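/- **Theorem 4.3 (representability).** Let $\mathbb P^1$ be the projective line over $\mathbb Z[1/2]$, and let $\mathrm{Rat}^{tm}_2$ be the open subscheme of the fivefold product $(\mathbb P^1)^5$ over $\mathbb Z[1/2]$, with non-homogeneous coordinates $(\omega_1,\omega_2,\omega_3,\xi_1,\xi_2)$, that is the complement of the locus $\xi_1=\xi_2$ and of the three loci $(\omega_j-\xi_1)(\omega_k-\xi_2)+(\omega_j-\xi_2)(\omega_k-\xi_1)=0$ for $1\le j<k\le 3$ (equations read in homogeneous coordinates, i.e. with $\omega-\xi$ replaced by $x_\omega y_\xi-x_\xi y_\omega$). For a scheme $S$ over $\mathbb Z[1/2]$ let $\underline{\mathrm{Rat}}^{tm}_2(S)$ be the set of tuples $(\phi,r_1,r_2,r_3,s_1,s_2)$ consisting of - an $S$-morphism $\phi:\mathbb P^1_S\to\mathbb P^1_S$ that is separable (on every fibre over a point of $S$ it is dominant and induces a separable extension of function fields) and of degree two (every point of $S$ has an open neighbourhood $W$ such that $\phi^*\mathcal O(1)\cong\mathcal O(2)$ over $\mathbb P^1_W$); - sections $r_1,r_2,r_3$ of $\mathbb P^1_S\to S$ with $\phi\circ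 r_i=r_i$ that list the fixed points of $\phi$ with multiplicity: $\mathrm{div}(r_1)+\mathrm{div}(r_2)+\mathrm{div}(r_3)=\mathrm{Fix}(\phi)$, where $\mathrm{Fix}(\phi)\subset\mathbb P^1_S$ is the equalizer of $\phi$ and the identity; - sections $s_1,s_2$ of $\mathbb P^1_S\to S$ with $\mathrm{div}(s_1)+\mathrm{div}(s_2)=R_\phi$, where $R_\phi$ is the ramification divisor of $\phi$, whose ideal sheaf is the annihilator of the sheaf $\Omega_\phi$ of relative differentials. Then these conditions are stable under base change, so that $\underline{\mathrm{Rat}}^{tm}_2$ is a functor $(\mathrm{Sch}/\mathbb Z[1/2])^{op}\to(\mathrm{Sets})$, and the scheme $\mathrm{Rat}^{tm}_2$ represents it, a tuple $(\phi,r_1,r_2,r_3,s_1,s_2)$ over $S$ corresponding to the $S$-valued point of $\mathrm{Rat}^{tm}_2\subset(\mathbb P^1)^5$ with coordinates $(r_1,r_2,r_3,s_1,s_2)$. In other words, $\mathrm{Rat}^{tm}_2$ is a fine moduli space for $\underline{\mathrm{Rat}}^{tm}_2$. -/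

import Mathlib

open CategoryTheory CategoryTheory.Limits AlgebraicGeometry Opposite

universe u

noncomputable section

namespace TotallyMarked

/-! ### Line bundles through transition functions -/

/-- Restriction of a section of the structure sheaf to a smaller open set. -/
def res {X : Scheme.{u}} {U V : X.Opens} (h : V ≤ U) : Γ(X, U) →+* Γ(X, V) :=
  (X.presheaf.map (homOfLE h).op).hom

/-- A line bundle on `X`, given by an open cover `U` and a multiplicative cocycle `g` of functions
on the overlaps. A section over an open set is a family of functions `s i`
on the sets `U i` with `s j = g i j * s i`. (The functions `g i j` are units, since
`g i j * g j i = g i i = 1` on the overlap.) -/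
structure LineBundle (X : Scheme.{u}) where
  ι : Type
  U : ι → X.Opens
  cover : ⨆ i, U i = ⊤
  g : ∀ i j, Γ(X, U i ⊓ U j)
  g_self : ∀ i, g i i = 1
  g_mul : ∀ i j k,
    res (V := U i ⊓ U j ⊓ U k) inf_le_left (g i j) *
      res (V := U i ⊓ U j ⊓ U k) (inf_le_inf_right _ inf_le_right) (g j k) =
      res (V := U i ⊓ U j ⊓ U k) (inf_le_inf_right _ inf_le_left) (g i k)

/-- The pullback `f^* L` of a line bundle. -/
def LineBundle.pullback {X Y : Scheme.{u}} (L : LineBundle Y) (f : X ⟶ Y) : LineBundle X where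
  ι := L.ι
  U i := f ⁻¹ᵁ L.U i
  cover := by
    rw [← Scheme.Hom.preimage_iSup, L.cover]; rfl
  g i j := (f.app (L.U i ⊓ L.U j)).hom (L.g i j)
  g_self i := by rw [L.g_self, map_one]; rfl
  g_mul i j k := by
    have nat : ∀ {U V : Y.Opens} (h : V ≤ U) (s : Γ(Y, U)),
        res (X := X) (U := f ⁻¹ᵁ U) (V := f ⁻¹ᵁ V) (f.preimage_mono h) ((f.app U).hom s) =
          (f.app V).hom (res h s) := by
      intro U V h s
      exact (congr($(f.naturality (homOfLE h).op).hom s)).symm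
    have := congrArg (f.app (L.U i ⊓ L.U j ⊓ L.U k)).hom (L.g_mul i j k)
    rw [map_mul, ← nat, ← nat, ← nat] at this
    exact this

/-- The line bundles `L` and `M` are isomorphic over the open set `W`: there are units `u i k` on
the sets `W ⊓ L.U i ⊓ M.U k` such that the maps `s i ↦ u i k * s i`
carry the transition functions of `L` into those of `M`. -/
def LineBundle.IsoOver {X : Scheme.{u}} (L M : LineBundle X) (W : X.Opens) : Prop :=
  ∃ u : ∀ i k, Γ(X, W ⊓ L.U i ⊓ M.U k)ˣ, ∀ i j k l,
    res (V := W ⊓ (L.U i ⊓ L.U j) ⊓ (M.U k ⊓ M.U l))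
        (inf_le_inf (inf_le_inf_left _ inf_le_right) inf_le_right) (u j l).val *
      res (inf_le_left.trans inf_le_right) (L.g i j) =
    res inf_le_right (M.g k l) *
      res (V := W ⊓ (L.U i ⊓ L.U j) ⊓ (M.U k ⊓ M.U l))
        (inf_le_inf (inf_le_inf_left _ inf_le_left) inf_le_left) (u i k).val

/-! ### The projective line -/

section ProjectiveLine

variable (R : Type u) [CommRing R]

/-- `R[X₀, X₁]` with its grading by degree. -/
abbrev grading : ℕ → Submodule R (MvPolynomial (Fin 2) R) :=
  MvPolynomial.homogeneousSubmodule (Fin 2) R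

instance : GradedAlgebra (grading R) := MvPolynomial.gradedAlgebra

theorem X_mem (a : Fin 2) : (MvPolynomial.X a : MvPolynomial (Fin 2) R) ∈ grading R 1 :=
  MvPolynomial.isHomogeneous_X R a

/-- The projective line over `R`. -/
def P1 : Scheme.{u} := Proj (grading R)

/-- The structure morphism of the projective line over `R`. -/
def P1.toSpec : P1 R ⟶ Spec (.of R) :=
  Proj.toSpecZero (grading R) ≫ Spec.map (CommRingCat.ofHom (algebraMap R (grading R 0)))

/-- The open subset of the projective line where `X_a` does not vanish. -/
def P1.chart (a : Fin 2) : (P1 R).Opens :=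
  Proj.basicOpen (grading R) (MvPolynomial.X a)

/-- The function `X_b / X_a` on the open set where `X_a` does not vanish. -/
def P1.coord (a b : Fin 2) : Γ(P1 R, P1.chart R a) :=
  (Proj.awayToSection (grading R) (MvPolynomial.X a)).hom
    (HomogeneousLocalization.Away.mk (grading R) (X_mem R a) 1 (MvPolynomial.X b)
      (by rw [one_smul]; exact X_mem R b))

theorem P1.coord_self (a : Fin 2) : P1.coord R a a = 1 := by
  refine Eq.trans (congrArg (Proj.awayToSection (grading R) (MvPolynomial.X a)).hom ?_) (map_one _)
  apply HomogeneousLocalization.val_injective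
  rw [HomogeneousLocalization.Away.val_mk, HomogeneousLocalization.val_one, ← Localization.mk_one,
    Localization.mk_eq_mk_iff, Localization.r_iff_exists]
  exact ⟨1, by simp⟩

theorem P1.coord_val (a b : Fin 2) (U : (P1 R).Opens) (h : U ≤ P1.chart R a) (p : U) :
    ((res h (P1.coord R a b)).val p).val = Localization.mk (MvPolynomial.X b)
      ⟨MvPolynomial.X a, h p.2⟩ := by
  refine (ProjectiveSpectrum.Proj.awayToSection_apply (𝒜 := grading R) (MvPolynomial.X a) _ ⟨p.1, h p.2⟩).trans ?_
  rw [HomogeneousLocalization.Away.val_mk, Localization.mk_eq_mk', IsLocalization.map_mk',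
    ← Localization.mk_eq_mk']
  congr 1
  apply Subtype.ext
  simp

theorem P1.coord_mul (a b c : Fin 2) (U : (P1 R).Opens) (ha : U ≤ P1.chart R a)
    (hb : U ≤ P1.chart R b) :
    res ha (P1.coord R a b) * res hb (P1.coord R b c) = res ha (P1.coord R a c) := by
  apply Subtype.ext
  funext p
  apply HomogeneousLocalization.val_injective
  refine (HomogeneousLocalization.val_mul _ _).trans ?_
  refine (congrArg₂ (· * ·) (P1.coord_val R a b U ha p) (P1.coord_val R b c U hb p)).trans ?_
  refine Eq.trans ?_ (P1.coord_val R a c U ha p).symm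
  dsimp only
  rw [Localization.mk_mul, Localization.mk_eq_mk_iff, Localization.r_iff_exists]
  refine ⟨1, ?_⟩
  simp
  ring

/-- The line bundle `𝒪(n)` on the projective line. A section `F` is given on the chart `a` by
`F / X_a ^ n`, so that the transition function from chart `a` to chart `b` is `(X_a / X_b) ^ n`. -/
def P1.twist (n : ℕ) : LineBundle (P1 R) where
  ι := Fin 2
  U := P1.chart R
  cover := by
    refine Proj.iSup_basicOpen_eq_top' (grading R) _
      (fun a => ⟨1, MvPolynomial.isHomogeneous_X R a⟩) ?_
    refine top_le_iff.mp fun x _ => ?_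
    have hx : x ∈ Algebra.adjoin R (Set.range (MvPolynomial.X : Fin 2 → _)) := by
      rw [MvPolynomial.adjoin_range_X]; trivial
    induction hx using Algebra.adjoin_induction with
    | mem x hx => exact Algebra.subset_adjoin hx
    | algebraMap r => exact Subalgebra.algebraMap_mem _ (algebraMap R (grading R 0) r)
    | add x y _ _ hx hy => exact add_mem (hx trivial) (hy trivial)
    | mul x y _ _ hx hy => exact mul_mem (hx trivial) (hy trivial)
  g a b := res inf_le_right (P1.coord R b a) ^ n
  g_self a := by rw [P1.coord_self, map_one, one_pow]
  g_mul a b c := by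
    have rr : ∀ {U V W : (P1 R).Opens} (h : V ≤ U) (k : W ≤ V) (s : Γ(P1 R, U)),
        res k (res h s) = res (k.trans h) s := fun h k s =>
      congr($((P1 R).presheaf.map_comp (homOfLE h).op (homOfLE k).op).hom s).symm
    rw [map_pow, map_pow, map_pow, rr, rr, rr, ← mul_pow, mul_comm,
      P1.coord_mul R c b a _ inf_le_right (inf_le_left.trans inf_le_right)]

/-! ### The projective line over a base and its endomorphisms -/

/-- The category of schemes over `Spec R`. -/
abbrev Sch : Type (u + 1) := Over (Spec (CommRingCat.of R))

variable {R}

/-- The projective line `ℙ¹_S` over `S`. -/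
def line (S : Sch R) : Scheme.{u} := Limits.pullback S.hom (P1.toSpec R)

/-- The structure morphism `ℙ¹_S ⟶ S`. -/
def line.proj (S : Sch R) : line S ⟶ S.left := pullback.fst _ _

/-- The projection from `ℙ¹_S` to `ℙ¹` over `R`. -/
def line.toP1 (S : Sch R) : line S ⟶ P1 R := pullback.snd _ _

/-- The line bundle `𝒪(n)` on `ℙ¹_S`. -/
def line.twist (S : Sch R) (n : ℕ) : LineBundle (line S) :=
  (P1.twist R n).pullback (line.toP1 S)

theorem line.condition (S : Sch R) : line.proj S ≫ S.hom = line.toP1 S ≫ P1.toSpec R :=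
  pullback.condition

/-- The morphism to `ℙ¹_S` with given components. -/
def line.lift (S : Sch R) {X : Scheme.{u}} (a : X ⟶ S.left) (b : X ⟶ P1 R)
    (h : a ≫ S.hom = b ≫ P1.toSpec R) : X ⟶ line S := pullback.lift a b h

@[simp] theorem line.lift_proj (S : Sch R) {X : Scheme.{u}} (a : X ⟶ S.left) (b : X ⟶ P1 R)
    (h : a ≫ S.hom = b ≫ P1.toSpec R) : line.lift S a b h ≫ line.proj S = a :=
  pullback.lift_fst _ _ _

@[simp] theorem line.lift_toP1 (S : Sch R) {X : Scheme.{u}} (a : X ⟶ S.left) (b : X ⟶ P1 R)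
    (h : a ≫ S.hom = b ≫ P1.toSpec R) : line.lift S a b h ≫ line.toP1 S = b :=
  pullback.lift_snd _ _ _

theorem line.hom_ext {S : Sch R} {X : Scheme.{u}} {a b : X ⟶ line S}
    (h₁ : a ≫ line.proj S = b ≫ line.proj S) (h₂ : a ≫ line.toP1 S = b ≫ line.toP1 S) : a = b :=
  pullback.hom_ext h₁ h₂

/-- The morphism `ℙ¹_T ⟶ ℙ¹_S` induced by `f : T ⟶ S`. -/
def line.map {T S : Sch R} (f : T ⟶ S) : line T ⟶ line S :=
  line.lift S (line.proj T ≫ f.left) (line.toP1 T) (by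
    rw [Category.assoc, Over.w, line.condition])

/-- An `S`-morphism `ℙ¹_S ⟶ ℙ¹_S`, together with three sections `r` and two sections `s` of
`ℙ¹_S ⟶ S`. -/
@[ext]
structure MarkedMap (S : Sch R) : Type u where
  φ : line S ⟶ line S
  φ_proj : φ ≫ line.proj S = line.proj S
  r : Fin 3 → (S.left ⟶ line S)
  r_proj : ∀ i, r i ≫ line.proj S = 𝟙 _
  s : Fin 2 → (S.left ⟶ line S)
  s_proj : ∀ j, s j ≫ line.proj S = 𝟙 _

/-- The base change of an `S`-endomorphism of `ℙ¹_S` along `f : T ⟶ S`. -/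
def baseChangeEnd {T S : Sch R} (f : T ⟶ S) (φ : line S ⟶ line S)
    (h : φ ≫ line.proj S = line.proj S) : line T ⟶ line T :=
  line.lift T (line.proj T) (line.map f ≫ φ ≫ line.toP1 S) (by
    rw [Category.assoc, Category.assoc, ← line.condition, reassoc_of% h, line.map,
      ← Category.assoc, line.lift_proj, Category.assoc, Over.w])

/-- The base change of a section of `ℙ¹_S ⟶ S` along `f : T ⟶ S`. -/
def baseChangeSection {T S : Sch R} (f : T ⟶ S) (r : S.left ⟶ line S)
    (h : r ≫ line.proj S = 𝟙 _) : T.left ⟶ line T :=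
  line.lift T (𝟙 _) (f.left ≫ r ≫ line.toP1 S) (by
    rw [Category.assoc, Category.assoc, ← line.condition, reassoc_of% h, Category.id_comp,
      Over.w])

/-- The base change of a marked map along `f : T ⟶ S`. -/
@[simps]
def MarkedMap.baseChange {T S : Sch R} (f : T ⟶ S) (x : MarkedMap S) : MarkedMap T where
  φ := baseChangeEnd f x.φ x.φ_proj
  φ_proj := line.lift_proj _ _ _ _
  r i := baseChangeSection f (x.r i) (x.r_proj i)
  r_proj _ := line.lift_proj _ _ _ _
  s j := baseChangeSection f (x.s j) (x.s_proj j)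
  s_proj _ := line.lift_proj _ _ _ _

theorem line.map_proj {T S : Sch R} (f : T ⟶ S) :
    line.map f ≫ line.proj S = line.proj T ≫ f.left := line.lift_proj _ _ _ _

theorem line.map_toP1 {T S : Sch R} (f : T ⟶ S) :
    line.map f ≫ line.toP1 S = line.toP1 T := line.lift_toP1 _ _ _ _

theorem line.map_id (S : Sch R) : line.map (𝟙 S) = 𝟙 _ :=
  line.hom_ext (by simp [line.map_proj]) (by simp [line.map_toP1])

theorem line.map_comp {U T S : Sch R} (g : U ⟶ T) (f : T ⟶ S) :
    line.map (g ≫ f) = line.map g ≫ line.map f :=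
  line.hom_ext (by
      rw [Category.assoc, line.map_proj, line.map_proj, reassoc_of% line.map_proj g, Over.comp_left])
    (by simp [line.map_toP1])

theorem MarkedMap.baseChange_id {S : Sch R} (x : MarkedMap S) : x.baseChange (𝟙 S) = x := by
  ext1
  · exact line.hom_ext ((line.lift_proj _ _ _ _).trans x.φ_proj.symm)
      ((line.lift_toP1 _ _ _ _).trans (by rw [line.map_id, Category.id_comp]))
  · funext i
    exact line.hom_ext ((line.lift_proj _ _ _ _).trans (x.r_proj i).symm)
      ((line.lift_toP1 _ _ _ _).trans (by rw [Over.id_left, Category.id_comp]))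
  · funext i
    exact line.hom_ext ((line.lift_proj _ _ _ _).trans (x.s_proj i).symm)
      ((line.lift_toP1 _ _ _ _).trans (by rw [Over.id_left, Category.id_comp]))

theorem MarkedMap.baseChange_comp {U T S : Sch R} (g : U ⟶ T) (f : T ⟶ S) (x : MarkedMap S) :
    x.baseChange (g ≫ f) = (x.baseChange f).baseChange g := by
  ext1
  · refine line.hom_ext ((line.lift_proj _ _ _ _).trans (line.lift_proj _ _ _ _).symm)
      ((line.lift_toP1 _ _ _ _).trans (Eq.trans ?_ (line.lift_toP1 _ _ _ _).symm))
    simp [baseChangeEnd, line.map_comp]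
  · funext i
    refine line.hom_ext ((line.lift_proj _ _ _ _).trans (line.lift_proj _ _ _ _).symm)
      ((line.lift_toP1 _ _ _ _).trans (Eq.trans ?_ (line.lift_toP1 _ _ _ _).symm))
    simp [baseChangeSection]
  · funext i
    refine line.hom_ext ((line.lift_proj _ _ _ _).trans (line.lift_proj _ _ _ _).symm)
      ((line.lift_toP1 _ _ _ _).trans (Eq.trans ?_ (line.lift_toP1 _ _ _ _).symm))
    simp [baseChangeSection]

variable (R) in
/-- The functor sending `S` to the set of all marked maps over `S`. -/
def markedMapFunctor : (Sch R)ᵒᵖ ⥤ Type u where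
  obj S := MarkedMap S.unop
  map f := ↾(MarkedMap.baseChange f.unop)
  map_id _ := ConcreteCategory.hom_ext _ _ fun x => MarkedMap.baseChange_id x
  map_comp f g := ConcreteCategory.hom_ext _ _ fun x => MarkedMap.baseChange_comp g.unop f.unop x

/-- The morphism `φ`, restricted to `ℙ¹` over the residue field at `p`. -/
def fibreEnd {S : Sch R} (φ : line S ⟶ line S) (h : φ ≫ line.proj S = line.proj S) (p : S.left) :
    line (Over.mk (S.left.fromSpecResidueField p ≫ S.hom)) ⟶
      line (Over.mk (S.left.fromSpecResidueField p ≫ S.hom)) :=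
  baseChangeEnd (Over.homMk (S.left.fromSpecResidueField p)) φ h

/-- A morphism of integral schemes is separable if it is dominant and induces a separable
extension of function fields. (The local ring at the generic point is the function field.) -/
def IsSeparableMorphism {X Y : Scheme.{u}} (ψ : X ⟶ Y) : Prop :=
  ∀ x : X, IsGenericPoint x Set.univ →
    IsGenericPoint (ψ x) Set.univ ∧
      letI := (ψ.stalkMap x).hom.toAlgebra
      Algebra.IsSeparable (Y.presheaf.stalk (ψ x)) (X.presheaf.stalk x)

/-- The ideal sheaf `I` on `X` defines the ramification divisor of `φ : X ⟶ Y`: on affine open sets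
it is the annihilator of the relative differentials `Ω_{X/Y}`. -/
def IsRamificationIdeal {X Y : Scheme.{u}} (φ : X ⟶ Y) (I : X.IdealSheafData) : Prop :=
  ∀ (U : X.affineOpens) (V : Y.affineOpens) (h : U.1 ≤ φ ⁻¹ᵁ V.1),
    letI := (φ.appLE V.1 U.1 h).hom.toAlgebra
    I.ideal U = Module.annihilator Γ(X, U.1) (Ω[Γ(X, U.1)⁄Γ(Y, V.1)])

/-- Totally marked degree two rational maps over `S`. -/
structure MarkedMap.IsTotallyMarked {S : Sch R} (x : MarkedMap S) : Prop where
  degree_two : ∀ p : S.left, ∃ W : S.left.Opens, p ∈ W ∧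
    ((line.twist S 1).pullback x.φ).IsoOver (line.twist S 2) (line.proj S ⁻¹ᵁ W)
  separable : ∀ p : S.left, IsSeparableMorphism (fibreEnd x.φ x.φ_proj p)
  fixed : ∀ i, x.r i ≫ x.φ = x.r i
  fixed_divisor : ∏ i, (x.r i).ker = (equalizer.ι x.φ (𝟙 (line S))).ker
  ramification : IsRamificationIdeal x.φ (∏ j, (x.s j).ker)

/-! ### The space of totally marked degree two rational maps -/

variable (R)

/-- The product `(ℙ¹)⁵` over `Spec R`. -/
def P1Five : Scheme.{u} :=
  widePullback (Spec (CommRingCat.of R)) (fun _ : Fin 5 => P1 R) (fun _ => P1.toSpec R)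

/-- The structure morphism of `(ℙ¹)⁵`. -/
def P1Five.toSpec : P1Five R ⟶ Spec (CommRingCat.of R) := WidePullback.base _

/-- The projections of `(ℙ¹)⁵`. -/
def P1Five.π (i : Fin 5) : P1Five R ⟶ P1 R := WidePullback.π _ i

/-- The open subset of `(ℙ¹)⁵` where the homogeneous coordinate `X_{ε i}` of the `i`-th point does
not vanish, for all `i`. -/
def P1Five.chart (ε : Fin 5 → Fin 2) : (P1Five R).Opens :=
  ⨅ i, P1Five.π R i ⁻¹ᵁ P1.chart R (ε i)

/-- The homogeneous coordinate `X_a` of the `i`-th point,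
when `X_{ε i}` is normalized to `1`. -/
def P1Five.coord (ε : Fin 5 → Fin 2) (i : Fin 5) (a : Fin 2) :
    Γ(P1Five R, P1Five.chart R ε) :=
  res (iInf_le _ i) (((P1Five.π R i).app (P1.chart R (ε i))).hom (P1.coord R (ε i) a))

/-- The difference of the `i`-th and the `j`-th point with denominators cleared:
`x_i y_j - x_j y_i` for the homogeneous coordinates `[x_i : y_i]` and `[x_j : y_j]`. -/
def P1Five.bracket (ε : Fin 5 → Fin 2) (i j : Fin 5) : Γ(P1Five R, P1Five.chart R ε) :=
  P1Five.coord R ε i 0 * P1Five.coord R ε j 1 - P1Five.coord R ε j 0 * P1Five.coord R ε i 1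

/-- The complement of the locus where the last two points coincide. -/
def P1Five.complC : (P1Five R).Opens :=
  ⨆ ε, (P1Five R).basicOpen (P1Five.bracket R ε 3 4)

/-- For `(ω₀, ω₁, ω₂, ξ₃, ξ₄)` in `(ℙ¹)⁵`, the complement of the locus where
`(ω_j - ξ₃) (ω_k - ξ₄) = - (ω_j - ξ₄) (ω_k - ξ₃)`. -/
def P1Five.complR (j k : Fin 5) : (P1Five R).Opens :=
  ⨆ ε, (P1Five R).basicOpen
    (P1Five.bracket R ε j 3 * P1Five.bracket R ε k 4 +
      P1Five.bracket R ε j 4 * P1Five.bracket R ε k 3)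

/-- The open subset of `(ℙ¹)⁵` underlying the space of totally marked degree two rational maps. -/
def ratTMOpen : (P1Five R).Opens :=
  P1Five.complC R ⊓ P1Five.complR R 1 2 ⊓ P1Five.complR R 0 2 ⊓ P1Five.complR R 0 1

/-- The space of totally marked degree two rational maps, as a scheme over `Spec R`. -/
def ratTM : Sch R := Over.mk ((ratTMOpen R).ι ≫ P1Five.toSpec R)

/-- The coordinates of the space of totally marked degree two rational maps. -/
def ratTM.point (i : Fin 5) : (ratTM R).left ⟶ P1 R := (ratTMOpen R).ι ≫ P1Five.π R i

end ProjectiveLine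

end TotallyMarked

end

/-! Write [x, y] for the bracket `br x y`, that is x₀y₁ − x₁y₀. In homogeneous coordinates a map of
degree two is a pair F of binary quadratic forms without common zero; its fixed points are the zeros
of the cubic form [x, F(x)], its critical points those of the Jacobian of F. Let a, b be the
critical points and ω₁, ω₂, ω₃ the fixed points. The Jacobian is apolar to both components of F
(`polar_eq_zero_of_jac`). As 2 is invertible, this makes [a, b] a unit (`isUnit_br_of_polar`), so
that F(x) = V [x, a]² + W [x, b]² for two vectors V, W. Expanding [a, b]³ ∏ [x, ω_j] in powers of
[x, a] and [x, b] and comparing with [x, V] [x, a]² + [x, W] [x, b]² gives V and W as polynomials in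
the five points; this is `stdForm`. The marked points determine F up to a unit
(`exists_unit_stdForm`), because an apolar pair whose cubic form vanishes is zero. Finally [V, W] is
[a, b] times the three pairings of the fixed points (`br_stdV_stdW`), and these four factors are the
equations removed from (ℙ¹)⁵.

The geometric conditions translate into this algebra on charts. Over an affine W the charts of ℙ¹_S
are polynomial rings (`line.scalar_bijective`). An isomorphism of φ^*𝒪(1) with 𝒪(2) yields F
(`line.exists_quadPair_of_isoOver`). Sections are cut out by linear forms (`line.ker_section`), the
fixed locus by the cubic form (`line.ker_equalizer`), and the annihilator of the differentials by
the Wronskian, which is half the Jacobian (`annKaehler_eq_span`). Equal ideals then give forms that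
differ by a unit of the base (`line.exists_unit_of_span_eq`). On fibres a nonzero Wronskian gives
dominance and separability (`line.isSeparableMorphism`).

Hence a marked map is totally marked exactly when its points are in general position and φ is the
standard map (`MarkedMap.isTotallyMarked_iff`). The second condition visibly pulls back. Standard
maps glue, because rescaling the coordinates of the points rescales `stdForm`; this gives a
universal map over `ratTM`, and any totally marked map is its pullback along the morphism given by
the five points. -/

noncomputable section

namespace TotallyMarked

/-! ### Pulling back functions -/

section Ev

variable {X Y Z : Scheme.{u}}

/-- Pullback of functions along a morphism, followed by restriction. -/
def ev (f : X ⟶ Y) {U : Y.Opens} {V : X.Opens} (h : V ≤ f ⁻¹ᵁ U) : Γ(Y, U) →+* Γ(X, V) :=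
  (f.appLE U V h).hom

theorem ev_congr {f g : X ⟶ Y} (e : f = g) {U : Y.Opens} {V : X.Opens} (h : V ≤ f ⁻¹ᵁ U)
    (s : Γ(Y, U)) : ev f h s = ev g (e ▸ h) s := by subst e; rfl

theorem res_res {U V W : X.Opens} (h : V ≤ U) (k : W ≤ V) (s : Γ(X, U)) :
    res k (res h s) = res (k.trans h) s :=
  congr($(X.presheaf.map_comp (homOfLE h).op (homOfLE k).op).hom s).symm

@[simp] theorem res_self {U : X.Opens} (h : U ≤ U) (s : Γ(X, U)) : res h s = s :=
  congr($(X.presheaf.map_id (op U)).hom s)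

theorem res_ev (f : X ⟶ Y) {U : Y.Opens} {V V' : X.Opens} (h : V ≤ f ⁻¹ᵁ U) (k : V' ≤ V)
    (s : Γ(Y, U)) : res k (ev f h s) = ev f (k.trans h) s :=
  congr($(f.appLE_map h (homOfLE k).op).hom s)

theorem ev_res (f : X ⟶ Y) {U U' : Y.Opens} {V : X.Opens} (h : V ≤ f ⁻¹ᵁ U') (k : U' ≤ U)
    (s : Γ(Y, U)) : ev f h (res k s) = ev f (h.trans (f.preimage_mono k)) s :=
  congr($(f.map_appLE h (homOfLE k).op).hom s)

theorem ev_ev (f : X ⟶ Y) (g : Y ⟶ Z) {U : Z.Opens} {V : Y.Opens} {W : X.Opens}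
    (h : V ≤ g ⁻¹ᵁ U) (k : W ≤ f ⁻¹ᵁ V) (s : Γ(Z, U)) :
    ev f k (ev g h s) = ev (f ≫ g) (k.trans (f.preimage_mono h)) s :=
  congr($(f.appLE_comp_appLE g U V W h k).hom s)

theorem app_eq_ev (f : X ⟶ Y) (U : Y.Opens) (s : Γ(Y, U)) :
    (f.app U).hom s = ev f le_rfl s := congr($(f.app_eq_appLE (U := U)).hom s)

theorem res_injective_of_eq {U V : X.Opens} (h : V ≤ U) (e : U ≤ V) :
    Function.Injective (res (X := X) h) := fun s t hst => by
  simpa [res_res] using congrArg (res e) hst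

theorem section_ext {U : X.Opens} {s t : Γ(X, U)}
    (H : ∀ x ∈ U, ∃ (V : X.Opens) (h : V ≤ U), x ∈ V ∧ res h s = res h t) : s = t := by
  refine X.IsSheaf.section_ext fun x hx => ?_
  obtain ⟨V, h, hxV, e⟩ := H x hx
  exact ⟨V, h, hxV, e⟩

theorem isUnit_of_locally {U : X.Opens} {s : Γ(X, U)}
    (H : ∀ x ∈ U, ∃ (V : X.Opens) (h : V ≤ U), x ∈ V ∧ IsUnit (res h s)) : IsUnit s := by
  have hU : U ≤ X.basicOpen s := fun x hx => by
    obtain ⟨V, h, hxV, e⟩ := H x hx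
    rw [Scheme.mem_basicOpen _ _ _ hx]
    have := e.map (X.presheaf.germ V x hxV).hom
    rwa [show (X.presheaf.germ V x hxV).hom (res h s) = (X.presheaf.germ U x hx).hom s from
      X.presheaf.germ_res_apply (homOfLE h) x hxV s] at this
  have := RingedSpace.isUnit_res_basicOpen X.toRingedSpace s
  have e : X.basicOpen s = U := le_antisymm (X.basicOpen_le s) hU
  have h2 := this.map (res (X := X) hU)
  have h3 : IsUnit (res (X := X) hU (res (X.basicOpen_le s) s)) := h2
  rwa [res_res, res_self] at h3

theorem isUnit_res_basicOpen {U : X.Opens} (s : Γ(X, U)) :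
    IsUnit (res (X.basicOpen_le s) s) :=
  RingedSpace.isUnit_res_basicOpen X.toRingedSpace s

theorem le_basicOpen_iff {U V : X.Opens} (h : V ≤ U) (s : Γ(X, U)) :
    V ≤ X.basicOpen s ↔ IsUnit (res h s) := by
  constructor
  · intro hV
    have := (isUnit_res_basicOpen s).map (res hV)
    rwa [res_res] at this
  · intro hu
    have e : X.basicOpen (res h s) = V ⊓ X.basicOpen s := X.basicOpen_res s (homOfLE h).op
    rw [X.basicOpen_of_isUnit hu] at e
    exact e ▸ inf_le_right

theorem basicOpen_ev (f : X ⟶ Y) {U : Y.Opens} {V : X.Opens} (h : V ≤ f ⁻¹ᵁ U) (s : Γ(Y, U)) :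
    X.basicOpen (ev f h s) = V ⊓ f ⁻¹ᵁ Y.basicOpen s := Scheme.basicOpen_appLE f V U h s

end Ev

/-! ### Charts of the projective line -/

section Charts

variable (R : Type u) [CommRing R]

theorem P1.iSup_chart : ⨆ i, P1.chart R i = ⊤ := (P1.twist R 0).cover

variable {R} in
theorem P1.exists_mem_chart (x : P1 R) : ∃ i, x ∈ P1.chart R i := by
  have : x ∈ ⨆ i, P1.chart R i := by rw [P1.iSup_chart]; trivial
  simpa using this

theorem P1.isAffineOpen_chart (i : Fin 2) : IsAffineOpen (P1.chart R i) :=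
  Proj.isAffineOpen_basicOpen (grading R) _ (X_mem R i) one_pos

/-- At a point p the germ of X_j / X_i is a fraction in the localization at p, invertible only if
its numerator lies outside p. On the overlap X_i / X_j is an inverse. -/
theorem P1.basicOpen_coord (i j : Fin 2) :
    (P1 R).basicOpen (P1.coord R i j) = P1.chart R i ⊓ P1.chart R j := by
  apply le_antisymm
  · refine le_inf ((P1 R).basicOpen_le _) fun p hp => ?_
    obtain ⟨s, hs⟩ := (isUnit_res_basicOpen (P1.coord R i j)).exists_left_inv
    have h1 := (HomogeneousLocalization.val_mul _ _).symm.trans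
      ((congrArg HomogeneousLocalization.val (congrFun (congrArg Subtype.val hs) ⟨p, hp⟩)).trans
        (HomogeneousLocalization.val_one (𝒜 := grading R)))
    replace h1 := (congrArg _ (P1.coord_val R i j _ ((P1 R).basicOpen_le _) ⟨p, hp⟩)).symm.trans h1
    have h2 := IsUnit.of_mul_eq_one_right _ h1
    rw [Localization.mk_eq_mk', IsLocalization.AtPrime.isUnit_mk'_iff] at h2
    exact h2
  · rw [le_basicOpen_iff inf_le_left]
    refine IsUnit.of_mul_eq_one (res inf_le_right (P1.coord R j i)) ?_
    rw [P1.coord_mul, P1.coord_self, map_one]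

/-- The structure map of functions on the chart `i` of `ℙ¹`. -/
def P1.scalar (i : Fin 2) : R →+* Γ(P1 R, P1.chart R i) :=
  (ev (P1.toSpec R) (U := ⊤) (V := P1.chart R i) le_top).comp
    (Scheme.ΓSpecIso (.of R)).inv.hom

variable {R} in
theorem eval₂_mul_of_isHomogeneous {A : Type*} [CommRing A] (φ : R →+* A) (c : A) (v : Fin 2 → A)
    {n : ℕ} {x : MvPolynomial (Fin 2) R} (hx : x.IsHomogeneous n) :
    MvPolynomial.eval₂ φ (fun j => c * v j) x = c ^ n * MvPolynomial.eval₂ φ v x := by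
  rw [MvPolynomial.eval₂_eq', MvPolynomial.eval₂_eq', Finset.mul_sum]
  refine Finset.sum_congr rfl fun d hd => ?_
  have hd' : ∑ j, d j = n := by
    rw [← hx (MvPolynomial.mem_support_iff.mp hd)]
    simp [Finsupp.weight_apply, Finsupp.sum_fintype]
  simp_rw [mul_pow, Finset.prod_mul_distrib, Finset.prod_pow_eq_pow_sum, hd']
  ring

/-- Evaluation of a polynomial at the coordinate on the chart `i`. -/
def P1.chartAway (i : Fin 2) :
    Polynomial R →+* HomogeneousLocalization.Away (grading R) (MvPolynomial.X i) :=
  Polynomial.eval₂RingHom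
    ((HomogeneousLocalization.fromZeroRingHom (grading R) _).comp (algebraMap R (grading R 0)))
    (HomogeneousLocalization.Away.mk (grading R) (X_mem R i) 1 (MvPolynomial.X (1 - i))
      (by rw [one_smul]; exact X_mem R _))

/-- Dehomogenization (X_i ↦ 1, the other variable ↦ X) extends to the localization and is a left
inverse. Surjectivity holds because a form x of degree n satisfies x = X_i ^ n · x(u), where u is
the vector of the fractions X_j / X_i. -/
theorem P1.chartAway_bijective (i : Fin 2) : Function.Bijective (P1.chartAway R i) := by
  let L := Localization.Away (MvPolynomial.X i : MvPolynomial (Fin 2) R)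
  let φ : MvPolynomial (Fin 2) R →+* L := algebraMap _ _
  let ι : HomogeneousLocalization.Away (grading R) (MvPolynomial.X i) →+* L := algebraMap _ _
  let u : Fin 2 → L := fun j =>
    Localization.mk (MvPolynomial.X j) ⟨MvPolynomial.X i, Submonoid.mem_powers _⟩
  have hu : ∀ j, φ (MvPolynomial.X i) * u j = φ (MvPolynomial.X j) := fun j => by
    simp only [φ, u]
    rw [← Localization.mk_one_eq_algebraMap, ← Localization.mk_one_eq_algebraMap,
      Localization.mk_mul, Localization.mk_eq_mk_iff, Localization.r_iff_exists]
    exact ⟨1, by simp⟩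
  have hui : IsUnit (φ (MvPolynomial.X i)) := IsLocalization.Away.algebraMap_isUnit _
  have hu1 : u i = 1 := by
    refine hui.mul_left_cancel ?_
    rw [hu, mul_one]
  let g : MvPolynomial (Fin 2) R →+* Polynomial R :=
    MvPolynomial.eval₂Hom Polynomial.C (fun j => if j = i then 1 else Polynomial.X)
  have hgi : g (MvPolynomial.X i) = 1 := by simp [g]
  have hij : 1 - i ≠ i := by fin_cases i <;> decide
  let G : L →+* Polynomial R :=
    IsLocalization.Away.lift (MvPolynomial.X i) (g := g) (by rw [hgi]; exact isUnit_one)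
  have hG : ∀ x, G (φ x) = g x := fun x => IsLocalization.Away.lift_eq _ _ _
  have hC : ∀ r, ι (P1.chartAway R i (Polynomial.C r)) = φ (MvPolynomial.C r) := fun r => by
    simp only [P1.chartAway, Polynomial.coe_eval₂RingHom, Polynomial.eval₂_C]
    exact Localization.mk_one_eq_algebraMap _
  have hX : ι (P1.chartAway R i Polynomial.X) = u (1 - i) := by
    simp only [P1.chartAway, Polynomial.coe_eval₂RingHom, Polynomial.eval₂_X]
    refine (HomogeneousLocalization.Away.val_mk (𝒜 := grading R) 1 (X_mem R i)
      (MvPolynomial.X (1 - i)) (by rw [one_smul]; exact X_mem R _)).trans ?_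
    simp only [u, pow_one]
  constructor
  · have hGc : (G.comp ι).comp (P1.chartAway R i) = RingHom.id _ := by
      refine Polynomial.ringHom_ext (fun r => ?_) ?_
      · simp only [RingHom.comp_apply, hC, hG, RingHom.id_apply]
        simp [g]
      · simp only [RingHom.comp_apply, hX, RingHom.id_apply]
        have := congrArg G (hu (1 - i))
        rw [map_mul, hG, hG, hgi, one_mul] at this
        rw [this]
        simp [g, hij]
    exact Function.LeftInverse.injective (g := G.comp ι) (fun p => congr($hGc p))
  · intro z
    obtain ⟨n, x, hx, rfl⟩ := HomogeneousLocalization.Away.mk_surjective (grading R) (X_mem R i) z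
    refine ⟨g x, HomogeneousLocalization.val_injective _ ?_⟩
    have key : (ι.comp (P1.chartAway R i)).comp g = MvPolynomial.eval₂Hom (φ.comp MvPolynomial.C) u := by
      refine MvPolynomial.ringHom_ext (fun r => ?_) fun j => ?_
      · simp only [RingHom.comp_apply]
        simp only [g, MvPolynomial.coe_eval₂Hom, MvPolynomial.eval₂_C, RingHom.comp_apply, hC]
      · simp only [RingHom.comp_apply]
        simp only [g, MvPolynomial.coe_eval₂Hom, MvPolynomial.eval₂_X]
        split_ifs with h
        · rw [map_one, map_one, h, hu1]
        · rw [hX]; congr 1; revert h; fin_cases i <;> fin_cases j <;> decide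
    rw [smul_eq_mul, mul_one] at hx
    have e : φ x = φ (MvPolynomial.X i) ^ n * MvPolynomial.eval₂ (φ.comp MvPolynomial.C) u x := by
      rw [← eval₂_mul_of_isHomogeneous _ _ _ ((MvPolynomial.mem_homogeneousSubmodule _ _).mp hx)]
      simp_rw [hu]
      exact congr($(MvPolynomial.ringHom_ext (f := φ) (g := MvPolynomial.eval₂Hom (φ.comp MvPolynomial.C)
        fun j => φ (MvPolynomial.X j)) (fun r => by simp) (fun j => by simp)) x)
    refine (congr($key x)).trans ?_
    refine (hui.pow n).mul_left_cancel (e.symm.trans ?_)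
    rw [HomogeneousLocalization.Away.val_mk, ← map_pow]
    simp only [φ]
    rw [← Localization.mk_one_eq_algebraMap, ← Localization.mk_one_eq_algebraMap,
      Localization.mk_mul, Localization.mk_eq_mk_iff, Localization.r_iff_exists]
    exact ⟨1, by simp⟩

/-- A ring receives at most one homomorphism from ℤ[1/2], so compatibility with the base is
automatic throughout. -/
theorem away_two_ringHom_ext [IsLocalization.Away (2 : ℤ) R] {A : Type*} [CommRing A]
    (f g : R →+* A) : f = g :=
  IsLocalization.ringHom_ext (Submonoid.powers (2 : ℤ)) (RingHom.ext_int _ _)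

theorem toSpec_ext [IsLocalization.Away (2 : ℤ) R] {X : Scheme.{u}} (f g : X ⟶ Spec (.of R)) :
    f = g := by
  refine ext_of_isAffine ?_
  ext1
  have := away_two_ringHom_ext R (f.appTop.hom.comp (Scheme.ΓSpecIso (.of R)).inv.hom)
    (g.appTop.hom.comp (Scheme.ΓSpecIso (.of R)).inv.hom)
  ext x
  have h := congr($this ((Scheme.ΓSpecIso (.of R)).hom x))
  simpa using h

variable [IsLocalization.Away (2 : ℤ) R]

/-- Any `α` is allowed, since it must coincide with the structure map. -/
theorem P1.chart_bijective (i : Fin 2) (α : R →+* Γ(P1 R, P1.chart R i)) :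
    Function.Bijective (Polynomial.eval₂RingHom α (P1.coord R i (1 - i))) := by
  let ψ : HomogeneousLocalization.Away (grading R) (MvPolynomial.X i) →+* Γ(P1 R, P1.chart R i) :=
    (Proj.awayToSection (grading R) (MvPolynomial.X i)).hom
  have h : Function.Bijective ψ := ConcreteCategory.bijective_of_isIso
      (Proj.basicOpenIsoAway (grading R) (MvPolynomial.X i) (X_mem R i) one_pos).hom
  have e : Polynomial.eval₂RingHom α (P1.coord R i (1 - i)) = ψ.comp (P1.chartAway R i) := by
    refine Polynomial.ringHom_ext (fun r => ?_) ?_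
    · exact congr($(away_two_ringHom_ext R ((Polynomial.eval₂RingHom α (P1.coord R i (1 - i))).comp
        Polynomial.C) ((ψ.comp (P1.chartAway R i)).comp Polynomial.C)) r)
    · rw [RingHom.comp_apply, P1.chartAway, Polynomial.coe_eval₂RingHom, Polynomial.eval₂_X,
        Polynomial.coe_eval₂RingHom, Polynomial.eval₂_X]
      rfl
  rw [e, RingHom.coe_comp]
  exact h.comp (P1.chartAway_bijective R i)

end Charts

/-! ### Homogeneous coordinates of morphisms to the projective line -/

section Coords

/-- The bracket `x₀ y₁ - x₁ y₀` of two vectors. -/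
def br {A : Type*} [CommRing A] (x y : Fin 2 → A) : A := x 0 * y 1 - x 1 * y 0

theorem map_br {A B : Type*} [CommRing A] [CommRing B] (φ : A →+* B) (x y : Fin 2 → A) :
    φ (br x y) = br (fun i => φ (x i)) (fun i => φ (y i)) := by simp [br]

theorem mul_comm_of_br_eq_zero {A : Type*} [CommRing A] {x y : Fin 2 → A} (h : br x y = 0)
    (i j : Fin 2) : x i * y j = x j * y i := by
  rw [br, sub_eq_zero] at h
  fin_cases i <;> fin_cases j <;> first | rfl | exact h | exact h.symm

theorem br_eq_zero_of_mul_comm {A : Type*} [CommRing A] {x y : Fin 2 → A}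
    (h : x 0 * y 1 = x 1 * y 0) : br x y = 0 := sub_eq_zero.mpr h

/-- Unimodular vectors with vanishing bracket differ by a unit. -/
theorem exists_unit_of_br_eq_zero {A : Type*} [CommRing A] {x y : Fin 2 → A}
    (hx : IsCoprime (x 0) (x 1)) (hy : IsCoprime (y 0) (y 1)) (h : br x y = 0) :
    ∃ c : Aˣ, ∀ i, y i = c * x i := by
  obtain ⟨u, v, hu⟩ := hx
  obtain ⟨s, t, hs⟩ := hy
  have h := sub_eq_zero.mp h
  -- If y = c x, then applying the functional (u, v), which is 1 on x, forces this value of c; the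
  -- inverse arises in the same way from (s, t).
  refine ⟨⟨u * y 0 + v * y 1, s * x 0 + t * x 1, ?_, ?_⟩, fun i => ?_⟩
  · linear_combination hu + (u * x 0 + v * x 1) * hs - (u * t - v * s) * h
  · linear_combination hu + (u * x 0 + v * x 1) * hs - (u * t - v * s) * h
  · fin_cases i
    · simp
      linear_combination -y 0 * hu - v * h
    · simp
      linear_combination -y 1 * hu + u * h

theorem isCoprime_of_isUnit {A : Type*} [CommRing A] {x : Fin 2 → A} {i : Fin 2}
    (h : IsUnit (x i)) : IsCoprime (x 0) (x 1) := by
  obtain ⟨c, hc⟩ := h.exists_left_inv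
  match i, hc with
  | 0, hc => exact ⟨c, 0, by rw [hc, zero_mul, add_zero]⟩
  | 1, hc => exact ⟨0, c, by rw [hc, zero_mul, zero_add]⟩

theorem br_eq_zero_of_mul_comm' {A : Type*} [CommRing A] {x y : Fin 2 → A} {i : Fin 2}
    (h : x i * y (1 - i) = x (1 - i) * y i) : br x y = 0 := by
  match i, h with
  | 0, h => exact sub_eq_zero.mpr h
  | 1, h => exact sub_eq_zero.mpr h.symm

variable {R : Type u} [CommRing R] {T T' : Scheme.{u}}

/-- The vector of functions `a` on `U` is a vector of homogeneous coordinates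
of the morphism `f` to the projective line. -/
structure HasCoords (f : T ⟶ P1 R) (U : T.Opens) (a : Fin 2 → Γ(T, U)) : Prop where
  coprime : IsCoprime (a 0) (a 1)
  eq : ∀ (i j : Fin 2) (V : T.Opens) (hU : V ≤ U) (hf : V ≤ f ⁻¹ᵁ P1.chart R i),
    res hU (a j) = res hU (a i) * ev f hf (P1.coord R i j)

variable {f g : T ⟶ P1 R} {U : T.Opens} {a b : Fin 2 → Γ(T, U)}

theorem HasCoords.comp (h : HasCoords f U a) (k : T' ⟶ T) {V : T'.Opens} (hV : V ≤ k ⁻¹ᵁ U) :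
    HasCoords (k ≫ f) V (fun i => ev k hV (a i)) where
  coprime := h.coprime.map _
  eq i j W hU hf := by
    have hW : W ≤ k ⁻¹ᵁ (U ⊓ f ⁻¹ᵁ P1.chart R i) := fun x hx => ⟨hV (hU hx), hf hx⟩
    have := congrArg (ev k hW) (h.eq i j (U ⊓ f ⁻¹ᵁ P1.chart R i) inf_le_left inf_le_right)
    rwa [map_mul, ev_res, ev_res, ev_ev, ← res_ev k hV hU, ← res_ev k hV hU] at this

theorem HasCoords.restrict (h : HasCoords f U a) {V : T.Opens} (hV : V ≤ U) :
    HasCoords f V (fun i => res hV (a i)) where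
  coprime := h.coprime.map _
  eq i j W hU hf := by rw [res_res, res_res]; exact h.eq i j W _ hf

theorem HasCoords.congr_hom (h : HasCoords f U a) (e : f = g) : HasCoords g U a := e ▸ h

theorem P1.hasCoords (i : Fin 2) : HasCoords (𝟙 (P1 R)) (P1.chart R i) (P1.coord R i) where
  coprime := isCoprime_of_isUnit (i := i) (by rw [P1.coord_self]; exact isUnit_one)
  eq j k V hU hf := by
    have e : ev (𝟙 (P1 R)) hf (P1.coord R j k) =
        res (show V ≤ P1.chart R j from hf) (P1.coord R j k) := by
      simp [ev, Scheme.Hom.appLE, res]; rfl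
    rw [e, P1.coord_mul]

theorem hasCoords_chart (f : T ⟶ P1 R) (i : Fin 2) :
    HasCoords f (f ⁻¹ᵁ P1.chart R i) (fun j => ev f le_rfl (P1.coord R i j)) := by
  have := (P1.hasCoords (R := R) i).comp f le_rfl
  rwa [Category.comp_id] at this

theorem br_ev_eq_zero {Z : Scheme.{u}} {q q' : Z ⟶ T} (hq : q = q') {V : T.Opens}
    {b : Fin 2 → Γ(T, V)}
    (h : br (fun k => res (inf_le_left : U ⊓ V ≤ _) (a k)) (fun k => res inf_le_right (b k)) = 0)
    {W : Z.Opens} (h1 : W ≤ q ⁻¹ᵁ U) (h2 : W ≤ q' ⁻¹ᵁ V) :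
    br (fun k => ev q h1 (a k)) (fun k => ev q' h2 (b k)) = 0 := by
  subst hq
  have h3 : W ≤ q ⁻¹ᵁ (U ⊓ V) := fun x hx => ⟨h1 hx, h2 hx⟩
  have e := congrArg (ev q h3) h
  rw [map_zero, map_br] at e
  simp_rw [ev_res] at e
  exact e

theorem exists_mem_basicOpen (ha : IsCoprime (a 0) (a 1)) {x : T} (hx : x ∈ U) :
    ∃ j, x ∈ T.basicOpen (a j) := by
  simp_rw [Scheme.mem_basicOpen _ _ _ hx]
  obtain ⟨u, v, h⟩ := ha.map (T.presheaf.germ U x hx).hom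
  rcases IsLocalRing.isUnit_or_isUnit_of_add_one h with h | h
  · exact ⟨0, isUnit_of_mul_isUnit_right h⟩
  · exact ⟨1, isUnit_of_mul_isUnit_right h⟩

/-- Where a_i is invertible, the relation a_i = a_j · X_i / X_j on chart j makes X_i / X_j
invertible, so `f` lands in chart i. Conversely, over chart i both entries are multiples of a_i, and
they generate the unit ideal. -/
theorem HasCoords.basicOpen_eq (h : HasCoords f U a) (i : Fin 2) :
    T.basicOpen (a i) = U ⊓ f ⁻¹ᵁ P1.chart R i := by
  apply le_antisymm
  · refine le_inf (T.basicOpen_le _) fun p hp => ?_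
    obtain ⟨j, hj⟩ := P1.exists_mem_chart (f p)
    let V : T.Opens := T.basicOpen (a i) ⊓ f ⁻¹ᵁ P1.chart R j
    have hV : V ≤ U := inf_le_left.trans (T.basicOpen_le _)
    have e := h.eq j i V hV inf_le_right
    have hu : IsUnit (res hV (a i)) := (le_basicOpen_iff hV _).mp inf_le_left
    rw [e] at hu
    have hu2 := T.basicOpen_of_isUnit (isUnit_of_mul_isUnit_right hu)
    rw [basicOpen_ev, P1.basicOpen_coord] at hu2
    have hpV : p ∈ V := ⟨hp, hj⟩
    rw [← hu2] at hpV
    exact hpV.2.2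
  · rw [le_basicOpen_iff inf_le_left]
    obtain ⟨u, v, huv⟩ := h.coprime.map (res (inf_le_left : U ⊓ f ⁻¹ᵁ P1.chart R i ≤ U))
    rw [h.eq i 0 _ inf_le_left inf_le_right, h.eq i 1 _ inf_le_left inf_le_right] at huv
    refine IsUnit.of_mul_eq_one (u * ev f inf_le_right (P1.coord R i 0) +
      v * ev f inf_le_right (P1.coord R i 1)) ?_
    rw [← huv]; ring

theorem HasCoords.br_eq_zero (ha : HasCoords f U a) (hb : HasCoords f U b) : br a b = 0 := by
  refine br_eq_zero_of_mul_comm (section_ext fun x hx => ?_)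
  obtain ⟨i, hi⟩ := P1.exists_mem_chart (f x)
  refine ⟨U ⊓ f ⁻¹ᵁ P1.chart R i, inf_le_left, ⟨hx, hi⟩, ?_⟩
  rw [map_mul, map_mul, ha.eq i 0 _ _ inf_le_right, ha.eq i 1 _ _ inf_le_right,
    hb.eq i 0 _ _ inf_le_right, hb.eq i 1 _ _ inf_le_right]
  ring

/-- Over chart i the entry a_i is a unit and cancels from a_i b_j = a_j b_i. Equality of morphisms
to ℙ¹ thereby becomes the vanishing of a bracket. -/
theorem HasCoords.of_br_eq_zero (ha : HasCoords f U a) (hb : IsCoprime (b 0) (b 1))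
    (h : br a b = 0) : HasCoords f U b where
  coprime := hb
  eq i j V hU hf := by
    have hu : IsUnit (res hU (a i)) :=
      (le_basicOpen_iff hU _).mp (by rw [ha.basicOpen_eq]; exact le_inf hU hf)
    have e := congrArg (res hU) (mul_comm_of_br_eq_zero h i j)
    rw [map_mul, map_mul, ha.eq i j _ hU hf] at e
    refine hu.mul_left_cancel ?_
    rw [e]; ring

theorem HasCoords.exists_unit (ha : HasCoords f U a) (hb : HasCoords f U b) :
    ∃ c : Γ(T, U)ˣ, ∀ i, b i = c * a i :=
  exists_unit_of_br_eq_zero ha.coprime hb.coprime (ha.br_eq_zero hb)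

theorem HasCoords.of_locally (hb : IsCoprime (b 0) (b 1))
    (H : ∀ x ∈ U, ∃ (V : T.Opens) (h : V ≤ U), x ∈ V ∧ HasCoords f V (fun i => res h (b i))) :
    HasCoords f U b where
  coprime := hb
  eq i j W hU hf := section_ext fun x hx => by
    obtain ⟨V, h, hxV, e⟩ := H x (hU hx)
    refine ⟨W ⊓ V, inf_le_left, ⟨hx, hxV⟩, ?_⟩
    have := e.eq i j (W ⊓ V) inf_le_right (inf_le_left.trans hf)
    rw [map_mul, res_res, res_res, res_ev]
    rwa [res_res, res_res] at this

theorem ev_ι_injective {V V' : T.Opens} (h : V' ≤ V) :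
    Function.Injective (ev V.ι (le_refl (V.ι ⁻¹ᵁ V'))) := by
  have e : V' ≤ V.ι ''ᵁ (V.ι ⁻¹ᵁ V') := fun x hx => ⟨⟨x, h hx⟩, hx, rfl⟩
  have h2 : V.ι ''ᵁ (V.ι ⁻¹ᵁ V') ≤ V' := by rintro _ ⟨x, hx, rfl⟩; exact hx
  rw [show ev V.ι (le_refl (V.ι ⁻¹ᵁ V')) = res h2 from congrArg CommRingCat.Hom.hom (V.ι_appLE _ _ _)]
  exact res_injective_of_eq h2 e

theorem HasCoords.of_ι {h : ⊤ ≤ U.ι ⁻¹ᵁ U} (ha : IsCoprime (a 0) (a 1))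
    (H : HasCoords (U.ι ≫ f) ⊤ (fun i => ev U.ι h (a i))) : HasCoords f U a where
  coprime := ha
  eq i j V hU hf := by
    refine ev_ι_injective hU ?_
    have := H.eq i j (U.ι ⁻¹ᵁ V) le_top (U.ι.preimage_mono hf)
    rw [map_mul, ev_res, ev_res, ev_ev]
    rwa [res_ev, res_ev] at this

theorem ι_comp_eq {X Y : Scheme.{u}} (f : X ⟶ Y) {U : Y.Opens} (hU : IsAffineOpen U) {V : X.Opens}
    (h : V ≤ f ⁻¹ᵁ U) : V.ι ≫ f = V.toSpecΓ ≫ Spec.map (f.appLE U V h) ≫ hU.fromSpec := by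
  rw [Scheme.Opens.toSpecΓ_SpecMap_appLE_assoc, IsAffineOpen.toSpecΓ_fromSpec,
    Scheme.Hom.resLE_comp_ι]

theorem toSpecΓ_SpecMap_injective {X : Scheme.{u}} {A : CommRingCat.{u}} {β γ : A ⟶ Γ(X, ⊤)}
    (h : X.toSpecΓ ≫ Spec.map β = X.toSpecΓ ≫ Spec.map γ) : β = γ := by
  have := congrArg (fun k => (Scheme.ΓSpecIso A).inv ≫ Scheme.Hom.appTop k) h
  simpa using this

theorem hom_ext_of_locally {X Y : Scheme.{u}} {f g : X ⟶ Y}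
    (H : ∀ x, ∃ V : X.Opens, x ∈ V ∧ V.ι ≫ f = V.ι ≫ g) : f = g := by
  choose V hV e using H
  exact Scheme.Cover.hom_ext (X.openCoverOfIsOpenCover V
    (top_le_iff.mp fun x _ => TopologicalSpace.Opens.mem_iSup.mpr ⟨x, hV x⟩)) _ _ e

theorem comp_eq_of_le {X Y Z : Scheme.{u}} {f g : X ⟶ Y} {V : X.Opens} (h : V.ι ≫ f = V.ι ≫ g)
    (k : Z ⟶ X) (hk : ⊤ ≤ k ⁻¹ᵁ V) : k ≫ f = k ≫ g := by
  have hr : Set.range k ⊆ Set.range V.ι := by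
    rw [V.range_ι]; rintro _ ⟨z, rfl⟩; exact hk trivial
  rw [← IsOpenImmersion.lift_fac V.ι k hr, Category.assoc, Category.assoc, h]

theorem ι_comp_eq_of_locally {X Y : Scheme.{u}} {f g : X ⟶ Y} {U : X.Opens}
    (H : ∀ x ∈ U, ∃ V : X.Opens, x ∈ V ∧ V.ι ≫ f = V.ι ≫ g) : U.ι ≫ f = U.ι ≫ g := by
  refine hom_ext_of_locally fun x => ?_
  obtain ⟨V, hxV, e⟩ := H x.1 x.2
  refine ⟨U.ι ⁻¹ᵁ V, hxV, ?_⟩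
  rw [← Category.assoc, ← Category.assoc]
  exact comp_eq_of_le e _ fun y _ => y.2

variable [IsLocalization.Away (2 : ℤ) R]

theorem P1.chart_ringHom_ext (i : Fin 2) {A : Type*} [CommRing A] {α β : Γ(P1 R, P1.chart R i) →+* A}
    (h : α (P1.coord R i (1 - i)) = β (P1.coord R i (1 - i))) : α = β := by
  have hs := (P1.chart_bijective R i (P1.scalar R i)).2
  refine RingHom.cancel_right hs |>.mp (Polynomial.ringHom_ext (fun r => ?_) ?_)
  · exact congr($(away_two_ringHom_ext R ((α.comp (Polynomial.eval₂RingHom _ _)).comp Polynomial.C)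
      ((β.comp (Polynomial.eval₂RingHom _ _)).comp Polynomial.C)) r)
  · simpa using h

/-- Where a_i is invertible both morphisms land in the affine chart i, and both pull its coordinate
back to a_{1-i} / a_i. -/
theorem HasCoords.ι_comp_eq (hf : HasCoords f U a) (hg : HasCoords g U a) : U.ι ≫ f = U.ι ≫ g := by
  refine ι_comp_eq_of_locally fun x hx => ?_
  obtain ⟨i, hi⟩ := P1.exists_mem_chart (f x)
  have h1 : T.basicOpen (a i) ≤ f ⁻¹ᵁ P1.chart R i := (hf.basicOpen_eq i).le.trans inf_le_right
  have h2 : T.basicOpen (a i) ≤ g ⁻¹ᵁ P1.chart R i := (hg.basicOpen_eq i).le.trans inf_le_right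
  refine ⟨T.basicOpen (a i), by rw [hf.basicOpen_eq]; exact ⟨hx, hi⟩, ?_⟩
  rw [TotallyMarked.ι_comp_eq f (P1.isAffineOpen_chart R i) h1,
    TotallyMarked.ι_comp_eq g (P1.isAffineOpen_chart R i) h2]
  congr 3
  ext1
  refine P1.chart_ringHom_ext i ?_
  change ev f h1 _ = ev g h2 _
  refine (isUnit_res_basicOpen (a i)).mul_left_cancel ?_
  rw [← hf.eq i _ _ (T.basicOpen_le _) h1, ← hg.eq i _ _ (T.basicOpen_le _) h2]

theorem HasCoords.ι_comp_eq' (hf : HasCoords f U a) (hg : HasCoords g U b) (h : br a b = 0) :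
    U.ι ≫ f = U.ι ≫ g :=
  (hf.of_br_eq_zero hg.coprime h).ι_comp_eq hg

theorem hom_ext_of_hasCoords {a b : Fin 2 → Γ(T, ⊤)} (hf : HasCoords f ⊤ a) (hg : HasCoords g ⊤ b)
    (h : br a b = 0) : f = g :=
  hom_ext_of_locally fun _ => ⟨⊤, trivial, hf.ι_comp_eq' hg h⟩

theorem P1.exists_chart_ringHom (i : Fin 2) {A : Type*} [CommRing A] (α : R →+* A) (x : A) :
    ∃ β : Γ(P1 R, P1.chart R i) →+* A, β (P1.coord R i (1 - i)) = x := by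
  let e := RingEquiv.ofBijective _ (P1.chart_bijective R i (P1.scalar R i))
  refine ⟨(Polynomial.eval₂RingHom α x).comp e.symm.toRingHom, ?_⟩
  have : e Polynomial.X = P1.coord R i (1 - i) := by simp [e]
  rw [← this]
  simp

/-- A morphism into the affine chart i is prescribed by the image of its coordinate, here a_{1-i} /
a_i. -/
theorem exists_hasCoords_of_isUnit (s : T ⟶ Spec (.of R)) {a : Fin 2 → Γ(T, ⊤)} (i : Fin 2)
    (ha : IsUnit (a i)) : ∃ f : T ⟶ P1 R, HasCoords f ⊤ a := by
  obtain ⟨c, hc⟩ := ha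
  obtain ⟨β, hβ⟩ := P1.exists_chart_ringHom (R := R) i
    (s.appTop.hom.comp (Scheme.ΓSpecIso (.of R)).inv.hom) (↑c⁻¹ * a (1 - i))
  have hU := P1.isAffineOpen_chart R i
  let f : T ⟶ P1 R := T.toSpecΓ ≫ Spec.map (CommRingCat.ofHom β) ≫ hU.fromSpec
  have hf : ⊤ ≤ f ⁻¹ᵁ P1.chart R i := fun x _ => by
    change hU.fromSpec _ ∈ (P1.chart R i : Set _)
    rw [← hU.range_fromSpec]
    exact ⟨_, rfl⟩
  have h0 := (hasCoords_chart f i).restrict hf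
  have e : ev f hf (P1.coord R i (1 - i)) = ↑c⁻¹ * a (1 - i) := by
    have h1 := ι_comp_eq f hU hf
    have : IsIso (⊤ : T.Opens).ι := inferInstanceAs (IsIso T.topIso.hom)
    rw [Scheme.Opens.toSpecΓ_top, Category.assoc, cancel_epi] at h1
    have h2 : T.toSpecΓ ≫ Spec.map (CommRingCat.ofHom β) ≫ hU.fromSpec = _ := h1
    rw [← Category.assoc, ← Category.assoc, cancel_mono] at h2
    have h3 := toSpecΓ_SpecMap_injective h2
    rw [← hβ]
    exact congr($(h3.symm).hom _)
  refine ⟨f, h0.of_br_eq_zero (isCoprime_of_isUnit (hc ▸ c.isUnit))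
    (br_eq_zero_of_mul_comm' (i := i) ?_)⟩
  simp_rw [res_ev]
  rw [P1.coord_self, map_one, e, ← hc]
  rw [mul_right_comm, Units.inv_mul]

/-- Morphisms to the projective line may be glued from compatible homogeneous coordinates. -/
theorem exists_hasCoords (s : T ⟶ Spec (.of R)) {ι : Type u} (U : ι → T.Opens)
    (a : ∀ i, Fin 2 → Γ(T, U i)) (hU : ∀ x, ∃ i, x ∈ U i)
    (hc : ∀ i, IsCoprime (a i 0) (a i 1))
    (hbr : ∀ i j, br (fun k => res (inf_le_left : U i ⊓ U j ≤ _) (a i k))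
      (fun k => res inf_le_right (a j k)) = 0) :
    ∃ f : T ⟶ P1 R, ∀ i, HasCoords f (U i) (a i) := by
  -- On these smaller sets one entry is a unit, so the morphism exists there; they still form a
  -- cover because the vectors are unimodular.
  let V : ι × Fin 2 → T.Opens := fun k => T.basicOpen (a k.1 k.2)
  have hV : ∀ k, V k ≤ U k.1 := fun k => T.basicOpen_le _
  have hVt : ∀ k, ⊤ ≤ (V k).ι ⁻¹ᵁ U k.1 := fun k x _ => hV k x.2
  have hm : ∀ k, ∃ m : (V k).toScheme ⟶ P1 R,
      HasCoords m ⊤ (fun j => ev (V k).ι (hVt k) (a k.1 j)) := fun k => by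
    refine exists_hasCoords_of_isUnit ((V k).ι ≫ s) k.2 ?_
    have h : ⊤ ≤ (V k).ι ⁻¹ᵁ V k := fun x _ => x.2
    have := (isUnit_res_basicOpen (a k.1 k.2)).map (ev (V k).ι h)
    exact (ev_res (V k).ι h (hV k) (a k.1 k.2)) ▸ this
  choose m hm using hm
  have hVc : ∀ i, ∀ x ∈ U i, ∃ j, x ∈ V (i, j) :=
    fun i x hx => exists_mem_basicOpen (hc i) hx
  let 𝒰 := T.openCoverOfIsOpenCover V (top_le_iff.mp fun x _ => by
    obtain ⟨i, hi⟩ := hU x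
    obtain ⟨j, hj⟩ := hVc i x hi
    exact TopologicalSpace.Opens.mem_iSup.mpr ⟨_, hj⟩)
  let f : T ⟶ P1 R := 𝒰.glueMorphisms m fun k l => by
    refine hom_ext_of_hasCoords ((hm k).comp (pullback.fst _ _) (V := ⊤) le_top)
      ((hm l).comp (pullback.snd _ _) (V := ⊤) le_top) ?_
    have h1 : ⊤ ≤ (pullback.fst (V k).ι (V l).ι ≫ (V k).ι) ⁻¹ᵁ U k.1 :=
      fun x _ => hV k (pullback.fst (V k).ι (V l).ι x).2
    have h2 : ⊤ ≤ (pullback.snd (V k).ι (V l).ι ≫ (V l).ι) ⁻¹ᵁ U l.1 :=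
      fun x _ => hV l (pullback.snd (V k).ι (V l).ι x).2
    refine Eq.trans ?_ (br_ev_eq_zero pullback.condition (hbr k.1 l.1) h1 h2)
    congr 1
    · ext i; exact ev_ev _ _ _ _ _
    · ext i; exact ev_ev _ _ _ _ _
  have hf : ∀ k, (V k).ι ≫ f = m k := fun k => 𝒰.ι_glueMorphisms _ _ k
  refine ⟨f, fun i => HasCoords.of_locally (hc i) fun x hx => ?_⟩
  obtain ⟨j, hj⟩ := hVc i x hx
  refine ⟨V (i, j), hV _, hj, HasCoords.of_ι (h := fun x _ => x.2) ((hc i).map _) ?_⟩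
  refine HasCoords.congr_hom (f := m (i, j)) ?_ (hf _).symm
  convert hm (i, j) using 2
  exact ev_res _ _ _ _

end Coords

/-! ### Affine charts of `ℙ¹_S` -/

section LineCharts

variable {R : Type u} [CommRing R] (S : Sch R) (W : S.left.Opens) (k : Fin 2)

/-- The part of the chart `k` of `ℙ¹_S` lying over `W`. -/
def line.chart : (line S).Opens := line.proj S ⁻¹ᵁ W ⊓ line.toP1 S ⁻¹ᵁ P1.chart R k

/-- Functions on `W`, as functions on the chart `k` over `W`. -/
def line.scalar : Γ(S.left, W) →+* Γ(line S, line.chart S W k) := ev (line.proj S) inf_le_left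

/-- The homogeneous coordinates on the chart `k` over `W`, the `k`-th one being `1`. -/
def line.coord (j : Fin 2) : Γ(line S, line.chart S W k) :=
  ev (line.toP1 S) inf_le_right (P1.coord R k j)

theorem line.coord_self : line.coord S W k k = 1 := by
  exact (congrArg _ (P1.coord_self R k)).trans (map_one _)

theorem line.hasCoords : HasCoords (line.toP1 S) (line.chart S W k) (line.coord S W k) := by
  have := (hasCoords_chart (line.toP1 S) k).restrict (V := line.chart S W k) inf_le_right
  convert this using 1
  ext j
  exact (res_ev _ _ _ _).symm

theorem line.exists_mem_chart (x : line S) (hx : line.proj S x ∈ W) :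
    ∃ k, x ∈ line.chart S W k := by
  obtain ⟨k, hk⟩ := P1.exists_mem_chart (line.toP1 S x)
  exact ⟨k, hx, hk⟩

theorem line.isPullback : IsPullback (line.proj S) (line.toP1 S) S.hom (P1.toSpec R) :=
  IsPullback.of_hasPullback _ _

variable {W}

theorem line.isAffineOpen_chart (hW : IsAffineOpen W) : IsAffineOpen (line.chart S W k) := by
  have : IsAffine _ := hW
  have : IsAffine _ := P1.isAffineOpen_chart R k
  have : IsAffine _ := isAffineOpen_top (Spec (.of R))
  have e := (Scheme.Hom.isPullback_resLE (line.isPullback S) (US := ⊤) (UX := W)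
    (UT := P1.chart R k) le_top le_top (UY := line.chart S W k) rfl).isoPullback
  exact IsAffine.of_isIso e.hom

variable [IsLocalization.Away (2 : ℤ) R]

theorem spec_ringHom_ext {A : Type*} [CommRing A] (f g : Γ(Spec (.of R), ⊤) →+* A) : f = g := by
  have := away_two_ringHom_ext R (f.comp (Scheme.ΓSpecIso (.of R)).inv.hom)
    (g.comp (Scheme.ΓSpecIso (.of R)).inv.hom)
  ext x
  have h := congr($this ((Scheme.ΓSpecIso (.of R)).hom x))
  simpa using h

/-- The chart is a fibre product of affine schemes, so its ring is the pushout of Γ(W) and R[X] over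
R. The inverse `δ` comes from the universal property. -/
theorem line.scalar_bijective (hW : IsAffineOpen W) : Function.Bijective
    (Polynomial.eval₂RingHom (line.scalar S W k) (line.coord S W k (1 - k))) := by
  have hp := (isIso_pushoutSection_iff (line.isPullback S) (US := ⊤) (UX := W)
    (UT := P1.chart R k) (UY := line.chart S W k) le_top le_top rfl).mp
    (isIso_pushoutSection_of_isAffineOpen _ _ _ _ (isAffineOpen_top _) (P1.isAffineOpen_chart R k) hW)
  set β := Polynomial.eval₂RingHom (line.scalar S W k) (line.coord S W k (1 - k))
  obtain ⟨γ, hγ⟩ := P1.exists_chart_ringHom (R := R) k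
    (A := Polynomial Γ(S.left, W)) ((Polynomial.C.comp (ev S.hom (U := ⊤) (V := W) le_top)).comp
      (Scheme.ΓSpecIso (.of R)).inv.hom) Polynomial.X
  let γ' : Γ(P1 R, P1.chart R k) ⟶ CommRingCat.of (Polynomial Γ(S.left, W)) :=
    CommRingCat.ofHom (R := Γ(P1 R, P1.chart R k)) γ
  let δ : Γ(line S, line.chart S W k) ⟶ CommRingCat.of (Polynomial Γ(S.left, W)) :=
    hp.desc (CommRingCat.ofHom Polynomial.C) γ'
      (CommRingCat.hom_ext (spec_ringHom_ext _ _))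
  have h1 : ∀ a, δ.hom (line.scalar S W k a) = Polynomial.C a := fun a =>
    congr($(hp.inl_desc (CommRingCat.ofHom Polynomial.C) γ'
      (CommRingCat.hom_ext (spec_ringHom_ext _ _))).hom a)
  have h2 : ∀ a, δ.hom (ev (line.toP1 S) inf_le_right a) = γ a := fun a =>
    congr($(hp.inr_desc (CommRingCat.ofHom Polynomial.C) γ'
      (CommRingCat.hom_ext (spec_ringHom_ext _ _))).hom a)
  refine Function.bijective_iff_has_inverse.mpr ⟨δ.hom, fun p => ?_, fun b => ?_⟩
  · refine congr($(Polynomial.ringHom_ext (f := δ.hom.comp β) (g := RingHom.id _) (fun a => ?_) ?_) p)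
    · simp [β, h1]
    · rw [RingHom.comp_apply, show β Polynomial.X = _ from Polynomial.eval₂_X _ _]
      exact (h2 _).trans hγ
  · have : δ ≫ CommRingCat.ofHom β = 𝟙 _ := by
      refine hp.hom_ext ?_ ?_
      · ext a
        refine (congrArg β (h1 a)).trans ?_
        simp [β, line.scalar]; rfl
      · refine CommRingCat.hom_ext (P1.chart_ringHom_ext k ?_)
        refine (congrArg β ((h2 _).trans hγ)).trans ?_
        exact Polynomial.eval₂_X _ _
    exact congr($(this).hom b)

end LineCharts

/-! ### Polynomials and binary forms -/

section Algebra

open Polynomial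

/-- This describes the section t = b / a, which lies in the chart only where `a` is invertible.
Powers of `a` clear denominators modulo a t − b, and `a` is already a unit modulo a t − b. -/
theorem ker_eq_span_of_coprime {A B A' : Type*} [CommRing A] [CommRing B] [CommRing A']
    {α : A →+* B} {t : B} (hs : Function.Surjective (eval₂RingHom α t)) {φ : A →+* A'} {ψ : B →+* A'}
    (hψ : ∀ x, ψ (α x) = φ x) {a b : A} (hab : IsCoprime a b)
    (hφ : ∀ x, φ x = 0 → ∃ n : ℕ, a ^ n * x = 0) (ht : ψ t * φ a = φ b) :
    RingHom.ker ψ = Ideal.span {α a * t - α b} := by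
  set I := Ideal.span {α a * t - α b}
  have hI : α a * t - α b ∈ I := Ideal.mem_span_singleton_self _
  apply le_antisymm
  -- Since a t ≡ b, multiplying by a high power of `a` turns a polynomial in t into a constant
  -- modulo `I`.
  · have key : ∀ p : A[X], ∃ (n : ℕ) (N : A), α a ^ n * eval₂ α t p - α N ∈ I := fun p => by
      induction p using Polynomial.induction_on' with
      | add p q hp hq =>
        obtain ⟨n, N, hn⟩ := hp
        obtain ⟨m, M, hm⟩ := hq
        refine ⟨n + m, a ^ m * N + a ^ n * M, ?_⟩
        have := I.add_mem (I.mul_mem_left (α a ^ m) hn) (I.mul_mem_left (α a ^ n) hm)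
        convert this using 1
        simp only [eval₂_add, map_add, map_mul, map_pow]
        ring
      | monomial n c =>
        refine ⟨n, c * b ^ n, ?_⟩
        have := I.mul_mem_left (α c) ((Ideal.Quotient.eq (I := I)).mp
          (by rw [map_pow, map_pow, Ideal.Quotient.eq.mpr hI] :
            Ideal.Quotient.mk I ((α a * t) ^ n) = Ideal.Quotient.mk I (α b ^ n)))
        convert this using 1
        simp only [eval₂_monomial, map_mul, map_pow]
        ring
    intro y hy
    obtain ⟨p, rfl⟩ := hs y
    obtain ⟨n, N, hn⟩ := key p
    have hIψ : ∀ z ∈ I, ψ z = 0 := fun z hz => by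
      obtain ⟨w, rfl⟩ := Ideal.mem_span_singleton'.mp hz
      rw [map_mul, map_sub, map_mul, hψ, hψ, mul_comm (φ a), ht, sub_self, mul_zero]
    have h0 : φ N = 0 := by
      have := hIψ _ hn
      rwa [map_sub, map_mul, show ψ (eval₂ α t p) = 0 from hy, mul_zero, zero_sub, neg_eq_zero,
        hψ] at this
    obtain ⟨m, hm⟩ := hφ N h0
    have h1 : α a ^ (m + n) * eval₂ α t p ∈ I := by
      have := I.mul_mem_left (α a ^ m) hn
      rwa [mul_sub, ← map_pow, ← map_mul, hm, map_zero, sub_zero, map_pow, ← mul_assoc,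
        ← pow_add] at this
    obtain ⟨u, v, huv⟩ := hab
    -- From u a + v b = 1 and b ≡ a t one gets a (u + v t) ≡ 1.
    have hu : IsUnit (Ideal.Quotient.mk I (α a)) := by
      refine IsUnit.of_mul_eq_one (Ideal.Quotient.mk I (α u + α v * t)) ?_
      rw [← map_mul, ← map_one (Ideal.Quotient.mk I), Ideal.Quotient.eq]
      convert I.mul_mem_left (α v) hI using 1
      rw [← map_one α, ← huv, map_add, map_mul, map_mul]
      ring
    rw [coe_eval₂RingHom, ← Ideal.Quotient.eq_zero_iff_mem]
    rw [← Ideal.Quotient.eq_zero_iff_mem, map_mul, map_pow] at h1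
    exact (hu.pow _).mul_right_eq_zero.mp h1
  · rw [Ideal.span_singleton_le_iff_mem, RingHom.mem_ker, map_sub, map_mul, hψ, hψ, mul_comm, ht,
      sub_self]

/-- With n the degree of Q, reversing Q gives the polynomial identity X^d · rev Q = X^n · P. For j >
d, the coefficient of X^(n + j) is P_j on the right, and on the left a coefficient of rev Q beyond
degree n, which is zero. -/
theorem natDegree_le_of_laurent {A E : Type*} [CommRing A] [CommRing E] {ψ : A →+* E} {x y : E}
    (hxy : x * y = 1) (hx : Function.Injective (eval₂RingHom ψ x)) {P Q : A[X]} {d : ℕ}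
    (h : eval₂ ψ y Q = y ^ d * eval₂ ψ x P) : P.natDegree ≤ d := by
  let _ : Invertible y := ⟨x, hxy, by rw [mul_comm, hxy]⟩
  have hr := eval₂_reflect_mul_pow ψ y Q.natDegree Q le_rfl
  rw [show ⅟y = x from rfl, h] at hr
  have e : X ^ d * reflect Q.natDegree Q = X ^ Q.natDegree * P := by
    apply hx
    simp only [coe_eval₂RingHom, eval₂_mul, eval₂_X_pow]
    have h1 : ∀ n : ℕ, x ^ n * y ^ n = 1 := fun n => by rw [← mul_pow, hxy, one_pow]
    linear_combination x ^ d * x ^ Q.natDegree * hr - x ^ d * eval₂ ψ x (reflect Q.natDegree Q) * h1 Q.natDegree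
      + x ^ Q.natDegree * eval₂ ψ x P * h1 d
  rw [natDegree_le_iff_coeff_eq_zero]
  intro j hj
  have := congrArg (fun p => coeff p (Q.natDegree + j)) e
  simp only [coeff_X_pow_mul', Nat.add_sub_cancel_left] at this
  rw [if_pos (by omega), if_pos (by omega), coeff_reflect, revAt_eq_self_of_lt (by omega)] at this
  rw [← this]
  exact coeff_eq_zero_of_natDegree_lt (by omega)

/-- The value of the binary quadratic form with coefficients `f`. -/
def quad {A : Type*} [CommRing A] (f : Fin 3 → A) (x : Fin 2 → A) : A :=
  f 0 * x 0 ^ 2 + f 1 * (x 0 * x 1) + f 2 * x 1 ^ 2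

theorem map_quad {A B : Type*} [CommRing A] [CommRing B] (φ : A →+* B) (f : Fin 3 → A)
    (x : Fin 2 → A) : φ (quad f x) = quad (fun i => φ (f i)) (fun i => φ (x i)) := by simp [quad]

/-- The coefficients of the Jacobian of two binary quadratic forms, divided by two. -/
def jac {A : Type*} [CommRing A] (f g : Fin 3 → A) : Fin 3 → A :=
  ![f 0 * g 1 - f 1 * g 0, 2 * (f 0 * g 2 - f 2 * g 0), f 1 * g 2 - f 2 * g 1]

/-- The product of two linear forms. -/
def prodForm {A : Type*} [CommRing A] (a b : Fin 2 → A) : Fin 3 → A :=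
  ![a 1 * b 1, -(a 0 * b 1 + a 1 * b 0), a 0 * b 0]

theorem quad_prodForm {A : Type*} [CommRing A] (a b x : Fin 2 → A) :
    quad (prodForm a b) x = br x a * br x b := by
  simp [quad, prodForm, br]; ring

/-- The polarization of a binary quadratic form. -/
def polar {A : Type*} [CommRing A] (f : Fin 3 → A) (x y : Fin 2 → A) : A :=
  2 * (f 0 * (x 0 * y 0)) + f 1 * (x 0 * y 1 + x 1 * y 0) + 2 * (f 2 * (x 1 * y 1))

section

variable {A : Type*} [CommRing A]

/-- The Jacobian is apolar to `f` and to `g`: its coefficients are the 2 × 2 minors of (f, g), and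
the apolar pairing with either form expands a determinant with a repeated row. Pairing with the
product [x, a] [x, b] is polarization at (a, b). -/
theorem polar_eq_zero_of_jac {f g : Fin 3 → A} {u : A} (hu : IsUnit u) {a b : Fin 2 → A}
    (h : ∀ i, jac f g i = u * prodForm a b i) : polar f a b = 0 ∧ polar g a b = 0 := by
  have h0 := h 0
  have h1 := h 1
  have h2 := h 2
  simp only [jac, prodForm, Matrix.cons_val_zero, Matrix.cons_val_one, Matrix.cons_val] at h0 h1 h2
  constructor
  · refine hu.mul_left_cancel ?_
    simp only [polar]
    linear_combination -2 * f 2 * h0 + f 1 * h1 - 2 * f 0 * h2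
  · refine hu.mul_left_cancel ?_
    simp only [polar]
    linear_combination -2 * g 2 * h0 + g 1 * h1 - 2 * g 0 * h2

/-- If `a` and `b` met at some point, then 2 f(a) = polar f a a and 2 g(a) would both vanish there,
against coprimality. -/
theorem isUnit_br_of_polar (h2 : IsUnit (2 : A)) {f g : Fin 3 → A} {a b : Fin 2 → A}
    (hb : IsCoprime (b 0) (b 1)) (hfg : IsCoprime (quad f a) (quad g a))
    (hf : polar f a b = 0) (hg : polar g a b = 0) : IsUnit (br a b) := by
  obtain ⟨s, t, hst⟩ := hb
  -- This vector completes b to a basis, and a = (s a₀ + t a₁) b + [a, b] y; polarizing with a kills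
  -- the b-term.
  let y : Fin 2 → A := ![t, -s]
  have key : ∀ f : Fin 3 → A, polar f a b = 0 → 2 * quad f a = br a b * polar f a y := by
    intro f hf
    simp only [polar, quad, br, y, Matrix.cons_val_zero, Matrix.cons_val_one] at hf ⊢
    linear_combination (s * a 0 + t * a 1) * hf -
      (2 * (f 0 * a 0 ^ 2 + f 1 * (a 0 * a 1) + f 2 * a 1 ^ 2)) * hst
  obtain ⟨m, n, hmn⟩ := hfg
  refine isUnit_of_mul_isUnit_left (y := m * polar f a y + n * polar g a y) ?_
  have : br a b * (m * polar f a y + n * polar g a y) = 2 := by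
    linear_combination 2 * hmn - m * key f hf - n * key g hg
  rwa [this]

/-- The coefficients of the cubic form `x ↦ br x (quad f x, quad g x)`. -/
def fixForm (f g : Fin 3 → A) : Fin 4 → A := ![g 0, g 1 - f 0, g 2 - f 1, -f 2]

theorem br_quad (f g : Fin 3 → A) (x : Fin 2 → A) :
    br x ![quad f x, quad g x] = fixForm f g 0 * x 0 ^ 3 + fixForm f g 1 * (x 0 ^ 2 * x 1) +
      fixForm f g 2 * (x 0 * x 1 ^ 2) + fixForm f g 3 * x 1 ^ 3 := by
  simp [br, quad, fixForm]; ring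

/-- A vanishing cubic form means (f, g) = ℓ(x) · x with ℓ = f₀ x₀ + f₁ x₁. The polarization at (a,
b) is then ℓ(a) b + ℓ(b) a; as a, b form a basis, ℓ vanishes on both and is zero. -/
theorem eq_zero_of_fixForm_of_polar {f g : Fin 3 → A} {a b : Fin 2 → A} (h : IsUnit (br a b))
    (hfix : ∀ i, fixForm f g i = 0) (hf : polar f a b = 0) (hg : polar g a b = 0) :
    f = 0 ∧ g = 0 := by
  have h0 := hfix 0
  have h1 := hfix 1
  have h2 := hfix 2
  have h3 := hfix 3
  simp only [fixForm, Matrix.cons_val_zero, Matrix.cons_val_one, Matrix.cons_val] at h0 h1 h2 h3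
  simp only [polar] at hf hg
  have e0 : f 0 = 0 := by
    refine (h.pow 2).mul_left_cancel ?_
    simp only [br]
    linear_combination (a 0 * b 1 + a 1 * b 0) * hg - 2 * (a 1 * b 1) * hf
      - (a 0 * b 1 + a 1 * b 0) * (2 * a 0 * b 0 * h0 + (a 0 * b 1 + a 1 * b 0) * h1 + 2 * a 1 * b 1 * h2)
      - 4 * (a 1 * b 1) ^ 2 * h3
  have e1 : f 1 = 0 := by
    refine (h.pow 2).mul_left_cancel ?_
    simp only [br]
    linear_combination (a 0 * b 1 + a 1 * b 0) * hf - 2 * (a 0 * b 0) * hg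
      + 2 * a 0 * b 0 * (2 * a 0 * b 0 * h0 + (a 0 * b 1 + a 1 * b 0) * h1 + 2 * a 1 * b 1 * h2)
      + (a 0 * b 1 + a 1 * b 0) * 2 * (a 1 * b 1) * h3
  constructor <;> funext i <;> fin_cases i <;> simp
  · exact e0
  · exact e1
  · linear_combination -h3
  · exact h0
  · linear_combination h1 + e0
  · linear_combination h2 + e1

/-- The coefficients of the product of three linear forms. -/
def cubicForm (ω : Fin 3 → Fin 2 → A) : Fin 4 → A :=
  ![ω 0 1 * ω 1 1 * ω 2 1,
    -(ω 0 0 * ω 1 1 * ω 2 1 + ω 0 1 * ω 1 0 * ω 2 1 + ω 0 1 * ω 1 1 * ω 2 0),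
    ω 0 0 * ω 1 0 * ω 2 1 + ω 0 0 * ω 1 1 * ω 2 0 + ω 0 1 * ω 1 0 * ω 2 0,
    -(ω 0 0 * ω 1 0 * ω 2 0)]

theorem cubicForm_eval (ω : Fin 3 → Fin 2 → A) (x : Fin 2 → A) :
    br x (ω 0) * br x (ω 1) * br x (ω 2) =
      cubicForm ω 0 * x 0 ^ 3 + cubicForm ω 1 * (x 0 ^ 2 * x 1) +
      cubicForm ω 2 * (x 0 * x 1 ^ 2) + cubicForm ω 3 * x 1 ^ 3 := by
  simp [br, cubicForm]; ring

/-! ### The standard map with given fixed and critical points -/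

section Std

variable (ω : Fin 3 → Fin 2 → A) (a b : Fin 2 → A)

/-- The factor of the discriminant of the standard map attached to two fixed points. -/
def pairing (x y : Fin 2 → A) : A := br x a * br y b + br x b * br y a

/-- The value of the standard map at the second critical point. -/
def stdV (e : Fin 2) : A :=
  br (ω 0) b * br (ω 1) b * br (ω 2) b * a e -
    (br (ω 0) a * br (ω 1) b * br (ω 2) b + br (ω 0) b * br (ω 1) a * br (ω 2) b +
      br (ω 0) b * br (ω 1) b * br (ω 2) a) * b e

/-- The value of the standard map at the first critical point. -/
def stdW (e : Fin 2) : A :=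
  (br (ω 0) a * br (ω 1) a * br (ω 2) b + br (ω 0) a * br (ω 1) b * br (ω 2) a +
      br (ω 0) b * br (ω 1) a * br (ω 2) a) * a e -
    br (ω 0) a * br (ω 1) a * br (ω 2) a * b e

/-- The binary quadratic forms defining the map of degree two
with fixed points `ω` and critical points `a`, `b`. -/
def stdForm (e : Fin 2) (i : Fin 3) : A :=
  stdV ω a b e * prodForm a a i + stdW ω a b e * prodForm b b i

theorem quad_stdForm (e : Fin 2) (x : Fin 2 → A) :
    quad (stdForm ω a b e) x = stdV ω a b e * br x a ^ 2 + stdW ω a b e * br x b ^ 2 := by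
  simp [quad, stdForm, prodForm, br]; ring

theorem polar_stdForm (e : Fin 2) : polar (stdForm ω a b e) a b = 0 := by
  simp [polar, stdForm, prodForm]; ring

/-- With p_j = [ω_j, b] and q_j = [ω_j, a] this is the homogenized identity e₁ e₂ − e₃ = (x + y)(y +
z)(x + z) for the ratios q_j / p_j. -/
theorem br_stdV_stdW : br (stdV ω a b) (stdW ω a b) =
    pairing a b (ω 1) (ω 2) * pairing a b (ω 0) (ω 2) * pairing a b (ω 0) (ω 1) * br a b := by
  have : ∀ p q r s : A, br (fun e => p * a e - q * b e) (fun e => r * a e - s * b e) =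
      (q * r - p * s) * br a b := fun p q r s => by simp only [br]; ring
  refine (this _ _ _ _).trans ?_
  simp only [pairing]
  ring

/-- Chain rule: the map is the linear change x ↦ ([x, a], [x, b]) of determinant [a, b], then
coordinatewise squaring, then the matrix with columns V, W. -/
theorem jac_stdForm (i : Fin 3) : jac (stdForm ω a b 0) (stdForm ω a b 1) i =
    2 * br (stdV ω a b) (stdW ω a b) * br a b * prodForm a b i := by
  have key : ∀ v w : Fin 2 → A,
      jac (fun i => v 0 * prodForm a a i + w 0 * prodForm b b i)
        (fun i => v 1 * prodForm a a i + w 1 * prodForm b b i) i =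
      2 * br v w * br a b * prodForm a b i := fun v w => by
    fin_cases i <;> simp [jac, prodForm, br] <;> ring
  exact key _ _

/-- This identity explains the choice of V and W. Since [a, b] ω_j = p_j a − q_j b with p_j = [ω_j,
b] and q_j = [ω_j, a], the right side is ∏ (p_j α − q_j β) for α = [x, a], β = [x, b]. Splitting its
four terms into a multiple of α² and a multiple of β² leaves the linear factors [x, V] and [x, W].
-/
theorem fixForm_stdForm (i : Fin 4) : fixForm (stdForm ω a b 0) (stdForm ω a b 1) i =
    br a b ^ 3 * cubicForm ω i := by
  have h1 : ∀ d : A, d ^ 3 * cubicForm ω i = cubicForm (fun j k => d * ω j k) i := fun d => by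
    fin_cases i <;> simp [cubicForm] <;> ring
  have h2 : (fun j k => br a b * ω j k) = fun j k => br (ω j) b * a k - br (ω j) a * b k := by
    funext j k
    fin_cases k <;> simp [br] <;> ring
  rw [h1, h2]
  have key : ∀ p q : Fin 3 → A,
      fixForm (fun i => (p 0 * p 1 * p 2 * a 0 - (q 0 * p 1 * p 2 + p 0 * q 1 * p 2 +
          p 0 * p 1 * q 2) * b 0) * prodForm a a i + ((q 0 * q 1 * p 2 + q 0 * p 1 * q 2 +
          p 0 * q 1 * q 2) * a 0 - q 0 * q 1 * q 2 * b 0) * prodForm b b i)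
        (fun i => (p 0 * p 1 * p 2 * a 1 - (q 0 * p 1 * p 2 + p 0 * q 1 * p 2 +
          p 0 * p 1 * q 2) * b 1) * prodForm a a i + ((q 0 * q 1 * p 2 + q 0 * p 1 * q 2 +
          p 0 * q 1 * q 2) * a 1 - q 0 * q 1 * q 2 * b 1) * prodForm b b i) i =
      cubicForm (fun j k => p j * a k - q j * b k) i := fun p q => by
    fin_cases i <;> simp [fixForm, cubicForm, prodForm] <;> ring
  exact key (fun j => br (ω j) b) fun j => br (ω j) a

/-- Since [a, b] is a unit, [x, a] and [x, b] are coprime for unimodular x; so are their squares,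
and the invertible matrix (V, W) preserves this. -/
theorem isCoprime_quad_stdForm (hD : IsUnit (br a b))
    (hM : IsUnit (br (stdV ω a b) (stdW ω a b))) {x : Fin 2 → A} (hx : IsCoprime (x 0) (x 1)) :
    IsCoprime (quad (stdForm ω a b 0) x) (quad (stdForm ω a b 1) x) := by
  obtain ⟨s, t, hst⟩ := hx
  obtain ⟨d, hd⟩ := hD.exists_left_inv
  obtain ⟨m, hm⟩ := hM.exists_left_inv
  have h1 : IsCoprime (br x a) (br x b) := by
    refine ⟨d * -(s * b 0 + t * b 1), d * (s * a 0 + t * a 1), ?_⟩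
    simp only [br] at hd ⊢
    linear_combination hst + (s * x 0 + t * x 1) * hd
  obtain ⟨p, q, hpq⟩ := h1.pow (m := 2) (n := 2)
  rw [quad_stdForm, quad_stdForm]
  refine ⟨m * (p * stdW ω a b 1 - q * stdV ω a b 1), m * (q * stdV ω a b 0 - p * stdW ω a b 0), ?_⟩
  simp only [br] at hm hpq ⊢
  linear_combination hpq + (p * (x 0 * a 1 - x 1 * a 0) ^ 2 + q * (x 0 * b 1 - x 1 * b 0) ^ 2) * hm

/-- Multihomogeneity is what makes the standard map depend only on the five points of ℙ¹. -/
theorem stdForm_smul (l : Fin 3 → A) (m n : A) (e : Fin 2) (i : Fin 3) :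
    stdForm (fun j k => l j * ω j k) (fun k => m * a k) (fun k => n * b k) e i =
      l 0 * l 1 * l 2 * m ^ 3 * n ^ 3 * stdForm ω a b e i := by
  have h1 : ∀ j, br (fun k => l j * ω j k) (fun k => m * a k) = l j * m * br (ω j) a := fun j => by
    simp only [br]; ring
  have h2 : ∀ j, br (fun k => l j * ω j k) (fun k => n * b k) = l j * n * br (ω j) b := fun j => by
    simp only [br]; ring
  have h3 : ∀ (m : A) (a : Fin 2 → A), prodForm (fun k => m * a k) (fun k => m * a k) i =
      m ^ 2 * prodForm a a i := fun m a => by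
    fin_cases i <;> simp [prodForm] <;> ring
  simp only [stdForm, stdV, stdW, h1, h2, h3]
  ring

theorem map_stdForm {B : Type*} [CommRing B] (φ : A →+* B) (e : Fin 2) (i : Fin 3) :
    φ (stdForm ω a b e i) =
      stdForm (fun j k => φ (ω j k)) (fun k => φ (a k)) (fun k => φ (b k)) e i := by
  have h3 : ∀ (a : Fin 2 → A), φ (prodForm a a i) = prodForm (fun k => φ (a k)) (fun k => φ (a k)) i :=
    fun a => by fin_cases i <;> simp [prodForm]
  simp only [stdForm, stdV, stdW, map_add, map_mul, map_sub, map_br, h3]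

/-- A pair of binary quadratic forms with the given fixed points and critical points is
proportional to the standard one. -/
theorem exists_unit_stdForm (h2 : IsUnit (2 : A)) {f g : Fin 3 → A} {u v : A} (hu : IsUnit u)
    (hv : IsUnit v) (hb : IsCoprime (b 0) (b 1)) (hfg : IsCoprime (quad f a) (quad g a))
    (hjac : ∀ i, jac f g i = u * prodForm a b i)
    (hfix : ∀ i, fixForm f g i = v * cubicForm ω i) :
    IsUnit (br a b) ∧ IsUnit (br (stdV ω a b) (stdW ω a b)) ∧
      ∃ c : A, IsUnit c ∧ ∀ i, stdForm ω a b 0 i = c * f i ∧ stdForm ω a b 1 i = c * g i := by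
  obtain ⟨hpf, hpg⟩ := polar_eq_zero_of_jac hu hjac
  have hD := isUnit_br_of_polar h2 hb hfg hpf hpg
  obtain ⟨v', hv'⟩ := hv.exists_left_inv
  -- The cubic forms of the standard pair and of (f, g) are [a, b]³ and v times the same form, so
  -- this is the only possible factor; the difference then has zero cubic form and zero
  -- polarization.
  set c := br a b ^ 3 * v'
  have hc : IsUnit c := (hD.pow 3).mul (IsUnit.of_mul_eq_one _ hv')
  have hfix' : ∀ i, fixForm (fun i => stdForm ω a b 0 i - c * f i)
      (fun i => stdForm ω a b 1 i - c * g i) i = 0 := fun i => by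
    have h1 : fixForm (fun i => stdForm ω a b 0 i - c * f i)
      (fun i => stdForm ω a b 1 i - c * g i) i =
        fixForm (stdForm ω a b 0) (stdForm ω a b 1) i - c * fixForm f g i := by
      generalize stdForm ω a b 0 = F
      generalize stdForm ω a b 1 = G
      fin_cases i <;> simp [fixForm] <;> ring
    rw [h1, fixForm_stdForm, hfix]
    linear_combination -br a b ^ 3 * cubicForm ω i * hv'
  have hpol : ∀ F f : Fin 3 → A, polar F a b = 0 → polar f a b = 0 →
      polar (fun i => F i - c * f i) a b = 0 := fun F f hF hf => by
    have : polar (fun i => F i - c * f i) a b = polar F a b - c * polar f a b := by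
      simp only [polar]; ring
    rw [this, hF, hf, mul_zero, sub_zero]
  obtain ⟨e0, e1⟩ := eq_zero_of_fixForm_of_polar hD hfix' (hpol _ _ (polar_stdForm ω a b 0) hpf)
    (hpol _ _ (polar_stdForm ω a b 1) hpg)
  have e0 : ∀ i, stdForm ω a b 0 i = c * f i := fun i => sub_eq_zero.mp (congrFun e0 i)
  have e1 : ∀ i, stdForm ω a b 1 i = c * g i := fun i => sub_eq_zero.mp (congrFun e1 i)
  refine ⟨hD, ?_, c, hc, fun i => ⟨e0 i, e1 i⟩⟩
  have hj : ∀ i, jac (stdForm ω a b 0) (stdForm ω a b 1) i = c ^ 2 * jac f g i := fun i => by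
    rw [show stdForm ω a b 0 = fun i => c * f i from funext e0,
      show stdForm ω a b 1 = fun i => c * g i from funext e1]
    fin_cases i <;> simp [jac] <;> ring
  simp_rw [jac_stdForm, hjac] at hj
  -- The proportional Jacobians are evaluated at a + b, where [x, a] [x, b] takes the value −[a,
  -- b]².
  have h3 : 2 * br (stdV ω a b) (stdW ω a b) * br a b * br a b ^ 2 = c ^ 2 * u * br a b ^ 2 := by
    have q0 := hj 0
    have q1 := hj 1
    have q2 := hj 2
    simp only [prodForm, Matrix.cons_val_zero, Matrix.cons_val_one, Matrix.cons_val] at q0 q1 q2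
    generalize br (stdV ω a b) (stdW ω a b) = m at *
    generalize hd : br a b = d at *
    simp only [br] at hd
    subst hd
    linear_combination -(a 0 + b 0) ^ 2 * q0 - (a 0 + b 0) * (a 1 + b 1) * q1 - (a 1 + b 1) ^ 2 * q2
  have h4 : IsUnit (2 * br (stdV ω a b) (stdW ω a b) * br a b * br a b ^ 2) := by
    rw [h3]
    exact ((hc.pow 2).mul hu).mul (hD.pow 2)
  exact isUnit_of_mul_isUnit_right
    (isUnit_of_mul_isUnit_left (isUnit_of_mul_isUnit_left h4))

end Std

end

end Algebra

/-! ### Functions and divisors on `ℙ¹_S` -/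

section Divisors

variable {R : Type u} [CommRing R]

instance : IsSeparated (P1.toSpec R) := by
  unfold P1.toSpec P1
  infer_instance

instance (S : Sch R) : IsSeparated (line.proj S) := by
  unfold line.proj line
  infer_instance

theorem isClosedImmersion_of_section {S : Sch R} {r : S.left ⟶ line S}
    (h : r ≫ line.proj S = 𝟙 _) : IsClosedImmersion r := by
  have : IsClosedImmersion (r ≫ line.proj S) := by rw [h]; infer_instance
  exact IsClosedImmersion.of_comp r (line.proj S)

/-- As φ is an S-morphism, the equalizer of schemes agrees with the one formed over S, and that one
is closed because ℙ¹_S is separated over S. -/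
theorem isClosedImmersion_equalizer {S : Sch R} {φ : line S ⟶ line S}
    (h : φ ≫ line.proj S = line.proj S) : IsClosedImmersion (equalizer.ι φ (𝟙 (line S))) := by
  let X : Over S.left := Over.mk (line.proj S)
  let f : X ⟶ X := Over.homMk φ h
  have : IsSeparated X.hom := inferInstanceAs (IsSeparated (line.proj S))
  have hc : IsClosedImmersion (equalizer.ι f (𝟙 X)).left := inferInstance
  let E : Over S.left := Over.mk (equalizer.ι φ (𝟙 (line S)) ≫ line.proj S)
  let i : E ⟶ X := Over.homMk (equalizer.ι φ (𝟙 (line S))) rfl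
  have hi : i ≫ f = i ≫ 𝟙 X := by
    ext1; exact equalizer.condition φ (𝟙 (line S))
  let k : equalizer φ (𝟙 (line S)) ⟶ (equalizer f (𝟙 X)).left := (equalizer.lift i hi).left
  have hk : k ≫ (equalizer.ι f (𝟙 X)).left = equalizer.ι φ (𝟙 (line S)) := by
    rw [← Over.comp_left, equalizer.lift_ι]; rfl
  let l : (equalizer f (𝟙 X)).left ⟶ equalizer φ (𝟙 (line S)) :=
    equalizer.lift (equalizer.ι f (𝟙 X)).left
      (by exact congrArg CommaMorphism.left (equalizer.condition f (𝟙 X)))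
  have hl : l ≫ equalizer.ι φ (𝟙 (line S)) = (equalizer.ι f (𝟙 X)).left := equalizer.lift_ι _ _
  have : IsIso k := ⟨l, by
    rw [← cancel_mono (equalizer.ι φ (𝟙 (line S))), Category.assoc, hl, hk, Category.id_comp], by
    rw [← cancel_mono (equalizer.ι f (𝟙 X)).left, Category.assoc, hk, hl, Category.id_comp]⟩
  rw [← hk]
  infer_instance

theorem ev_id {X : Scheme.{u}} {U V : X.Opens} (h : V ≤ U) (s : Γ(X, U)) : ev (𝟙 X) h s = res h s := by
  simp [ev, Scheme.Hom.appLE, res]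
  rfl

theorem ev_SpecMap_fromSpec {X : Scheme.{u}} {U : X.Opens} (hU : IsAffineOpen U) {A : CommRingCat.{u}}
    (f : Γ(X, U) ⟶ A) (h : ⊤ ≤ (Spec.map f ≫ hU.fromSpec) ⁻¹ᵁ U) (s : Γ(X, U)) :
    ev (Spec.map f ≫ hU.fromSpec) h s = (Scheme.ΓSpecIso A).inv.hom (f.hom s) := by
  have h1 : (⊤ : (Spec Γ(X, U)).Opens) ≤ hU.fromSpec ⁻¹ᵁ U := hU.fromSpec_preimage_self.ge
  have h2 : hU.fromSpec.appLE U ⊤ h1 = (Scheme.ΓSpecIso Γ(X, U)).inv := by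
    rw [Scheme.Hom.appLE, hU.fromSpec_app_self, Category.assoc, ← Functor.map_comp]
    exact (congrArg _ ((Spec Γ(X, U)).presheaf.map_id _)).trans (Category.comp_id _)
  have h3 := ev_ev (Spec.map f) hU.fromSpec h1 (le_refl (⊤ : (Spec A).Opens)) s
  refine h3.symm.trans ?_
  have h4 : (Spec.map f).appLE ⊤ ⊤ le_rfl = (Spec.map f).appTop := Scheme.Hom.appLE_eq_app _
  have := congr($(Scheme.ΓSpecIso_inv_naturality f).hom s)
  simp only [ev]
  rw [h2]
  exact (congr($(h4).hom _)).trans this.symm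

theorem ker_ideal_eq {X Y : Scheme.{u}} (f : X ⟶ Y) [QuasiCompact f] {U : Y.Opens} (hU : IsAffineOpen U) :
    f.ker.ideal ⟨U, hU⟩ = RingHom.ker (ev f (le_refl (f ⁻¹ᵁ U))) := by
  ext b
  rw [Scheme.Hom.ker_apply, RingHom.mem_ker, RingHom.mem_ker]
  exact (app_eq_ev f U b).congr_left

variable {S : Sch R} {W : S.left.Opens} (k : Fin 2)

theorem line.overlap_le : line.chart S W 0 ⊓ line.chart S W 1 ≤ line.chart S W k := by
  match k with
  | 0 => exact inf_le_left
  | 1 => exact inf_le_right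

theorem line.overlap_eq :
    line.chart S W 0 ⊓ line.chart S W 1 = (line S).basicOpen (line.coord S W k (1 - k)) := by
  have := (line.hasCoords S W k).basicOpen_eq (1 - k)
  rw [this]
  match k with
  | 0 => exact le_antisymm (le_inf inf_le_left (inf_le_right.trans inf_le_right)) (le_inf inf_le_left (le_inf (inf_le_left.trans inf_le_left) inf_le_right))
  | 1 => exact le_antisymm (le_inf inf_le_right (inf_le_left.trans inf_le_right)) (le_inf (le_inf (inf_le_left.trans inf_le_left) inf_le_right) inf_le_left)

theorem line.coord_one_eq (j : Fin 2) : res (line.overlap_le 1) (line.coord S W 1 j) =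
    res (line.overlap_le 1) (line.coord S W 1 0) * res (line.overlap_le 0) (line.coord S W 0 j) := by
  have := ((line.hasCoords S W 1).eq 0 j (line.chart S W 0 ⊓ line.chart S W 1) (line.overlap_le 1)
    (inf_le_left.trans inf_le_right))
  rw [this]
  exact congrArg _ (res_ev _ _ _ _).symm

theorem isLocalization_of_eq_basicOpen {X : Scheme.{u}} {U V : X.Opens} (hU : IsAffineOpen U)
    (f : Γ(X, U)) (h : V ≤ U) (e : V = X.basicOpen f) :
    @IsLocalization.Away _ _ f Γ(X, V) _ (res h).toAlgebra :=
  hU.isLocalization_of_eq_basicOpen f (homOfLE h) e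

theorem mem_nonZeroDivisors_res {X : Scheme.{u}} {U V : X.Opens} (hU : IsAffineOpen U)
    (f : Γ(X, U)) (h : V ≤ U) (e : V = X.basicOpen f) {q : Γ(X, U)} (hq : q ∈ nonZeroDivisors Γ(X, U)) :
    res h q ∈ nonZeroDivisors Γ(X, V) := by
  let _ := (res (X := X) h).toAlgebra
  have := isLocalization_of_eq_basicOpen hU f h e
  exact IsLocalization.map_nonZeroDivisors_le (Submonoid.powers f) Γ(X, V) ⟨q, hq, rfl⟩

theorem exists_pow_mul_eq_zero {X : Scheme.{u}} {U V : X.Opens} (hU : IsAffineOpen U)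
    (f : Γ(X, U)) (h : V ≤ U) (e : V = X.basicOpen f) {q : Γ(X, U)} (hq : res h q = 0) :
    ∃ n : ℕ, f ^ n * q = 0 := by
  let _ := (res (X := X) h).toAlgebra
  have := isLocalization_of_eq_basicOpen hU f h e
  obtain ⟨⟨_, n, rfl⟩, hn⟩ := (IsLocalization.map_eq_zero_iff (Submonoid.powers f) Γ(X, V) q).mp hq
  exact ⟨n, hn⟩

/-- The value of a linear form vanishing at `a`, on the chart `k`. -/
def line.linForm (S : Sch R) (W : S.left.Opens) (k : Fin 2) (a : Fin 2 → Γ(S.left, W)) :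
    Γ(line S, line.chart S W k) := br (line.coord S W k) (fun i => line.scalar S W k (a i))

theorem line.span_linForm (a : Fin 2 → Γ(S.left, W)) : Ideal.span {line.linForm S W k a} =
    Ideal.span {line.scalar S W k (a k) * line.coord S W k (1 - k) - line.scalar S W k (a (1 - k))} := by
  match k with
  | 0 =>
    rw [← Ideal.span_singleton_neg]
    congr 2
    simp only [line.linForm, br, line.coord_self, sub_zero]
    ring
  | 1 =>
    congr 2
    simp only [line.linForm, br, line.coord_self, sub_self]
    ring

theorem line.preimage_chart_section {r : S.left ⟶ line S} (hr : r ≫ line.proj S = 𝟙 _)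
    {a : Fin 2 → Γ(S.left, W)} (ha : HasCoords (r ≫ line.toP1 S) W a) :
    r ⁻¹ᵁ line.chart S W k = S.left.basicOpen (a k) := by
  rw [ha.basicOpen_eq]
  have : r ⁻¹ᵁ (line.proj S ⁻¹ᵁ W) = W := by
    change (r ≫ line.proj S) ⁻¹ᵁ W = W
    rw [hr]; rfl
  exact congrArg (· ⊓ (r ≫ line.toP1 S) ⁻¹ᵁ P1.chart R k) this

/-- On chart k the section is t = a_{1-k} / a_k, defined where a_k is invertible, so
`ker_eq_span_of_coprime` applies. -/
theorem line.ker_section [IsLocalization.Away (2 : ℤ) R] (hW : IsAffineOpen W) {r : S.left ⟶ line S} (hr : r ≫ line.proj S = 𝟙 _)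
    {a : Fin 2 → Γ(S.left, W)} (ha : HasCoords (r ≫ line.toP1 S) W a) :
    r.ker.ideal ⟨line.chart S W k, line.isAffineOpen_chart S k hW⟩ =
      Ideal.span {line.linForm S W k a} := by
  have := isClosedImmersion_of_section hr
  have e := line.preimage_chart_section k hr ha
  have hle : r ⁻¹ᵁ line.chart S W k ≤ W := e.le.trans (S.left.basicOpen_le _)
  rw [line.span_linForm, ker_ideal_eq]
  refine ker_eq_span_of_coprime (line.scalar_bijective S k hW).2 (φ := res hle) (fun x => ?_) ?_
    (fun x hx => exists_pow_mul_eq_zero hW _ hle e hx) ?_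
  · refine (ev_ev _ _ _ _ _).trans ((ev_congr hr _ _).trans (ev_id _ _))
  · match k with
    | 0 => exact ha.coprime
    | 1 => exact ha.coprime.symm
  · refine (mul_comm _ _).trans (Eq.trans ?_ (ha.eq k (1 - k) _ hle (r.preimage_mono inf_le_right)).symm)
    exact congrArg _ (ev_ev _ _ _ _ _)

/-- On the closed subscheme of the chart where the bracket vanishes, φ and the identity have
proportional coordinates and coincide; it therefore factors through the equalizer, and functions
vanishing on the equalizer vanish on it. Conversely, on the equalizer the two vectors are
coordinates of one morphism. -/
theorem line.ker_equalizer [IsLocalization.Away (2 : ℤ) R] (hW : IsAffineOpen W) {φ : line S ⟶ line S}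
    (hφ : φ ≫ line.proj S = line.proj S) {F : Fin 2 → Γ(line S, line.chart S W k)}
    (hF : HasCoords (φ ≫ line.toP1 S) (line.chart S W k) F) :
    (equalizer.ι φ (𝟙 (line S))).ker.ideal ⟨line.chart S W k, line.isAffineOpen_chart S k hW⟩ =
      Ideal.span {br (line.coord S W k) F} := by
  have := isClosedImmersion_equalizer hφ
  have hU := line.isAffineOpen_chart S k hW
  rw [ker_ideal_eq]
  set ι := equalizer.ι φ (𝟙 (line S))
  have hι : ι ≫ φ = ι := (equalizer.condition φ (𝟙 (line S))).trans (Category.comp_id _)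
  apply le_antisymm
  · intro b hb
    let I := Ideal.span {br (line.coord S W k) F}
    let q : Γ(line S, line.chart S W k) ⟶ CommRingCat.of (_ ⧸ I) :=
      CommRingCat.ofHom (Ideal.Quotient.mk I)
    let z := Spec.map q ≫ hU.fromSpec
    have hz : ⊤ ≤ z ⁻¹ᵁ line.chart S W k := fun x _ => by
      change hU.fromSpec _ ∈ (line.chart S W k : Set _)
      rw [← hU.range_fromSpec]
      exact ⟨_, rfl⟩
    have hzφ : z ≫ φ = z ≫ 𝟙 _ := by
      rw [Category.comp_id]
      refine line.hom_ext (by rw [Category.assoc, hφ]) ?_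
      rw [Category.assoc]
      refine hom_ext_of_hasCoords (hF.comp z hz) ((line.hasCoords S W k).comp z hz) ?_
      refine (map_br (ev z hz) _ _).symm.trans ((ev_SpecMap_fromSpec hU q hz _).trans ?_)
      have : q.hom (br F (line.coord S W k)) = 0 := by
        refine Ideal.Quotient.eq_zero_iff_mem.mpr ?_
        rw [show br F (line.coord S W k) = - br (line.coord S W k) F by simp only [br]; ring]
        exact neg_mem (Ideal.mem_span_singleton_self _)
      rw [this, map_zero]
    have hl := equalizer.lift_ι z hzφ
    have hb' : ev ι le_rfl b = 0 := hb
    have hz' : ⊤ ≤ equalizer.lift z hzφ ⁻¹ᵁ (ι ⁻¹ᵁ line.chart S W k) := by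
      have hz'' : ⊤ ≤ (equalizer.lift z hzφ ≫ ι) ⁻¹ᵁ line.chart S W k := by rw [hl]; exact hz
      exact hz''
    have h0 := congrArg (ev (equalizer.lift z hzφ) hz') hb'
    rw [map_zero] at h0
    have h1 := ((ev_ev _ _ _ _ b).symm.trans h0)
    have h2 := (ev_congr hl _ b).symm.trans h1
    have h3 := (ev_SpecMap_fromSpec hU q hz b).symm.trans h2
    have h4 : q.hom b = 0 := by
      have h5 := congrArg (Scheme.ΓSpecIso (CommRingCat.of (_ ⧸ I))).hom.hom h3
      rw [map_zero] at h5
      exact (congr($((Scheme.ΓSpecIso (CommRingCat.of (_ ⧸ I))).inv_hom_id).hom (q.hom b))).symm.trans h5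
    exact Ideal.Quotient.eq_zero_iff_mem.mp h4
  · rw [Ideal.span_singleton_le_iff_mem, RingHom.mem_ker, map_br]
    have h1 := hF.comp ι le_rfl
    rw [← Category.assoc, hι] at h1
    exact ((line.hasCoords S W k).comp ι le_rfl).br_eq_zero h1

end Divisors

/-! ### Binary forms on `ℙ¹_S` -/

section Forms

open Polynomial

/-- The binary form of degree `d` with coefficients `c`. -/
def homForm {A : Type*} [CommRing A] (d : ℕ) (c : ℕ → A) (x : Fin 2 → A) : A :=
  ∑ i ∈ Finset.range (d + 1), c i * x 0 ^ (d - i) * x 1 ^ i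

theorem homForm_mul {A : Type*} [CommRing A] (d : ℕ) (c : ℕ → A) (x : Fin 2 → A) (l : A) :
    homForm d c (fun i => l * x i) = l ^ d * homForm d c x := by
  rw [homForm, homForm, Finset.mul_sum]
  refine Finset.sum_congr rfl fun i hi => ?_
  rw [mul_pow, mul_pow, ← Nat.sub_add_cancel (Nat.lt_succ_iff.mp (Finset.mem_range.mp hi)), pow_add l]
  simp only [Nat.add_sub_cancel]
  ring

theorem map_homForm {A B : Type*} [CommRing A] [CommRing B] (φ : A →+* B) (d : ℕ) (c : ℕ → A)
    (x : Fin 2 → A) : φ (homForm d c x) = homForm d (fun i => φ (c i)) (fun i => φ (x i)) := by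
  simp [homForm]

variable {R : Type u} [CommRing R] {S : Sch R} {W : S.left.Opens}

theorem line.coord_mul_coord : res (line.overlap_le 0) (line.coord S W 0 1) *
    res (line.overlap_le 1) (line.coord S W 1 0) = 1 := by
  have := line.coord_one_eq (S := S) (W := W) 1
  rw [line.coord_self, map_one] at this
  rw [this, mul_comm]

theorem line.homForm_transform (d : ℕ) (c : ℕ → Γ(S.left, W)) :
    res (line.overlap_le 1) (homForm d (fun i => line.scalar S W 1 (c i)) (line.coord S W 1)) =
      res (line.overlap_le 1) (line.coord S W 1 0) ^ d * res (line.overlap_le 0)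
        (homForm d (fun i => line.scalar S W 0 (c i)) (line.coord S W 0)) := by
  have hc : (fun j => res (line.overlap_le 1) (line.coord S W 1 j)) = fun j =>
      res (line.overlap_le 1) (line.coord S W 1 0) * res (line.overlap_le 0) (line.coord S W 0 j) :=
    funext line.coord_one_eq
  rw [map_homForm, map_homForm, hc, homForm_mul]
  congr 3
  funext i
  exact (res_ev _ _ _ _).trans (res_ev _ _ _ _).symm

theorem ringEquiv_mem_nonZeroDivisors {A B : Type*} [CommRing A] [CommRing B] (e : A ≃+* B) {x : A}
    (hx : x ∈ nonZeroDivisors A) : e x ∈ nonZeroDivisors B := by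
  refine mem_nonZeroDivisors_iff_right.mpr fun z hz => ?_
  have := (mul_right_mem_nonZeroDivisors_eq_zero_iff (x := e.symm z) hx).mp
    (e.injective (by simpa using hz))
  simpa using this

variable [IsLocalization.Away (2 : ℤ) R]

theorem line.coord_mem_nonZeroDivisors (hW : IsAffineOpen W) (k : Fin 2) :
    line.coord S W k (1 - k) ∈ nonZeroDivisors Γ(line S, line.chart S W k) := by
  have hb := line.scalar_bijective S k hW
  let e := RingEquiv.ofBijective _ hb
  have hX : e X = line.coord S W k (1 - k) := eval₂_X _ _
  rw [← hX]
  exact ringEquiv_mem_nonZeroDivisors e X_mem_nonzeroDivisors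

theorem line.res_overlap_injective (hW : IsAffineOpen W) (k : Fin 2) :
    Function.Injective (res (X := line S) (line.overlap_le (W := W) k)) := by
  refine (injective_iff_map_eq_zero _).mpr fun q hq => ?_
  obtain ⟨n, hn⟩ := exists_pow_mul_eq_zero (line.isAffineOpen_chart S k hW) _ _ (line.overlap_eq k) hq
  exact (mul_left_mem_nonZeroDivisors_eq_zero_iff
    (pow_mem (line.coord_mem_nonZeroDivisors hW k) n)).mp hn

/-- A family of functions on the two charts which transforms like a binary form of degree `d`
is given by such a form. -/
theorem line.exists_homForm (hW : IsAffineOpen W) {d : ℕ} {p : ∀ k, Γ(line S, line.chart S W k)}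
    (h : res (line.overlap_le 1) (p 1) =
      res (line.overlap_le 1) (line.coord S W 1 0) ^ d * res (line.overlap_le 0) (p 0)) :
    ∃ c : ℕ → Γ(S.left, W), ∀ k,
      p k = homForm d (fun i => line.scalar S W k (c i)) (line.coord S W k) := by
  obtain ⟨P, hP⟩ := (line.scalar_bijective S 0 hW).2 (p 0)
  obtain ⟨Q, hQ⟩ := (line.scalar_bijective S 1 hW).2 (p 1)
  simp only [coe_eval₂RingHom, sub_zero, sub_self] at hP hQ
  have hs : ∀ k, (res (line.overlap_le k)).comp (line.scalar S W k) =
      ev (line.proj S) (V := line.chart S W 0 ⊓ line.chart S W 1) (inf_le_left.trans inf_le_left) :=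
    fun k => RingHom.ext fun x => res_ev _ _ _ _
  have hx : Function.Injective (eval₂RingHom (ev (line.proj S) (U := W)
      (V := line.chart S W 0 ⊓ line.chart S W 1) (inf_le_left.trans inf_le_left))
      (res (line.overlap_le 0) (line.coord S W 0 1))) := by
    have := (line.res_overlap_injective hW 0).comp (line.scalar_bijective S 0 hW).1
    convert this using 1
    funext q
    refine Eq.trans ?_ (hom_eval₂ q (line.scalar S W 0) (res (line.overlap_le 0)) (line.coord S W 0 1)).symm
    rw [hs 0]; rfl
  -- On the overlap p 0 is a polynomial in t and p 1 one in 1 / t; the transformation law bounds the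
  -- degree.
  have hd : P.natDegree ≤ d := by
    refine natDegree_le_of_laurent line.coord_mul_coord hx (P := P) (Q := Q) (d := d) ?_
    rw [← hs 1, ← hom_eval₂, hQ, h, hs 1, ← hs 0, ← hom_eval₂, hP]
  have h0 : p 0 = homForm d (fun i => line.scalar S W 0 (P.coeff i)) (line.coord S W 0) := by
    rw [← hP, eval₂_eq_sum_range' _ (Nat.lt_succ_of_le hd), homForm]
    simp [line.coord_self]
  refine ⟨P.coeff, fun k => ?_⟩
  match k with
  | 0 => exact h0
  | 1 =>
    apply line.res_overlap_injective hW 1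
    have hc : (fun j => res (line.overlap_le 1) (line.coord S W 1 j)) = fun j =>
        res (line.overlap_le 1) (line.coord S W 1 0) * res (line.overlap_le 0) (line.coord S W 0 j) :=
      funext line.coord_one_eq
    rw [h, h0, map_homForm, map_homForm, hc, homForm_mul]
    congr 3
    funext i
    exact congr($((hs 0).trans (hs 1).symm) (P.coeff i))

theorem line.homForm_injective (hW : IsAffineOpen W) {d : ℕ} {c c' : ℕ → Γ(S.left, W)}
    (h : homForm d (fun i => line.scalar S W 0 (c i)) (line.coord S W 0) =
      homForm d (fun i => line.scalar S W 0 (c' i)) (line.coord S W 0)) {i : ℕ} (hi : i ≤ d) :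
    c i = c' i := by
  have key : ∀ c : ℕ → Γ(S.left, W), homForm d (fun i => line.scalar S W 0 (c i)) (line.coord S W 0) =
      eval₂RingHom (line.scalar S W 0) (line.coord S W 0 (1 - 0))
        (∑ i ∈ Finset.range (d + 1), C (c i) * X ^ i) := fun c => by
    simp [homForm, line.coord_self]
  rw [key, key] at h
  have := congrArg (fun p => coeff p i) ((line.scalar_bijective S 0 hW).1 h)
  simpa [finsetSum_coeff, coeff_C_mul, coeff_X_pow, Nat.lt_succ_iff.mpr hi] using this

/-- By McCoy's theorem a zero divisor in a polynomial ring is killed by a nonzero constant; such a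
constant would kill both entries of the unimodular vector. -/
theorem line.linForm_mem_nonZeroDivisors (hW : IsAffineOpen W) (k : Fin 2) {a : Fin 2 → Γ(S.left, W)}
    (ha : IsCoprime (a 0) (a 1)) :
    line.linForm S W k a ∈ nonZeroDivisors Γ(line S, line.chart S W k) := by
  have key : ∀ b c : Γ(S.left, W), IsCoprime b c →
      line.scalar S W k b * line.coord S W k (1 - k) - line.scalar S W k c ∈ nonZeroDivisors _ := by
    intro b c ⟨s, t, hst⟩
    let e := RingEquiv.ofBijective _ (line.scalar_bijective S k hW)
    have hX : e (C b * X - C c) =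
        line.scalar S W k b * line.coord S W k (1 - k) - line.scalar S W k c := by
      change eval₂ _ _ _ = _
      simp
    rw [← hX]
    refine ringEquiv_mem_nonZeroDivisors e ?_
    by_contra hn
    obtain ⟨z, hz, h⟩ := Polynomial.notMem_nonZeroDivisors_iff.mp hn
    have h0 := congrArg (coeff · 0) h
    have h1 := congrArg (coeff · 1) h
    simp [coeff_C] at h0 h1
    exact hz (by linear_combination (-(z * hst)) + s * h1 + t * h0)
  match k with
  | 0 =>
    have := key _ _ ha
    have h : line.linForm S W 0 a = -(line.scalar S W 0 (a 0) * line.coord S W 0 (1 - 0) - line.scalar S W 0 (a 1)) := by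
      simp only [line.linForm, br, line.coord_self, sub_zero]; ring
    rw [h]
    rw [← neg_one_mul]
    exact mul_mem (isUnit_one.neg.mem_nonZeroDivisors) this
  | 1 =>
    have := key _ _ ha.symm
    have h : line.linForm S W 1 a = (line.scalar S W 1 (a 1) * line.coord S W 1 (1 - 1) - line.scalar S W 1 (a 0)) := by
      simp only [line.linForm, br, line.coord_self, sub_self]; ring
    rwa [h]

theorem exists_unit_of_span_singleton_eq {B : Type*} [CommRing B] {p q : B}
    (h : Ideal.span {p} = Ideal.span {q}) (hq : q ∈ nonZeroDivisors B) : ∃ u, IsUnit u ∧ p = u * q := by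
  obtain ⟨a, ha⟩ := Ideal.mem_span_singleton'.mp (h ▸ Ideal.mem_span_singleton_self p)
  obtain ⟨b, hb⟩ := Ideal.mem_span_singleton'.mp (h.symm ▸ Ideal.mem_span_singleton_self q)
  refine ⟨a, IsUnit.of_mul_eq_one b ?_, ha.symm⟩
  have : (a * b - 1) * q = 0 := by linear_combination b * ha + hb
  exact sub_eq_zero.mp ((mul_right_mem_nonZeroDivisors_eq_zero_iff hq).mp this)

theorem line.exists_scalar (hW : IsAffineOpen W) {p : ∀ k, Γ(line S, line.chart S W k)}
    (h : res (line.overlap_le 1) (p 1) = res (line.overlap_le 0) (p 0)) :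
    ∃ c : Γ(S.left, W), ∀ k, p k = line.scalar S W k c := by
  obtain ⟨c, hc⟩ := line.exists_homForm hW (d := 0) (p := p) (by rw [h, pow_zero, one_mul])
  exact ⟨c 0, fun k => (hc k).trans (by simp [homForm])⟩

/-- Two families of functions on the charts that transform like binary forms of the same degree and
generate the same ideals differ by a unit on the base. -/
theorem line.exists_unit_of_span_eq (hW : IsAffineOpen W) {d : ℕ} {p q : ∀ k, Γ(line S, line.chart S W k)}
    (hp : res (line.overlap_le 1) (p 1) =
      res (line.overlap_le 1) (line.coord S W 1 0) ^ d * res (line.overlap_le 0) (p 0))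
    (hq : res (line.overlap_le 1) (q 1) =
      res (line.overlap_le 1) (line.coord S W 1 0) ^ d * res (line.overlap_le 0) (q 0))
    (hn : ∀ k, q k ∈ nonZeroDivisors Γ(line S, line.chart S W k))
    (h : ∀ k, Ideal.span {p k} = Ideal.span {q k}) :
    ∃ u : Γ(S.left, W), IsUnit u ∧ ∀ k, p k = line.scalar S W k u * q k := by
  choose u hu hpq using fun k => exists_unit_of_span_singleton_eq (h k) (hn k)
  -- The nonzerodivisor q 1 stays one on the overlap and can be cancelled, so the two factors glue
  -- to a global function on ℙ¹ over W, which comes from W. The same holds for their inverses.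
  have hu1 : res (line.overlap_le 1) (u 1) = res (line.overlap_le 0) (u 0) := by
    have hn1 := mem_nonZeroDivisors_res (line.isAffineOpen_chart S 1 hW) _ (line.overlap_le 1)
      (line.overlap_eq 1) (hn 1)
    rw [hpq 1, hpq 0, map_mul, map_mul] at hp
    have : (res (line.overlap_le 1) (u 1) - res (line.overlap_le 0) (u 0)) *
      res (line.overlap_le 1) (q 1) = 0 := by
      linear_combination hp - res (line.overlap_le 0) (u 0) * hq
    exact sub_eq_zero.mp ((mul_right_mem_nonZeroDivisors_eq_zero_iff hn1).mp this)
  choose v hv using fun k => (hu k).exists_right_inv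
  have hv1 : res (line.overlap_le 1) (v 1) = res (line.overlap_le 0) (v 0) := by
    have h0 := congrArg (res (X := line S) (line.overlap_le (W := W) 0)) (hv 0)
    have h1 := congrArg (res (X := line S) (line.overlap_le (W := W) 1)) (hv 1)
    rw [map_mul, map_one] at h0 h1
    rw [hu1] at h1
    linear_combination res (line.overlap_le 0) (v 0) * h1 - res (line.overlap_le 1) (v 1) * h0
  obtain ⟨c, hc⟩ := line.exists_scalar hW hu1
  obtain ⟨c', hc'⟩ := line.exists_scalar hW hv1
  refine ⟨c, IsUnit.of_mul_eq_one c' ?_, fun k => by rw [← hc, hpq]⟩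
  have hi : Function.Injective (line.scalar S W 0) := by
    have := (line.scalar_bijective S 0 hW).1.comp C_injective
    convert this using 1
    funext x
    simp
  apply hi
  rw [map_mul, ← hc, ← hc', hv, map_one]

end Forms

/-! ### Annihilators of differentials -/

section Different

/-- The annihilator of the relative differentials of a ring homomorphism. -/
def annKaehler {C B : Type u} [CommRing C] [CommRing B] (ψ : C →+* B) : Ideal B :=
  letI := ψ.toAlgebra
  Module.annihilator B (Ω[B⁄C])

theorem mem_annihilator_kaehler {C B : Type*} [CommRing C] [CommRing B] [Algebra C B] {b : B} :
    b ∈ Module.annihilator B (Ω[B⁄C]) ↔ ∀ x, b • KaehlerDifferential.D C B x = 0 := by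
  refine ⟨fun h x => Module.mem_annihilator.mp h _, fun h => Module.mem_annihilator.mpr fun m => ?_⟩
  have hm : m ∈ Submodule.span B (Set.range (KaehlerDifferential.D C B)) := by
    rw [KaehlerDifferential.span_range_derivation]; trivial
  induction hm using Submodule.span_induction with
  | mem y hy => obtain ⟨x, rfl⟩ := hy; exact h x
  | zero => exact smul_zero _
  | add y z _ _ hy hz => rw [smul_add, hy, hz, add_zero]
  | smul c y _ hy => rw [smul_comm, hy, smul_zero]

/-- Finiteness enters in one inclusion: an element killing the localized module kills each of
finitely many generators after multiplication by one common denominator. -/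
theorem annihilator_eq_map_of_isLocalizedModule {B B' N N' : Type*} [CommRing B] [CommRing B']
    [Algebra B B'] [AddCommGroup N] [Module B N] [AddCommGroup N'] [Module B N'] [Module B' N']
    [IsScalarTower B B' N'] (M : Submonoid B) [IsLocalization M B'] (f : N →ₗ[B] N')
    [IsLocalizedModule M f] [Module.Finite B N] :
    Module.annihilator B' N' = (Module.annihilator B N).map (algebraMap B B') := by
  apply le_antisymm
  · intro b' hb'
    obtain ⟨⟨b, m⟩, hbm⟩ := IsLocalization.surj M b'
    have hb : ∀ n, f (b • n) = 0 := fun n => by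
      rw [map_smul, ← algebraMap_smul B' b (f n), ← hbm, mul_comm, mul_smul,
        Module.mem_annihilator.mp hb', smul_zero]
    classical
    obtain ⟨s, hs⟩ := Module.finite_def.mp ‹Module.Finite B N›
    have : ∃ m : M, ∀ n ∈ s, (m : B) • (b • n) = 0 := by
      clear hs
      induction s using Finset.induction_on with
      | empty => exact ⟨1, fun n hn => absurd hn (Finset.notMem_empty n)⟩
      | insert n s _ ih =>
        obtain ⟨m, hm⟩ := ih
        obtain ⟨m', hm'⟩ := (IsLocalizedModule.eq_zero_iff M f).mp (hb n)
        refine ⟨m * m', fun x hx => ?_⟩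
        rcases Finset.mem_insert.mp hx with rfl | hx
        · rw [Submonoid.coe_mul, mul_smul, show ((m' : B) • (b • x)) = 0 from hm', smul_zero]
        · rw [Submonoid.coe_mul, mul_comm, mul_smul, hm x hx, smul_zero]
    obtain ⟨m', hm'⟩ := this
    have hann : (m' : B) * b ∈ Module.annihilator B N := by
      refine Module.mem_annihilator.mpr fun n => ?_
      have hn : n ∈ Submodule.span B (s : Set N) := by rw [hs]; trivial
      induction hn using Submodule.span_induction with
      | mem y hy => rw [mul_smul]; exact hm' y hy
      | zero => exact smul_zero _
      | add y z _ _ hy hz => rw [smul_add, hy, hz, add_zero]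
      | smul c y _ hy => rw [smul_comm, hy, smul_zero]
    have h1 := Ideal.mem_map_of_mem (algebraMap B B') hann
    rw [map_mul, ← hbm] at h1
    have h2 : IsUnit (algebraMap B B' m' * algebraMap B B' m) :=
      (IsLocalization.map_units B' m').mul (IsLocalization.map_units B' m)
    rw [← Ideal.unit_mul_mem_iff_mem _ h2]
    convert h1 using 1
    ring
  · rw [Ideal.map_le_iff_le_comap]
    intro b hb
    refine Module.mem_annihilator.mpr fun n' => ?_
    obtain ⟨⟨n, m⟩, hnm⟩ := IsLocalizedModule.surj M f n'
    have h1 : (m : B) • (algebraMap B B' b • n') = 0 := by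
      rw [smul_comm]
      refine (congrArg _ hnm).trans ?_
      rw [algebraMap_smul, ← map_smul, Module.mem_annihilator.mp hb, map_zero]
    have h2 := IsLocalization.map_units B' m
    obtain ⟨v, hv⟩ := h2.exists_left_inv
    rw [← one_smul B' (_ • n'), ← hv, mul_smul, algebraMap_smul, h1, smul_zero]

/-- A derivation over C is automatically linear over a localization C', so the universal derivations
over C and C' factor through each other. -/
theorem annihilator_kaehler_eq_of_isLocalization {C C' B : Type*} [CommRing C] [CommRing C'] [CommRing B]
    [Algebra C C'] [Algebra C' B] [Algebra C B] [IsScalarTower C C' B] (N : Submonoid C)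
    [IsLocalization N C'] :
    Module.annihilator B (Ω[B⁄C']) = Module.annihilator B (Ω[B⁄C]) := by
  ext b
  rw [mem_annihilator_kaehler, mem_annihilator_kaehler]
  refine ⟨fun h x => ?_, fun h x => ?_⟩
  · let D : Derivation C' B (Ω[B⁄C]) := Derivation.mk'
      { toFun := KaehlerDifferential.D C B
        map_add' := map_add _
        map_smul' := fun c' x => by
          obtain ⟨⟨c, n⟩, hcn⟩ := IsLocalization.surj N c'
          have hu : IsUnit (algebraMap C B n) := by
            rw [IsScalarTower.algebraMap_apply C C' B]
            exact (IsLocalization.map_units C' n).map _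
          have e : algebraMap C' B c' * algebraMap C B n = algebraMap C B c := by
            rw [IsScalarTower.algebraMap_apply C C' B, ← map_mul, hcn, ← IsScalarTower.algebraMap_apply]
          have h1 : algebraMap C B n • KaehlerDifferential.D C B (c' • x) =
              algebraMap C B n • (c' • KaehlerDifferential.D C B x) := by
            have h2 : (n : C) • (c' • x) = c • x := by
              rw [Algebra.smul_def, Algebra.smul_def, Algebra.smul_def, ← mul_assoc, mul_comm, ← e]
              ring
            have h3 : algebraMap C B n • (c' • KaehlerDifferential.D C B x) =
                c • KaehlerDifferential.D C B x := by
              rw [← algebraMap_smul B c', smul_smul, mul_comm, e, algebraMap_smul]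
            rw [h3, algebraMap_smul, ← Derivation.map_smul, h2, Derivation.map_smul]
          exact hu.smul_left_cancel.mp h1 }
      (fun a b => (KaehlerDifferential.D C B).leibniz a b)
    have := congrArg D.liftKaehlerDifferential (h x)
    rw [map_smul, map_zero, Derivation.liftKaehlerDifferential_comp_D] at this
    exact this
  · have := congrArg (KaehlerDifferential.map C C' B B) (h x)
    rw [map_smul, map_zero, KaehlerDifferential.map_D] at this
    exact this

theorem annKaehler_eq_map {C C' B B' : Type u} [CommRing C] [CommRing C'] [CommRing B] [CommRing B']
    (ψ : C →+* B) (ψ' : C' →+* B') (ρ : B →+* B') (σ : C →+* C') (h : ρ.comp ψ = ψ'.comp σ)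
    (hψ : ψ.FiniteType) (g : B) (hg : @IsLocalization.Away _ _ g B' _ ρ.toAlgebra) (c : C)
    (hc : @IsLocalization.Away _ _ c C' _ σ.toAlgebra) :
    annKaehler ψ' = (annKaehler ψ).map ρ := by
  algebraize [ψ, ψ', ρ, σ, ρ.comp ψ]
  have : IsScalarTower C C' B' := .of_algebraMap_eq' h
  have := annihilator_kaehler_eq_of_isLocalization (C := C) (C' := C') (B := B') (Submonoid.powers c)
  have h2 := annihilator_eq_map_of_isLocalizedModule (B' := B') (Submonoid.powers g)
    (KaehlerDifferential.map C C B B')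
  exact this.trans h2

open Polynomial in
/-- The homomorphism to the dual numbers given by a homomorphism from a polynomial ring
and the derivative. -/
def dualLift {A Q : Type*} [CommRing A] [CommRing Q] (f : A[X] →+* Q) :
    A[X] →+* TrivSqZeroExt Q Q where
  toFun p := TrivSqZeroExt.inl (f p) + TrivSqZeroExt.inr (f (derivative p))
  map_one' := by simp
  map_zero' := by simp
  map_add' p q := by
    refine TrivSqZeroExt.ext ?_ ?_ <;> simp only [TrivSqZeroExt.fst_add, TrivSqZeroExt.snd_add,
      TrivSqZeroExt.fst_inl, TrivSqZeroExt.snd_inl, TrivSqZeroExt.fst_inr, TrivSqZeroExt.snd_inr, map_add] <;> ring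
  map_mul' p q := by
    refine TrivSqZeroExt.ext ?_ ?_ <;> simp only [TrivSqZeroExt.fst_add, TrivSqZeroExt.snd_add,
      TrivSqZeroExt.fst_inl, TrivSqZeroExt.snd_inl, TrivSqZeroExt.fst_inr, TrivSqZeroExt.snd_inr,
      TrivSqZeroExt.fst_mul, TrivSqZeroExt.snd_mul, map_mul, map_add, derivative_mul, smul_eq_mul,
      MulOpposite.smul_eq_mul_unop, MulOpposite.unop_op] <;> ring

open Polynomial in
theorem fst_dualLift {A Q : Type*} [CommRing A] [CommRing Q] (f : A[X] →+* Q) (p : A[X]) :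
    (dualLift f p).fst = f p := by simp [dualLift]

open Polynomial in
theorem snd_dualLift {A Q : Type*} [CommRing A] [CommRing Q] (f : A[X] →+* Q) (p : A[X]) :
    (dualLift f p).snd = f (derivative p) := by simp [dualLift]

open Polynomial in
/-- The different of a monogenic extension: the annihilator of the relative differentials of
`A[t]_P` over `A[w]`, where `w` is mapped to `Q / P`. -/
theorem annKaehler_eq_span {A C B : Type u} [CommRing A] [CommRing C] [CommRing B] [Algebra A[X] B]
    {P Q : A[X]} [IsLocalization.Away P B] {ψ : C →+* B} {γ : A →+* C} {w : C}
    (hγ : Function.Surjective (eval₂RingHom γ w))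
    (h : ψ.comp γ = (algebraMap A[X] B).comp Polynomial.C)
    (hw : ψ w * algebraMap A[X] B P = algebraMap A[X] B Q) :
    annKaehler ψ = Ideal.span {algebraMap A[X] B (P * derivative Q - derivative P * Q)} := by
  set W := algebraMap A[X] B (P * derivative Q - derivative P * Q) with hW
  have hP : IsUnit (algebraMap A[X] B P) := IsLocalization.Away.algebraMap_isUnit P
  unfold annKaehler
  let _ := ψ.toAlgebra
  let d := KaehlerDifferential.D C B
  have hψ : ∀ c, ψ c = algebraMap C B c := fun c => rfl
  have hdA : ∀ a : A, d (algebraMap A[X] B (Polynomial.C a)) = 0 := fun a => by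
    rw [← RingHom.comp_apply, ← h]
    exact d.map_algebraMap _
  have hdX : ∀ p : A[X], d (algebraMap A[X] B p) =
      algebraMap A[X] B (derivative p) • d (algebraMap A[X] B X) := fun p => by
    induction p using Polynomial.induction_on' with
    | add p q hp hq => rw [map_add, map_add, hp, hq, map_add, map_add, add_smul]
    | monomial n a =>
      rw [← C_mul_X_pow_eq_monomial, map_mul, d.leibniz, hdA, smul_zero, add_zero, map_pow,
        d.leibniz_pow, derivative_C_mul_X_pow, ← Nat.cast_smul_eq_nsmul B, smul_smul, smul_smul]
      congr 1
      simp only [map_mul, map_pow, map_natCast]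
  apply le_antisymm
  · intro b hb
    -- The map p ↦ p + p' ε into the dual numbers over B / W extends to B, because P becomes a unit.
    -- It is constant on C, since the derivative of Q / P is W / P², zero modulo W. Its ε-part is
    -- thus a C-derivation with value 1 at X, and `b` must vanish modulo W.
    let I := Ideal.span {W}
    let mk := Ideal.Quotient.mk I
    let θ := dualLift (mk.comp (algebraMap A[X] B))
    have hu : IsUnit (θ P) := by
      rw [TrivSqZeroExt.isUnit_iff_isUnit_fst, fst_dualLift]
      exact hP.map mk
    let Θ : B →+* TrivSqZeroExt (B ⧸ I) (B ⧸ I) := IsLocalization.Away.lift P hu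
    have hΘ : ∀ p, Θ (algebraMap A[X] B p) = θ p := fun p => IsLocalization.Away.lift_eq P hu p
    have hfst : (TrivSqZeroExt.fstHom (B ⧸ I) (B ⧸ I) (B ⧸ I)).toRingHom.comp Θ = mk := by
      refine IsLocalization.ringHom_ext (Submonoid.powers P) (RingHom.ext fun p => ?_)
      exact (congrArg TrivSqZeroExt.fst (hΘ p)).trans (fst_dualLift _ p)
    have hC : Θ.comp ψ = ((TrivSqZeroExt.inlHom (B ⧸ I) (B ⧸ I)).comp mk).comp ψ := by
      rw [← RingHom.cancel_right hγ]
      refine Polynomial.ringHom_ext (fun a => ?_) ?_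
      · have hc : ψ (γ a) = algebraMap A[X] B (Polynomial.C a) := congr($h a)
        simp only [RingHom.comp_apply, coe_eval₂RingHom, eval₂_C, hc, hΘ]
        refine TrivSqZeroExt.ext (fst_dualLift _ _) ((snd_dualLift _ _).trans ?_)
        rw [derivative_C, map_zero]
        rfl
      · simp only [RingHom.comp_apply, coe_eval₂RingHom, eval₂_X]
        have hu' : IsUnit (Θ (algebraMap A[X] B P)) := hP.map Θ
        apply hu'.mul_left_injective
        simp only
        rw [← map_mul, hw, hΘ, hΘ]
        have hmw : mk (ψ w) * mk (algebraMap A[X] B P) = mk (algebraMap A[X] B Q) := by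
          rw [← map_mul, hw]
        refine TrivSqZeroExt.ext ?_ ?_
        · rw [fst_dualLift, TrivSqZeroExt.fst_mul, fst_dualLift]
          exact hmw.symm
        · rw [snd_dualLift, TrivSqZeroExt.snd_mul, fst_dualLift, snd_dualLift]
          change mk _ = mk (ψ w) • mk _ + MulOpposite.op (mk _) • 0
          rw [smul_zero, add_zero, smul_eq_mul]
          apply (hP.map mk).mul_left_injective
          simp only
          have h0 : mk W = 0 := Ideal.Quotient.eq_zero_iff_mem.mpr (Ideal.mem_span_singleton_self _)
          rw [hW] at h0
          simp only [map_sub, map_mul] at h0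
          linear_combination h0 - mk (algebraMap A[X] B (derivative P)) * hmw
    have hfst' : ∀ x, (Θ x).fst = mk x := fun x => congr($hfst x)
    have hC' : ∀ c, Θ (algebraMap C B c) = TrivSqZeroExt.inl (mk (algebraMap C B c)) :=
      fun c => congr($hC c)
    let D : Derivation C B (B ⧸ I) := Derivation.mk'
      { toFun := fun x => (Θ x).snd
        map_add' := fun x y => by rw [map_add, TrivSqZeroExt.snd_add]
        map_smul' := fun c x => by
          rw [Algebra.smul_def, map_mul, TrivSqZeroExt.snd_mul, hC']
          simp [Algebra.smul_def]
          rfl }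
      (fun x y => by
        change (Θ (x * y)).snd = _
        rw [map_mul, TrivSqZeroExt.snd_mul, hfst', hfst']
        exact congrArg _ (mul_comm (Θ x).snd (mk y)))
    have h1 := congrArg D.liftKaehlerDifferential
      (mem_annihilator_kaehler.mp hb (algebraMap A[X] B X))
    rw [map_smul, map_zero, Derivation.liftKaehlerDifferential_comp_D] at h1
    have h2 : D (algebraMap A[X] B X) = 1 := by
      change (Θ (algebraMap A[X] B X)).snd = 1
      rw [hΘ, snd_dualLift, derivative_X, map_one]
    rw [h2] at h1
    apply Ideal.Quotient.eq_zero_iff_mem.mp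
    rw [← h1, Algebra.smul_def, mul_one]
    rfl
  · rw [Ideal.span_singleton_le_iff_mem, mem_annihilator_kaehler]
    -- Differentiating w P = Q with dw = 0 gives (Q' − w P') dX = 0; multiplied by P this is W dX =
    -- 0.
    have h0 : W • d (algebraMap A[X] B X) = 0 := by
      have h1 := congrArg d hw
      rw [d.leibniz, hdX P, hdX Q, show d (ψ w) = 0 from d.map_algebraMap w, smul_zero, add_zero,
        smul_smul, ← sub_eq_zero, ← sub_smul] at h1
      have h2 : W = -algebraMap A[X] B P *
          (ψ w * algebraMap A[X] B (derivative P) - algebraMap A[X] B (derivative Q)) := by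
        rw [hW]
        simp only [map_sub, map_mul]
        rw [← hw]
        ring
      rw [h2, mul_smul, h1, smul_zero]
    intro x
    obtain ⟨n, p, hp⟩ := IsLocalization.Away.surj P x
    have h1 := congrArg d hp
    rw [d.leibniz, ← map_pow, hdX (P ^ n), hdX p] at h1
    have h2 : algebraMap A[X] B (P ^ n) • (W • d x) = 0 := by
      rw [smul_comm, eq_sub_of_add_eq' h1, smul_sub, smul_comm W, h0, smul_zero, smul_comm W x,
        smul_comm W, h0, smul_zero,
        smul_zero, sub_zero]
    have h3 : IsUnit (algebraMap A[X] B (P ^ n)) := by rw [map_pow]; exact hP.pow n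
    exact h3.smul_left_cancel.mp (h2.trans (smul_zero _).symm)

end Different

/-! ### The ramification divisor -/

section Ramification

instance P1.locallyOfFiniteType_toSpec (R : Type u) [CommRing R] : LocallyOfFiniteType (P1.toSpec R) := by
  have : IsScalarTower R (grading R 0) (MvPolynomial (Fin 2) R) :=
    ⟨fun r a x => smul_mul_assoc r a.1 x⟩
  have : Algebra.FiniteType (grading R 0) (MvPolynomial (Fin 2) R) :=
    Algebra.FiniteType.of_restrictScalars_finiteType R _ _
  have h1 : Function.Surjective (algebraMap R (grading R 0)) := fun p => by
    obtain ⟨p, hp⟩ := p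
    obtain ⟨r, hr⟩ : ∃ r, p = MvPolynomial.C r :=
      ⟨_, MvPolynomial.totalDegree_eq_zero_iff_eq_C.mp (Nat.le_zero.mp (MvPolynomial.IsHomogeneous.totalDegree_le hp))⟩
    exact ⟨r, Subtype.ext hr.symm⟩
  have h2 : LocallyOfFiniteType (Spec.map (CommRingCat.ofHom (algebraMap R (grading R 0)))) := by
    rw [HasRingHomProperty.Spec_iff (P := @LocallyOfFiniteType)]
    exact RingHom.FiniteType.of_surjective _ h1
  have h3 : LocallyOfFiniteType (Proj.toSpecZero (grading R)) := inferInstance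
  exact locallyOfFiniteType_comp (Proj.toSpecZero (grading R)) _

instance line.locallyOfFiniteType_proj {R : Type u} [CommRing R] (S : Sch R) :
    LocallyOfFiniteType (line.proj S) := by
  unfold line.proj line
  infer_instance

theorem line.locallyOfFiniteType {R : Type u} [CommRing R] {S : Sch R} {φ : line S ⟶ line S}
    (hφ : φ ≫ line.proj S = line.proj S) : LocallyOfFiniteType φ := by
  have : LocallyOfFiniteType (φ ≫ line.proj S) := by rw [hφ]; infer_instance
  exact locallyOfFiniteType_of_comp φ (line.proj S)

variable {X Y : Scheme.{u}}

theorem ideal_eq_of_locally {U : X.Opens} (hU : IsAffineOpen U) {I J : Ideal Γ(X, U)}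
    (H : ∀ x ∈ U, ∃ (V : X.Opens) (h : V ≤ U), x ∈ V ∧ I.map (res h) = J.map (res h)) : I = J := by
  refine hU.ideal_ext_iff.mpr fun x hx => ?_
  obtain ⟨V, h, hxV, e⟩ := H x hx
  have := congrArg (Ideal.map (X.presheaf.germ V x hxV).hom) e
  have hg : (X.presheaf.germ V x hxV).hom.comp (res h) = (X.presheaf.germ U x hx).hom :=
    RingHom.ext fun s => X.presheaf.germ_res_apply (homOfLE h) x hxV s
  rwa [Ideal.map_map, Ideal.map_map, hg] at this

theorem map_ideal_res (I : X.IdealSheafData) {U V : X.Opens} (hU : IsAffineOpen U) (hV : IsAffineOpen V)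
    (h : V ≤ U) : (I.ideal ⟨U, hU⟩).map (res h) = I.ideal ⟨V, hV⟩ :=
  I.map_ideal (U := ⟨V, hV⟩) (V := ⟨U, hU⟩) h

theorem annKaehler_ev (φ : X ⟶ Y) [LocallyOfFiniteType φ] {U U' : X.Opens} {V V' : Y.Opens}
    (hU : IsAffineOpen U) (hV : IsAffineOpen V) (h : U ≤ φ ⁻¹ᵁ V) (h' : U' ≤ φ ⁻¹ᵁ V') (hUU : U' ≤ U)
    {g : Γ(X, U)} {c : Γ(Y, V)} (eU : U' = X.basicOpen g) (eV : V' = Y.basicOpen c) :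
    annKaehler (ev φ h') = (annKaehler (ev φ h)).map (res hUU) := by
  have hVV : V' ≤ V := eV.le.trans (Y.basicOpen_le c)
  refine annKaehler_eq_map (ev φ h) (ev φ h') (res hUU) (res hVV) (RingHom.ext fun s => ?_)
    (φ.finiteType_appLE hV hU h) g (isLocalization_of_eq_basicOpen hU g hUU eU) c
    (isLocalization_of_eq_basicOpen hV c hVV eV)
  exact (res_ev _ _ _ _).trans (ev_res _ _ _ _).symm

theorem isRamificationIdeal_iff {φ : X ⟶ Y} {I : X.IdealSheafData} :
    IsRamificationIdeal φ I ↔ ∀ (U : X.Opens) (V : Y.Opens) (hU : IsAffineOpen U) (_ : IsAffineOpen V)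
      (h : U ≤ φ ⁻¹ᵁ V), I.ideal ⟨U, hU⟩ = annKaehler (ev φ h) :=
  ⟨fun H U V hU hV h => H ⟨U, hU⟩ ⟨V, hV⟩ h, fun H U V h => H U.1 V.1 U.2 V.2 h⟩

/-- The annihilator is compatible with passing to basic open sets in source and target, so two pairs
of affine open sets can be compared on a common smaller pair. -/
theorem isRamificationIdeal_of_locally {φ : X ⟶ Y} [LocallyOfFiniteType φ] {I : X.IdealSheafData}
    (H : ∀ x : X, ∃ (U : X.Opens) (V : Y.Opens) (hU : IsAffineOpen U) (_ : IsAffineOpen V)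
      (h : U ≤ φ ⁻¹ᵁ V), x ∈ U ∧ I.ideal ⟨U, hU⟩ = annKaehler (ev φ h)) : IsRamificationIdeal φ I := by
  refine isRamificationIdeal_iff.mpr fun U V hU hV h => ?_
  refine ideal_eq_of_locally hU fun x hx => ?_
  obtain ⟨U₁, V₁, hU₁, hV₁, h₁, hx₁, e⟩ := H x
  obtain ⟨f, f₁, hf, hxf⟩ := exists_basicOpen_le_affine_inter hU hU₁ x ⟨hx, hx₁⟩
  obtain ⟨c, c₁, hc, hxc⟩ := exists_basicOpen_le_affine_inter hV hV₁ (φ x) ⟨h hx, h₁ hx₁⟩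
  -- The intersection has to be a basic open set of both `U` and `U₁`; multiplying by the pulled
  -- back function achieves this.
  have e1 : X.basicOpen (f * ev φ h c) = X.basicOpen f ⊓ φ ⁻¹ᵁ Y.basicOpen c := by
    rw [Scheme.basicOpen_mul, basicOpen_ev]
    exact le_antisymm (inf_le_inf_left _ inf_le_right)
      (le_inf inf_le_left (inf_le_inf_right _ (X.basicOpen_le f)))
  have e2 : X.basicOpen (f * ev φ h c) = X.basicOpen (f₁ * ev φ h₁ c₁) := by
    rw [e1, Scheme.basicOpen_mul, basicOpen_ev, hf, hc]
    exact le_antisymm (le_inf inf_le_left (inf_le_inf_right _ (X.basicOpen_le f₁)))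
      (inf_le_inf_left _ inf_le_right)
  have hle : X.basicOpen (f * ev φ h c) ≤ φ ⁻¹ᵁ Y.basicOpen c := e1.le.trans inf_le_right
  have hUU := X.basicOpen_le (f * ev φ h c)
  have hUU₁ : X.basicOpen (f * ev φ h c) ≤ U₁ := e2.le.trans (X.basicOpen_le _)
  refine ⟨X.basicOpen (f * ev φ h c), hUU, e1 ▸ ⟨hxf, hxc⟩, ?_⟩
  rw [← annKaehler_ev φ hU hV h hle hUU rfl rfl,
    annKaehler_ev φ hU₁ hV₁ h₁ hle hUU₁ e2 hc, ← e,
    map_ideal_res I hU (hU.basicOpen _) hUU, map_ideal_res I hU₁ (hU.basicOpen _) hUU₁]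

open Polynomial

/-- The pair of binary quadratic forms with coefficients `f` and `g` on the chart `k`. -/
def line.quadPair {R : Type u} [CommRing R] (S : Sch R) (W : S.left.Opens) (k : Fin 2)
    (f g : Fin 3 → Γ(S.left, W)) : Fin 2 → Γ(line S, line.chart S W k) :=
  ![quad (fun i => line.scalar S W k (f i)) (line.coord S W k),
    quad (fun i => line.scalar S W k (g i)) (line.coord S W k)]

theorem isLocalization_comp_of_bijective {A B C : Type*} [CommRing A] [CommRing B] [CommRing C]
    {β : A →+* B} (hβ : Function.Bijective β) {ρ : B →+* C} {p : A}
    (h : @IsLocalization.Away _ _ (β p) C _ ρ.toAlgebra) :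
    @IsLocalization.Away _ _ p C _ (ρ.comp β).toAlgebra := by
  let _ := ρ.toAlgebra
  let _ := (ρ.comp β).toAlgebra
  refine IsLocalization.Away.mk p (IsLocalization.Away.algebraMap_isUnit (S := C) (β p))
    (fun z => ?_) (fun a b hab => ?_)
  · obtain ⟨n, b, hb⟩ := IsLocalization.Away.surj (β p) z
    obtain ⟨a, rfl⟩ := hβ.2 b
    exact ⟨n, a, hb⟩
  · obtain ⟨n, hn⟩ := IsLocalization.Away.exists_of_eq (S := C) (β p) hab
    exact ⟨n, hβ.1 (by simpa using hn)⟩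

theorem annKaehler_eq_span_of_bijective {A B₀ B C : Type u} [CommRing A] [CommRing B₀] [CommRing B]
    [CommRing C] {α : A →+* B₀} {t : B₀} (hb : Function.Bijective (eval₂RingHom α t)) {ρ : B₀ →+* B}
    {P Q : A[X]} (hρ : @IsLocalization.Away _ _ (eval₂RingHom α t P) B _ ρ.toAlgebra) {ψ : C →+* B}
    {γ : A →+* C} {w : C} (hγ : Function.Surjective (eval₂RingHom γ w)) (h : ∀ a, ψ (γ a) = ρ (α a))
    (hw : ψ w * ρ (eval₂RingHom α t P) = ρ (eval₂RingHom α t Q)) :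
    annKaehler ψ =
      Ideal.span {ρ (eval₂RingHom α t (P * derivative Q - derivative P * Q))} := by
  let _ := (ρ.comp (eval₂RingHom α t)).toAlgebra
  have : IsLocalization.Away P B := isLocalization_comp_of_bijective hb hρ
  refine annKaehler_eq_span (P := P) (Q := Q) hγ (RingHom.ext fun a => (h a).trans ?_) hw
  exact congrArg ρ (eval₂_C α t).symm

/-- Setting one variable equal to 1 turns half the Jacobian of two quadratic forms into the
Wronskian of the resulting polynomials, by Euler's relation. The sign depends on `k`, hence the
formulation with ideals. -/
theorem exists_quad_polynomial {A B : Type*} [CommRing A] [CommRing B] (α : A →+* B) (k : Fin 2)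
    {x : Fin 2 → B} (hx : x k = 1) : ∃ v : Fin 2 → A[X],
      (∀ f : Fin 3 → A, eval₂RingHom α (x (1 - k)) (quad (fun i => C (f i)) v) = quad (fun i => α (f i)) x) ∧
      ∀ f g : Fin 3 → A, Ideal.span {eval₂RingHom α (x (1 - k)) (quad (fun i => C (f i)) v * derivative (quad (fun i => C (g i)) v) -
          derivative (quad (fun i => C (f i)) v) * quad (fun i => C (g i)) v)} =
        Ideal.span {quad (fun i => α (jac f g i)) x} := by
  match k with
  | 0 =>
    refine ⟨![1, X], fun f => ?_, fun f g => ?_⟩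
    · simp [quad, hx]
    · congr 2
      simp [quad, jac, hx, map_ofNat α 2]
      ring
  | 1 =>
    refine ⟨![X, 1], fun f => ?_, fun f g => ?_⟩
    · simp [quad, hx]
    · rw [← Ideal.span_singleton_neg]
      congr 2
      simp [quad, jac, hx, map_ofNat α 2]
      ring

variable {R : Type u} [CommRing R] {S : Sch R} {W : S.left.Opens}
  {φ : line S ⟶ line S} {f g : Fin 3 → Γ(S.left, W)}

theorem line.basicOpen_quadPair_le (hφ : φ ≫ line.proj S = line.proj S) {k : Fin 2}
    (h : HasCoords (φ ≫ line.toP1 S) (line.chart S W k) (line.quadPair S W k f g)) (j : Fin 2) :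
    (line S).basicOpen (line.quadPair S W k f g j) ≤ φ ⁻¹ᵁ line.chart S W j := by
  rw [h.basicOpen_eq j]
  have h1 : φ ⁻¹ᵁ (line.proj S ⁻¹ᵁ W) = line.proj S ⁻¹ᵁ W := by
    have : (φ ≫ line.proj S) ⁻¹ᵁ W = line.proj S ⁻¹ᵁ W := by rw [hφ]
    exact this
  exact le_inf (inf_le_left.trans (inf_le_left.trans h1.ge)) inf_le_right

variable [IsLocalization.Away (2 : ℤ) R]

/-- Where the j-th form F_j is invertible, φ maps to chart j and pulls its coordinate back to
F_{1-j} / F_j, the situation of `annKaehler_eq_span`. Exchanging the two forms only changes the sign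
of the Jacobian. -/
theorem line.annKaehler_quadPair (hW : IsAffineOpen W) (hφ : φ ≫ line.proj S = line.proj S) {k : Fin 2}
    (h : HasCoords (φ ≫ line.toP1 S) (line.chart S W k) (line.quadPair S W k f g)) (j : Fin 2) :
    annKaehler (ev φ (line.basicOpen_quadPair_le hφ h j)) =
      Ideal.span {res ((line S).basicOpen_le _)
        (quad (fun i => line.scalar S W k (jac f g i)) (line.coord S W k))} := by
  obtain ⟨v, hv, hjac⟩ := exists_quad_polynomial (line.scalar S W k) k (line.coord_self S W k)
  have hU := line.isAffineOpen_chart S k hW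
  set β := eval₂RingHom (line.scalar S W k) (line.coord S W k (1 - k)) with hβ
  have key : ∀ (f' g' : Fin 3 → Γ(S.left, W)),
      line.quadPair S W k f g j = quad (fun i => line.scalar S W k (f' i)) (line.coord S W k) →
      line.quadPair S W k f g (1 - j) = quad (fun i => line.scalar S W k (g' i)) (line.coord S W k) →
      annKaehler (ev φ (line.basicOpen_quadPair_le hφ h j)) =
        Ideal.span {res ((line S).basicOpen_le _)
          (quad (fun i => line.scalar S W k (jac f' g' i)) (line.coord S W k))} := by
    intro f' g' hf' hg'
    have hle := (line S).basicOpen_le (line.quadPair S W k f g j)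
    have hP : res hle (β (quad (fun i => C (f' i)) v)) =
        res hle (line.quadPair S W k f g j) := congrArg (res hle) ((hv f').trans hf'.symm)
    have hQ : res hle (β (quad (fun i => C (g' i)) v)) =
        res hle (line.quadPair S W k f g (1 - j)) := congrArg (res hle) ((hv g').trans hg'.symm)
    have := annKaehler_eq_span_of_bijective (P := quad (fun i => C (f' i)) v)
      (Q := quad (fun i => C (g' i)) v) (ψ := ev φ (line.basicOpen_quadPair_le hφ h j))
      (ρ := res ((line S).basicOpen_le (line.quadPair S W k f g j))) (γ := line.scalar S W j)
      (w := line.coord S W j (1 - j)) (line.scalar_bijective S k hW)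
      (isLocalization_of_eq_basicOpen hU _ ((line S).basicOpen_le _) (by rw [hf', ← hv]))
      (line.scalar_bijective S j hW).2 (fun a => ?_) ?_
    · rw [this]
      have h2 := congrArg (Ideal.map (res ((line S).basicOpen_le (line.quadPair S W k f g j)))) (hjac f' g')
      rw [Ideal.map_span, Ideal.map_span, Set.image_singleton, Set.image_singleton] at h2
      exact h2
    · refine (ev_ev _ _ _ _ _).trans ((ev_congr hφ _ _).trans ?_)
      exact (res_ev _ _ _ _).symm
    · refine (congrArg _ hP).trans (Eq.trans ?_ hQ.symm)
      rw [mul_comm, h.eq j (1 - j) _ ((line S).basicOpen_le _)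
        ((line.basicOpen_quadPair_le hφ h j).trans (φ.preimage_mono inf_le_right))]
      exact congrArg _ (ev_ev _ _ _ _ _)
  match j with
  | 0 => exact key f g rfl rfl
  | 1 =>
    rw [key g f rfl rfl, ← Ideal.span_singleton_neg]
    congr 2
    rw [← map_neg]
    congr 1
    simp only [quad, jac]
    simp
    ring

theorem line.isRamificationIdeal_iff (hφ : φ ≫ line.proj S = line.proj S) {I : (line S).IdealSheafData}
    (H : ∀ p : S.left, ∃ (W : S.left.Opens) (f g : Fin 3 → Γ(S.left, W)) (hW : IsAffineOpen W), p ∈ W ∧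
      ∀ k, HasCoords (φ ≫ line.toP1 S) (line.chart S W k) (line.quadPair S W k f g) ∧
        I.ideal ⟨line.chart S W k, line.isAffineOpen_chart S k hW⟩ =
          Ideal.span {quad (fun i => line.scalar S W k (jac f g i)) (line.coord S W k)}) :
    IsRamificationIdeal φ I := by
  have := line.locallyOfFiniteType hφ
  refine isRamificationIdeal_of_locally fun x => ?_
  obtain ⟨W, f, g, hW, hp, hk⟩ := H (line.proj S x)
  obtain ⟨k, hx⟩ := line.exists_mem_chart S W x hp
  obtain ⟨h, e⟩ := hk k
  obtain ⟨j, hj⟩ := exists_mem_basicOpen h.coprime hx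
  have hU := line.isAffineOpen_chart S k hW
  refine ⟨_, _, hU.basicOpen _, line.isAffineOpen_chart S j hW, line.basicOpen_quadPair_le hφ h j, hj, ?_⟩
  rw [line.annKaehler_quadPair hW hφ h j, ← map_ideal_res I hU _ ((line S).basicOpen_le _), e, Ideal.map_span,
    Set.image_singleton]

theorem line.ideal_eq_of_isRamificationIdeal (hφ : φ ≫ line.proj S = line.proj S)
    {I : (line S).IdealSheafData} (hI : IsRamificationIdeal φ I) (hW : IsAffineOpen W) (k : Fin 2)
    (h : HasCoords (φ ≫ line.toP1 S) (line.chart S W k) (line.quadPair S W k f g)) :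
    I.ideal ⟨line.chart S W k, line.isAffineOpen_chart S k hW⟩ =
      Ideal.span {quad (fun i => line.scalar S W k (jac f g i)) (line.coord S W k)} := by
  have hU := line.isAffineOpen_chart S k hW
  refine ideal_eq_of_locally hU fun x hx => ?_
  obtain ⟨j, hj⟩ := exists_mem_basicOpen h.coprime hx
  refine ⟨_, (line S).basicOpen_le _, hj, ?_⟩
  rw [map_ideal_res I hU (hU.basicOpen _), Ideal.map_span, Set.image_singleton,
    ← line.annKaehler_quadPair hW hφ h j]
  exact TotallyMarked.isRamificationIdeal_iff.mp hI _ _ _ (line.isAffineOpen_chart S j hW) _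

end Ramification

/-! ### Morphisms of degree two -/

section DegreeTwo

theorem exists_glue {X : Scheme.{u}} {ι : Type} (U : ι → X.Opens) {V : X.Opens} (hU : ∀ i, U i ≤ V)
    (hV : ∀ x ∈ V, ∃ i, x ∈ U i) (s : ∀ i, Γ(X, U i))
    (h : ∀ i j (W : X.Opens) (hi : W ≤ U i) (hj : W ≤ U j), res hi (s i) = res hj (s j)) :
    ∃ t : Γ(X, V), ∀ i, res (hU i) t = s i := by
  obtain ⟨t, ht, -⟩ := TopCat.Sheaf.existsUnique_gluing' X.sheaf U V (fun i => homOfLE (hU i))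
    (fun x hx => TopologicalSpace.Opens.mem_iSup.mpr (hV x hx)) s
    (fun i j => h i j _ inf_le_left inf_le_right)
  exact ⟨t, ht⟩

theorem res_mul_congr {X : Scheme.{u}} {U₁ U₂ U₃ U₄ V V' : X.Opens} {h₁ : V ≤ U₁} {h₂ : V ≤ U₂}
    {h₃ : V ≤ U₃} {h₄ : V ≤ U₄} {x : Γ(X, U₁)} {y : Γ(X, U₂)} {z : Γ(X, U₃)} {w : Γ(X, U₄)} (h : V' ≤ V)
    (e : res h₁ x * res h₂ y = res h₃ z * res h₄ w) :
    res (h.trans h₁) x * res (h.trans h₂) y = res (h.trans h₃) z * res (h.trans h₄) w := by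
  have := congrArg (res h) e
  rwa [map_mul, map_mul, res_res, res_res, res_res, res_res] at this

variable {R : Type u} [CommRing R]

theorem coord_mul_ev {T : Scheme.{u}} (f : T ⟶ P1 R) {V : T.Opens} {a b : Fin 2}
    (ha : V ≤ f ⁻¹ᵁ P1.chart R a) (hb : V ≤ f ⁻¹ᵁ P1.chart R b) (c : Fin 2) :
    ev f ha (P1.coord R a b) * ev f hb (P1.coord R b c) = ev f ha (P1.coord R a c) := by
  have h : V ≤ f ⁻¹ᵁ (P1.chart R a ⊓ P1.chart R b) := fun x hx => ⟨ha hx, hb hx⟩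
  have := congrArg (ev f h) (P1.coord_mul R a b c _ inf_le_left inf_le_right)
  rwa [map_mul, ev_res, ev_res, ev_res] at this

/-- The units trivialize f^*𝒪(1) on `U`, and the pulled back sections X₀, X₁ become functions: a_j =
u_i · X_j / X_i over chart i. -/
theorem exists_hasCoords_of_units {T : Scheme.{u}} (f : T ⟶ P1 R) {U : T.Opens} (hU : IsAffineOpen U)
    (u : ∀ i, Γ(T, U ⊓ f ⁻¹ᵁ P1.chart R i)ˣ)
    (h : ∀ i j (V : T.Opens) (hi : V ≤ U ⊓ f ⁻¹ᵁ P1.chart R i) (hj : V ≤ U ⊓ f ⁻¹ᵁ P1.chart R j),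
      res hj (u j).1 * ev f (hj.trans inf_le_right) (P1.coord R j i) = res hi (u i).1) :
    ∃ a : Fin 2 → Γ(T, U), HasCoords f U a ∧
      ∀ i j, res inf_le_left (a j) = (u i).1 * ev f inf_le_right (P1.coord R i j) := by
  have hc : ∀ x ∈ U, ∃ i, x ∈ U ⊓ f ⁻¹ᵁ P1.chart R i := fun x hx => by
    obtain ⟨i, hi⟩ := P1.exists_mem_chart (f x)
    exact ⟨i, hx, hi⟩
  choose a ha using fun j => exists_glue (fun i => U ⊓ f ⁻¹ᵁ P1.chart R i) (fun i => inf_le_left) hc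
    (fun i => (u i).1 * ev f inf_le_right (P1.coord R i j)) (fun i i' W hi hi' => by
      rw [map_mul, map_mul, res_ev, res_ev, ← h i i' W hi hi', mul_assoc, coord_mul_ev])
  have hs : ∀ i, res inf_le_left (a i) = (u i).1 := fun i => by
    rw [ha i i, P1.coord_self, map_one, mul_one]
  refine ⟨a, ⟨?_, fun i j V hV hf => ?_⟩, fun i j => ha j i⟩
  -- On an affine open set, coprimality follows once the basic open sets of a 0 and a 1 cover; a i
  -- equals the unit u i over chart i.
  · have := (IsAffineOpen.iSup_basicOpen_eq_self_iff hU (s := {a 0, a 1})).mp (le_antisymm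
      (iSup_le fun s => T.basicOpen_le _) fun x hx => ?_)
    · obtain ⟨b, c, h⟩ := Ideal.mem_span_pair.mp ((Ideal.eq_top_iff_one _).mp this)
      exact ⟨b, c, h⟩
    · obtain ⟨i, hi⟩ := hc x hx
      have h1 : U ⊓ f ⁻¹ᵁ P1.chart R i ≤ T.basicOpen (a i) := by
        rw [le_basicOpen_iff inf_le_left, hs]
        exact (u i).isUnit
      refine TopologicalSpace.Opens.mem_iSup.mpr ⟨⟨a i, ?_⟩, h1 hi⟩
      match i with
      | 0 => exact Or.inl rfl
      | 1 => exact Or.inr rfl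
  · have h1 := congrArg (res (le_inf hV hf)) (ha j i)
    have h2 := congrArg (res (le_inf hV hf)) (hs i)
    rw [map_mul, res_res, res_ev] at h1
    rw [res_res] at h2
    rw [h1, h2]

variable {S : Sch R}

theorem line.isoOver_iff {φ : line S ⟶ line S} {W : S.left.Opens} :
    ((line.twist S 1).pullback φ).IsoOver (line.twist S 2) (line.proj S ⁻¹ᵁ W) ↔
    ∃ u : ∀ i k : Fin 2, Γ(line S, line.proj S ⁻¹ᵁ W ⊓ φ ⁻¹ᵁ (line.toP1 S ⁻¹ᵁ P1.chart R i) ⊓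
        line.toP1 S ⁻¹ᵁ P1.chart R k)ˣ,
      ∀ (i j k l : Fin 2) (V : (line S).Opens)
        (hik : V ≤ line.proj S ⁻¹ᵁ W ⊓ φ ⁻¹ᵁ (line.toP1 S ⁻¹ᵁ P1.chart R i) ⊓
          line.toP1 S ⁻¹ᵁ P1.chart R k)
        (hjl : V ≤ line.proj S ⁻¹ᵁ W ⊓ φ ⁻¹ᵁ (line.toP1 S ⁻¹ᵁ P1.chart R j) ⊓
          line.toP1 S ⁻¹ᵁ P1.chart R l),
        res hjl (u j l).1 * ev (φ ≫ line.toP1 S) ((hjl.trans inf_le_left).trans inf_le_right)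
            (P1.coord R j i) =
          ev (line.toP1 S) (hjl.trans inf_le_right) (P1.coord R l k) ^ 2 * res hik (u i k).1 := by
  have h1 : ∀ (i j : Fin 2) (V : (line S).Opens)
      (h : V ≤ φ ⁻¹ᵁ (line.toP1 S ⁻¹ᵁ (P1.chart R i ⊓ P1.chart R j))),
      res h (((line.twist S 1).pullback φ).g i j) =
        ev (φ ≫ line.toP1 S) (h.trans (φ.preimage_mono ((line.toP1 S).preimage_mono inf_le_right)))
          (P1.coord R j i) := by
    intro i j V h
    change res h ((φ.app _).hom (((line.toP1 S).app _).hom (res inf_le_right (P1.coord R j i) ^ 1))) = _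
    rw [pow_one, app_eq_ev (line.toP1 S), app_eq_ev φ]
    rw [ev_ev, res_ev, ev_res]
  have h2 : ∀ (i j : Fin 2) (V : (line S).Opens)
      (h : V ≤ (line.toP1 S ⁻¹ᵁ (P1.chart R i ⊓ P1.chart R j))),
      res h ((line.twist S 2).g i j) =
        ev (line.toP1 S) (h.trans ((line.toP1 S).preimage_mono inf_le_right)) (P1.coord R j i) ^ 2 := by
    intro i j V h
    change res h (((line.toP1 S).app _).hom (res inf_le_right (P1.coord R j i) ^ 2)) = _
    rw [app_eq_ev, map_pow, map_pow, res_ev, ev_res]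
  constructor
  · rintro ⟨u, hu⟩
    refine ⟨u, fun i j k l V hik hjl => ?_⟩
    have hV : V ≤ line.proj S ⁻¹ᵁ W ⊓
        φ ⁻¹ᵁ (line.toP1 S ⁻¹ᵁ (P1.chart R i ⊓ P1.chart R j)) ⊓
        line.toP1 S ⁻¹ᵁ (P1.chart R k ⊓ P1.chart R l) := fun x hx =>
      ⟨⟨(hik hx).1.1, (hik hx).1.2, (hjl hx).1.2⟩, (hik hx).2, (hjl hx).2⟩
    have := res_mul_congr hV (hu i j k l)
    exact (congrArg _ (h1 i j _ _)).symm.trans (this.trans (congrArg (· * _) (h2 k l _ _)))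
  · rintro ⟨u, hu⟩
    refine ⟨u, fun i j k l => ?_⟩
    have := hu i j k l _ (inf_le_inf (inf_le_inf_left _ inf_le_left) inf_le_left)
      (inf_le_inf (inf_le_inf_left _ inf_le_right) inf_le_right)
    refine Eq.trans (congrArg _ (h1 i j _ _)) (this.trans (congrArg (· * _) (h2 k l _ _).symm))

theorem quad_mul {A : Type*} [CommRing A] (f : Fin 3 → A) (l : A) (x : Fin 2 → A) :
    quad f (fun i => l * x i) = l ^ 2 * quad f x := by
  simp only [quad]; ring

theorem line.res_coord {W : S.left.Opens} {k : Fin 2} {V : (line S).Opens} (h : V ≤ line.chart S W k)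
    (j : Fin 2) : res h (line.coord S W k j) = ev (line.toP1 S) (h.trans inf_le_right) (P1.coord R k j) :=
  res_ev _ _ _ _

theorem line.res_scalar {W : S.left.Opens} {k : Fin 2} {V : (line S).Opens} (h : V ≤ line.chart S W k)
    (a : Γ(S.left, W)) : res h (line.scalar S W k a) = ev (line.proj S) (h.trans inf_le_left) a :=
  res_ev _ _ _ _

theorem line.res_quadPair {W : S.left.Opens} (f g : Fin 3 → Γ(S.left, W)) (k l e : Fin 2)
    {V : (line S).Opens} (hk : V ≤ line.chart S W k) (hl : V ≤ line.chart S W l) :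
    res hl (line.quadPair S W l f g e) =
      ev (line.toP1 S) (hl.trans inf_le_right) (P1.coord R l k) ^ 2 *
        res hk (line.quadPair S W k f g e) := by
  have h1 : ∀ m, res hl (line.coord S W l m) =
      ev (line.toP1 S) (hl.trans inf_le_right) (P1.coord R l k) * res hk (line.coord S W k m) := by
    intro m
    rw [line.res_coord, line.res_coord, coord_mul_ev]
  have h2 : ∀ a, res hl (line.scalar S W l a) = res hk (line.scalar S W k a) := fun a =>
    (line.res_scalar _ _).trans (line.res_scalar _ _).symm
  have key : ∀ f : Fin 3 → Γ(S.left, W),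
      res hl (quad (fun i => line.scalar S W l (f i)) (line.coord S W l)) =
      ev (line.toP1 S) (hl.trans inf_le_right) (P1.coord R l k) ^ 2 *
        res hk (quad (fun i => line.scalar S W k (f i)) (line.coord S W k)) := by
    intro f
    rw [map_quad, map_quad, ← quad_mul]
    simp only [h1, h2]
  match e with
  | 0 => exact key f
  | 1 => exact key g

/-- The isomorphism is given on chart k by the i-th quadratic form, which is invertible where φ
lands in chart i. -/
theorem line.isoOver_of_quadPair {φ : line S ⟶ line S} {W : S.left.Opens} {f g : Fin 3 → Γ(S.left, W)}
    (h : ∀ k, HasCoords (φ ≫ line.toP1 S) (line.chart S W k) (line.quadPair S W k f g)) :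
    ((line.twist S 1).pullback φ).IsoOver (line.twist S 2) (line.proj S ⁻¹ᵁ W) := by
  have hle : ∀ i k, line.proj S ⁻¹ᵁ W ⊓ φ ⁻¹ᵁ (line.toP1 S ⁻¹ᵁ P1.chart R i) ⊓
        line.toP1 S ⁻¹ᵁ P1.chart R k ≤ line.chart S W k := fun i k x hx => ⟨hx.1.1, hx.2⟩
  have hu : ∀ i k, IsUnit (res (hle i k) (line.quadPair S W k f g i)) := fun i k => by
    rw [← le_basicOpen_iff, (h k).basicOpen_eq i]
    exact fun x hx => ⟨hle i k hx, hx.1.2⟩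
  refine line.isoOver_iff.mpr ⟨fun i k => (hu i k).unit, fun i j k l V hik hjl => ?_⟩
  rw [IsUnit.unit_spec, IsUnit.unit_spec, res_res, res_res]
  refine ((h l).eq j i V (hjl.trans (hle j l)) _).symm.trans ?_
  exact line.res_quadPair f g k l i (hik.trans (hle i k)) (hjl.trans (hle j l))

variable [IsLocalization.Away (2 : ℤ) R]

/-- The isomorphism carries the pullbacks of X₀ and X₁ to sections of 𝒪(2), and over an affine base
these are binary quadratic forms. -/
theorem line.exists_quadPair_of_isoOver {φ : line S ⟶ line S} {W W' : S.left.Opens} (hW' : IsAffineOpen W')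
    (hWW : W' ≤ W)
    (h : ((line.twist S 1).pullback φ).IsoOver (line.twist S 2) (line.proj S ⁻¹ᵁ W)) :
    ∃ f g : Fin 3 → Γ(S.left, W'),
      ∀ k, HasCoords (φ ≫ line.toP1 S) (line.chart S W' k) (line.quadPair S W' k f g) := by
  obtain ⟨u, hu⟩ := line.isoOver_iff.mp h
  have hle : ∀ i k, line.chart S W' k ⊓ (φ ≫ line.toP1 S) ⁻¹ᵁ P1.chart R i ≤
      line.proj S ⁻¹ᵁ W ⊓ φ ⁻¹ᵁ (line.toP1 S ⁻¹ᵁ P1.chart R i) ⊓ line.toP1 S ⁻¹ᵁ P1.chart R k :=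
    fun i k x hx => ⟨⟨hWW hx.1.1, hx.2⟩, hx.1.2⟩
  choose a ha hau using fun k => exists_hasCoords_of_units (φ ≫ line.toP1 S)
    (line.isAffineOpen_chart S k hW') (fun i => Units.map (res (hle i k)).toMonoidHom (u i k))
    (fun i j V hi hj => by
      have := hu i j k k V (hi.trans (hle i k)) (hj.trans (hle j k))
      rw [P1.coord_self, map_one, one_pow, one_mul] at this
      refine Eq.trans (congrArg (· * _) (res_res _ _ _)) (this.trans (res_res _ _ _).symm))
  have key : ∀ e, ∃ f : Fin 3 → Γ(S.left, W'), ∀ k,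
      a k e = quad (fun i => line.scalar S W' k (f i)) (line.coord S W' k) := by
    intro e
    obtain ⟨c, hc⟩ := line.exists_homForm hW' (d := 2) (p := fun k => a k e) (by
      refine section_ext fun x hx => ?_
      obtain ⟨i, hi⟩ := P1.exists_mem_chart ((φ ≫ line.toP1 S) x)
      refine ⟨line.chart S W' 0 ⊓ line.chart S W' 1 ⊓ (φ ≫ line.toP1 S) ⁻¹ᵁ P1.chart R i, inf_le_left,
        ⟨hx, hi⟩, ?_⟩
      have h0 : line.chart S W' 0 ⊓ line.chart S W' 1 ⊓ (φ ≫ line.toP1 S) ⁻¹ᵁ P1.chart R i ≤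
        line.chart S W' 0 ⊓ (φ ≫ line.toP1 S) ⁻¹ᵁ P1.chart R i := inf_le_inf_right _ inf_le_left
      have h1 : line.chart S W' 0 ⊓ line.chart S W' 1 ⊓ (φ ≫ line.toP1 S) ⁻¹ᵁ P1.chart R i ≤
        line.chart S W' 1 ⊓ (φ ≫ line.toP1 S) ⁻¹ᵁ P1.chart R i := inf_le_inf_right _ inf_le_right
      have e0 := congrArg (res h0) (hau 0 i e)
      have e1 := congrArg (res h1) (hau 1 i e)
      have e2 := hu i i 0 1 _ (h0.trans (hle i 0)) (h1.trans (hle i 1))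
      rw [P1.coord_self, map_one, mul_one] at e2
      rw [map_mul, res_res, res_ev] at e0 e1
      have e0' : res h0 ((Units.map (res (hle i 0)).toMonoidHom (u i 0)).1) = res (h0.trans (hle i 0)) (u i 0).1 :=
        res_res _ _ _
      have e1' : res h1 ((Units.map (res (hle i 1)).toMonoidHom (u i 1)).1) = res (h1.trans (hle i 1)) (u i 1).1 :=
        res_res _ _ _
      rw [e0'] at e0
      rw [e1', e2] at e1
      rw [map_mul, map_pow, res_res, res_res, res_res, e0, e1, line.res_coord, mul_assoc])
    refine ⟨fun i => c i, fun k => (hc k).trans ?_⟩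
    simp [homForm, quad, Finset.sum_range_succ]
    ring
  obtain ⟨f, hf⟩ := key 0
  obtain ⟨g, hg⟩ := key 1
  refine ⟨f, g, fun k => ?_⟩
  have : a k = line.quadPair S W' k f g := by
    funext e
    match e with
    | 0 => exact hf k
    | 1 => exact hg k
  exact this ▸ ha k

end DegreeTwo

/-! ### Standard maps -/

section StdAlgebra

variable {A B : Type*} [CommRing A] [CommRing B]

/-- The quadratic forms of the standard map with fixed points `c 0`, `c 1`, `c 2` and critical points
`c 3`, `c 4`. -/
def stdCoeff (c : Fin 5 → Fin 2 → A) (e : Fin 2) (i : Fin 3) : A :=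
  stdForm (fun j => c (Fin.castAdd 2 j)) (c 3) (c 4) e i

/-- The value of the standard map at `y`. -/
def stdVal (c : Fin 5 → Fin 2 → A) (y : Fin 2 → A) (e : Fin 2) : A := quad (stdCoeff c e) y

theorem map_stdCoeff (φ : A →+* B) (c : Fin 5 → Fin 2 → A) (e : Fin 2) (i : Fin 3) :
    φ (stdCoeff c e i) = stdCoeff (fun i k => φ (c i k)) e i := map_stdForm _ _ _ φ e i

theorem map_stdVal (φ : A →+* B) (c : Fin 5 → Fin 2 → A) (y : Fin 2 → A) (e : Fin 2) :
    φ (stdVal c y e) = stdVal (fun i k => φ (c i k)) (fun k => φ (y k)) e := by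
  simp only [stdVal, map_quad, map_stdCoeff]

theorem stdVal_smul (l : Fin 5 → A) (m : A) (c : Fin 5 → Fin 2 → A) (y : Fin 2 → A) (e : Fin 2) :
    stdVal (fun i k => l i * c i k) (fun k => m * y k) e =
      l 0 * l 1 * l 2 * l 3 ^ 3 * l 4 ^ 3 * m ^ 2 * stdVal c y e := by
  have : ∀ i, stdCoeff (fun i k => l i * c i k) e i =
      l 0 * l 1 * l 2 * l 3 ^ 3 * l 4 ^ 3 * stdCoeff c e i := fun i =>
    stdForm_smul _ _ _ (fun j => l (Fin.castAdd 2 j)) _ _ e i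
  simp only [stdVal, quad, this]
  ring

/-- Five points in general position: the two critical points are distinct,
and no two of the fixed points are harmonic conjugates with respect to them. -/
structure Nondeg (c : Fin 5 → Fin 2 → A) : Prop where
  br : IsUnit (br (c 3) (c 4))
  pairing₁₂ : IsUnit (pairing (c 3) (c 4) (c 1) (c 2))
  pairing₀₂ : IsUnit (pairing (c 3) (c 4) (c 0) (c 2))
  pairing₀₁ : IsUnit (pairing (c 3) (c 4) (c 0) (c 1))

theorem map_pairing (φ : A →+* B) (a b x y : Fin 2 → A) : φ (pairing a b x y) =
    pairing (fun k => φ (a k)) (fun k => φ (b k)) (fun k => φ (x k)) (fun k => φ (y k)) := by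
  simp only [pairing, map_add, map_mul, map_br]

theorem Nondeg.map {c : Fin 5 → Fin 2 → A} (h : Nondeg c) (φ : A →+* B) :
    Nondeg (fun i k => φ (c i k)) where
  br := by have := h.br.map φ; rwa [map_br] at this
  pairing₁₂ := by have := h.pairing₁₂.map φ; rwa [map_pairing] at this
  pairing₀₂ := by have := h.pairing₀₂.map φ; rwa [map_pairing] at this
  pairing₀₁ := by have := h.pairing₀₁.map φ; rwa [map_pairing] at this

theorem Nondeg.isUnit_br {c : Fin 5 → Fin 2 → A} (h : Nondeg c) :
    IsUnit (TotallyMarked.br (stdV (fun j => c (Fin.castAdd 2 j)) (c 3) (c 4))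
      (stdW (fun j => c (Fin.castAdd 2 j)) (c 3) (c 4))) := by
  rw [br_stdV_stdW]
  exact ((h.pairing₁₂.mul h.pairing₀₂).mul h.pairing₀₁).mul h.br

theorem nondeg_of_isUnit {c : Fin 5 → Fin 2 → A}
    (h : IsUnit (TotallyMarked.br (stdV (fun j => c (Fin.castAdd 2 j)) (c 3) (c 4))
      (stdW (fun j => c (Fin.castAdd 2 j)) (c 3) (c 4)))) : Nondeg c := by
  rw [br_stdV_stdW] at h
  exact ⟨isUnit_of_mul_isUnit_right h,
    isUnit_of_mul_isUnit_left (isUnit_of_mul_isUnit_left (isUnit_of_mul_isUnit_left h)),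
    isUnit_of_mul_isUnit_right (isUnit_of_mul_isUnit_left (isUnit_of_mul_isUnit_left h)),
    isUnit_of_mul_isUnit_right (isUnit_of_mul_isUnit_left h)⟩

theorem Nondeg.isCoprime {c : Fin 5 → Fin 2 → A} (h : Nondeg c) {y : Fin 2 → A}
    (hy : IsCoprime (y 0) (y 1)) : IsCoprime (stdVal c y 0) (stdVal c y 1) :=
  isCoprime_quad_stdForm _ _ _ h.br h.isUnit_br hy

theorem br_smul (l m : A) (a b : Fin 2 → A) :
    br (fun k => l * a k) (fun k => m * b k) = l * m * br a b := by
  simp only [br]; ring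

theorem pairing_smul (l m n o : A) (a b x y : Fin 2 → A) :
    pairing (fun k => l * a k) (fun k => m * b k) (fun k => n * x k) (fun k => o * y k) =
      l * m * n * o * pairing a b x y := by
  simp only [pairing, br]; ring

theorem br_stdVal (c : Fin 5 → Fin 2 → A) (y : Fin 2 → A) : br y (stdVal c y) =
    br (c 3) (c 4) ^ 3 * (br y (c 0) * br y (c 1) * br y (c 2)) := by
  have h := br_quad (stdCoeff c 0) (stdCoeff c 1) y
  have h1 : stdVal c y = ![quad (stdCoeff c 0) y, quad (stdCoeff c 1) y] := by
    funext e
    match e with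
    | 0 => rfl
    | 1 => rfl
  have h2 : ∀ i, fixForm (stdCoeff c 0) (stdCoeff c 1) i =
      br (c 3) (c 4) ^ 3 * cubicForm (fun j => c (Fin.castAdd 2 j)) i := fixForm_stdForm _ _ _
  have h3 := cubicForm_eval (fun j => c (Fin.castAdd 2 j)) y
  rw [h1, h, h2, h2, h2, h2]
  refine Eq.trans ?_ (congrArg _ h3.symm)
  ring

end StdAlgebra

/-! ### Five points of ℙ¹ in general position and gluing of the standard map -/

section Points

variable {R : Type u} [CommRing R] {T T' : Scheme.{u}}

/-- The vectors `c` are homogeneous coordinates of the five morphisms `p` on `U`. -/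
def HasPtsCoords (p : Fin 5 → (T ⟶ P1 R)) (U : T.Opens) (c : Fin 5 → Fin 2 → Γ(T, U)) : Prop :=
  ∀ i, HasCoords (p i) U (c i)

theorem HasPtsCoords.comp {p : Fin 5 → (T ⟶ P1 R)} {U : T.Opens} {c : Fin 5 → Fin 2 → Γ(T, U)}
    (h : HasPtsCoords p U c) (k : T' ⟶ T) {V : T'.Opens} (hV : V ≤ k ⁻¹ᵁ U) :
    HasPtsCoords (fun i => k ≫ p i) V (fun i j => ev k hV (c i j)) := fun i => (h i).comp k hV

theorem HasPtsCoords.restrict {p : Fin 5 → (T ⟶ P1 R)} {U : T.Opens} {c : Fin 5 → Fin 2 → Γ(T, U)}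
    (h : HasPtsCoords p U c) {V : T.Opens} (hV : V ≤ U) :
    HasPtsCoords p V (fun i j => res hV (c i j)) := fun i => (h i).restrict hV

theorem mem_iInf_opens {X : Scheme.{u}} {ι : Type*} [Finite ι] {U : ι → X.Opens} {x : X} :
    x ∈ ⨅ i, U i ↔ ∀ i, x ∈ U i := by
  change x ∈ ((⨅ i, U i : X.Opens) : Set X) ↔ _
  rw [TopologicalSpace.Opens.coe_iInf]
  exact Set.mem_iInter

theorem exists_hasPtsCoords (p : Fin 5 → (T ⟶ P1 R)) (x : T) :
    ∃ (U : T.Opens) (c : Fin 5 → Fin 2 → Γ(T, U)), x ∈ U ∧ HasPtsCoords p U c := by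
  choose k hk using fun i => P1.exists_mem_chart (p i x)
  have hle : ∀ i, (⨅ i, p i ⁻¹ᵁ P1.chart R (k i)) ≤ p i ⁻¹ᵁ P1.chart R (k i) := fun i => iInf_le _ i
  refine ⟨⨅ i, p i ⁻¹ᵁ P1.chart R (k i), _, ?_, fun i => (hasCoords_chart (p i) (k i)).restrict (hle i)⟩
  exact mem_iInf_opens.mpr hk

/-- The morphism `Φ` is locally the value at `y` of the standard map given by the points `p`. -/
def IsStd (p : Fin 5 → (T ⟶ P1 R)) (y Φ : T ⟶ P1 R) : Prop :=
  ∀ x : T, ∃ (U : T.Opens) (c : Fin 5 → Fin 2 → Γ(T, U)) (v : Fin 2 → Γ(T, U)), x ∈ U ∧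
    HasPtsCoords p U c ∧ HasCoords y U v ∧ HasCoords Φ U (stdVal c v)

/-- Five points are in general position. -/
def Good (p : Fin 5 → (T ⟶ P1 R)) : Prop :=
  ∀ x : T, ∃ (U : T.Opens) (c : Fin 5 → Fin 2 → Γ(T, U)), x ∈ U ∧ HasPtsCoords p U c ∧ Nondeg c

theorem HasPtsCoords.exists_unit {p : Fin 5 → (T ⟶ P1 R)} {U : T.Opens} {c d : Fin 5 → Fin 2 → Γ(T, U)}
    (hc : HasPtsCoords p U c) (hd : HasPtsCoords p U d) :
    ∃ l : Fin 5 → Γ(T, U), (∀ i, IsUnit (l i)) ∧ d = fun i k => l i * c i k := by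
  choose l hl using fun i => (hc i).exists_unit (hd i)
  exact ⟨fun i => (l i).1, fun i => (l i).isUnit, funext fun i => funext fun k => hl i k⟩

theorem Nondeg.smul {A : Type*} [CommRing A] {c : Fin 5 → Fin 2 → A} (h : Nondeg c) {l : Fin 5 → A}
    (hl : ∀ i, IsUnit (l i)) : Nondeg (fun i k => l i * c i k) where
  br := by rw [br_smul]; exact ((hl _).mul (hl _)).mul h.br
  pairing₁₂ := by rw [pairing_smul]; exact ((((hl _).mul (hl _)).mul (hl _)).mul (hl _)).mul h.pairing₁₂
  pairing₀₂ := by rw [pairing_smul]; exact ((((hl _).mul (hl _)).mul (hl _)).mul (hl _)).mul h.pairing₀₂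
  pairing₀₁ := by rw [pairing_smul]; exact ((((hl _).mul (hl _)).mul (hl _)).mul (hl _)).mul h.pairing₀₁

/-- Two coordinate systems differ by units and the four conditions are multihomogeneous, so one good
system at each point suffices. -/
theorem Good.nondeg {p : Fin 5 → (T ⟶ P1 R)} (h : Good p) {U : T.Opens} {c : Fin 5 → Fin 2 → Γ(T, U)}
    (hc : HasPtsCoords p U c) : Nondeg c := by
  have key : ∀ x ∈ U, ∃ (V : T.Opens) (hV : V ≤ U), x ∈ V ∧ Nondeg (fun i k => res hV (c i k)) := by
    intro x hx
    obtain ⟨V, d, hxV, hd, hn⟩ := h x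
    obtain ⟨l, hl, e⟩ := (hd.restrict (inf_le_right : U ⊓ V ≤ V)).exists_unit
      (hc.restrict (inf_le_left : U ⊓ V ≤ U))
    exact ⟨U ⊓ V, inf_le_left, ⟨hx, hxV⟩, e ▸ (hn.map (res inf_le_right)).smul hl⟩
  constructor
  · refine isUnit_of_locally fun x hx => ?_
    obtain ⟨V, hV, hxV, hn⟩ := key x hx
    exact ⟨V, hV, hxV, by rw [map_br]; exact hn.br⟩
  · refine isUnit_of_locally fun x hx => ?_
    obtain ⟨V, hV, hxV, hn⟩ := key x hx
    exact ⟨V, hV, hxV, by rw [map_pairing]; exact hn.pairing₁₂⟩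
  · refine isUnit_of_locally fun x hx => ?_
    obtain ⟨V, hV, hxV, hn⟩ := key x hx
    exact ⟨V, hV, hxV, by rw [map_pairing]; exact hn.pairing₀₂⟩
  · refine isUnit_of_locally fun x hx => ?_
    obtain ⟨V, hV, hxV, hn⟩ := key x hx
    exact ⟨V, hV, hxV, by rw [map_pairing]; exact hn.pairing₀₁⟩

theorem Good.comp {p : Fin 5 → (T ⟶ P1 R)} (h : Good p) (k : T' ⟶ T) : Good (fun i => k ≫ p i) := by
  intro x
  obtain ⟨U, c, hx, hc, hn⟩ := h (k x)
  exact ⟨k ⁻¹ᵁ U, _, hx, hc.comp k le_rfl, hn.map _⟩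

theorem IsStd.comp {p : Fin 5 → (T ⟶ P1 R)} {y Φ : T ⟶ P1 R} (h : IsStd p y Φ) (k : T' ⟶ T) :
    IsStd (fun i => k ≫ p i) (k ≫ y) (k ≫ Φ) := by
  intro x
  obtain ⟨U, c, v, hx, hc, hv, hΦ⟩ := h (k x)
  refine ⟨k ⁻¹ᵁ U, _, _, hx, hc.comp k le_rfl, hv.comp k le_rfl, ?_⟩
  have := hΦ.comp k le_rfl
  convert this using 1
  funext e
  exact (map_stdVal _ _ _ _).symm

/-- Other coordinates of the points and of the argument only rescale the value. This serves as the
gluing condition and gives uniqueness. -/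
theorem br_stdVal_eq_zero {p : Fin 5 → (T ⟶ P1 R)} {y : T ⟶ P1 R} {U : T.Opens}
    {c d : Fin 5 → Fin 2 → Γ(T, U)} {v w : Fin 2 → Γ(T, U)} (hc : HasPtsCoords p U c)
    (hd : HasPtsCoords p U d) (hv : HasCoords y U v) (hw : HasCoords y U w) :
    br (stdVal c v) (stdVal d w) = 0 := by
  obtain ⟨l, -, rfl⟩ := hc.exists_unit hd
  obtain ⟨m, hm⟩ := hv.exists_unit hw
  have hm' : w = fun k => m.1 * v k := funext hm
  have : stdVal (fun i k => l i * c i k) w = fun e => l 0 * l 1 * l 2 * l 3 ^ 3 * l 4 ^ 3 * m.1 ^ 2 * stdVal c v e :=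
    funext fun e => by rw [hm', stdVal_smul]
  rw [this]
  simp only [br]
  ring

theorem IsStd.hasCoords {p : Fin 5 → (T ⟶ P1 R)} {y Φ : T ⟶ P1 R} (h : IsStd p y Φ) {U : T.Opens}
    {c : Fin 5 → Fin 2 → Γ(T, U)} {v : Fin 2 → Γ(T, U)} (hc : HasPtsCoords p U c) (hv : HasCoords y U v)
    (hn : Nondeg c) : HasCoords Φ U (stdVal c v) := by
  refine HasCoords.of_locally (hn.isCoprime hv.coprime) fun x hx => ?_
  obtain ⟨V, d, w, hxV, hd, hw, hΦ⟩ := h x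
  refine ⟨U ⊓ V, inf_le_left, ⟨hx, hxV⟩, ?_⟩
  refine (hΦ.restrict (inf_le_right : U ⊓ V ≤ V)).of_br_eq_zero ?_ ?_
  · exact (hn.isCoprime hv.coprime).map _
  · simp only [map_stdVal]
    exact br_stdVal_eq_zero (hd.restrict inf_le_right) (hc.restrict inf_le_left)
      (hw.restrict inf_le_right) (hv.restrict inf_le_left)

theorem IsStd.eq [IsLocalization.Away (2 : ℤ) R] {p : Fin 5 → (T ⟶ P1 R)} {y Φ Ψ : T ⟶ P1 R} (h : IsStd p y Φ) (h' : IsStd p y Ψ) :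
    Φ = Ψ := by
  refine hom_ext_of_locally fun x => ?_
  obtain ⟨U, c, v, hx, hc, hv, hΦ⟩ := h x
  obtain ⟨V, d, w, hxV, hd, hw, hΨ⟩ := h' x
  refine ⟨U ⊓ V, ⟨hx, hxV⟩, ?_⟩
  refine (hΦ.restrict (inf_le_left : U ⊓ V ≤ U)).ι_comp_eq' (hΨ.restrict inf_le_right) ?_
  simp only [map_stdVal]
  exact br_stdVal_eq_zero (hc.restrict inf_le_left) (hd.restrict inf_le_right)
      (hv.restrict inf_le_left) (hw.restrict inf_le_right)

theorem Good.exists_isStd [IsLocalization.Away (2 : ℤ) R] {p : Fin 5 → (T ⟶ P1 R)} (h : Good p)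
    (y : T ⟶ P1 R) : ∃ Φ, IsStd p y Φ := by
  let ι := { k : Σ U : T.Opens, (Fin 5 → Fin 2 → Γ(T, U)) × (Fin 2 → Γ(T, U)) //
    HasPtsCoords p k.1 k.2.1 ∧ HasCoords y k.1 k.2.2 }
  have hcov : ∀ x : T, ∃ i : ι, x ∈ i.1.1 := fun x => by
    obtain ⟨U, c, hx, hc⟩ := exists_hasPtsCoords p x
    obtain ⟨k, hk⟩ := P1.exists_mem_chart (y x)
    exact ⟨⟨⟨U ⊓ y ⁻¹ᵁ P1.chart R k, _, _⟩, hc.restrict inf_le_left,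
      (hasCoords_chart y k).restrict inf_le_right⟩, hx, hk⟩
  obtain ⟨Φ, hΦ⟩ := exists_hasCoords (y ≫ P1.toSpec R) (fun i : ι => i.1.1)
    (fun i => stdVal i.1.2.1 i.1.2.2) hcov
    (fun i => (h.nondeg i.2.1).isCoprime i.2.2.coprime) (fun i j => by
      simp only [map_stdVal]
      exact br_stdVal_eq_zero (i.2.1.restrict inf_le_left) (j.2.1.restrict inf_le_right)
        (i.2.2.restrict inf_le_left) (j.2.2.restrict inf_le_right))
  refine ⟨Φ, fun x => ?_⟩
  obtain ⟨i, hi⟩ := hcov x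
  exact ⟨_, _, _, hi, i.2.1, i.2.2, hΦ i⟩

end Points

/-! ### Points of the moduli space -/

section Moduli

variable {R : Type u} [CommRing R] {T : Scheme.{u}}

theorem P1Five.hasPtsCoords (ε : Fin 5 → Fin 2) :
    HasPtsCoords (P1Five.π R) (P1Five.chart R ε) (P1Five.coord R ε) := fun i => by
  have := (hasCoords_chart (P1Five.π R i) (ε i)).restrict (V := P1Five.chart R ε) (iInf_le _ i)
  convert this using 1
  funext a
  rw [P1Five.coord, app_eq_ev]
  rfl

theorem P1Five.exists_mem_chart (x : P1Five R) : ∃ ε, x ∈ P1Five.chart R ε := by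
  choose ε hε using fun i => P1.exists_mem_chart (P1Five.π R i x)
  exact ⟨ε, mem_iInf_opens.mpr hε⟩

/-- The equations on (ℙ¹)⁵ use normalized coordinates on each chart; since they change by units, any
coordinates on `T` may be used to test them. -/
theorem mem_iSup_basicOpen_iff (h : T ⟶ P1Five R) {U : T.Opens} {x : T} (hx : x ∈ U)
    (s : ∀ ε, Γ(P1Five R, P1Five.chart R ε)) (t : Γ(T, U))
    (H : ∀ (ε) (V : T.Opens) (hV : V ≤ U) (hV' : V ≤ h ⁻¹ᵁ P1Five.chart R ε),
      ∃ l, IsUnit l ∧ ev h hV' (s ε) = l * res hV t) :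
    h x ∈ ⨆ ε, (P1Five R).basicOpen (s ε) ↔ x ∈ T.basicOpen t := by
  have key : ∀ ε, h x ∈ P1Five.chart R ε → (h x ∈ (P1Five R).basicOpen (s ε) ↔ x ∈ T.basicOpen t) := by
    intro ε hε
    obtain ⟨l, hl, e⟩ := H ε (U ⊓ h ⁻¹ᵁ P1Five.chart R ε) inf_le_left inf_le_right
    have e1 := basicOpen_ev h (inf_le_right : U ⊓ h ⁻¹ᵁ P1Five.chart R ε ≤ _) (s ε)
    have e2 : T.basicOpen (res (inf_le_left : U ⊓ h ⁻¹ᵁ P1Five.chart R ε ≤ U) t) =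
        (U ⊓ h ⁻¹ᵁ P1Five.chart R ε) ⊓ T.basicOpen t := Scheme.basicOpen_res _ _ _
    rw [e, Scheme.basicOpen_mul, Scheme.basicOpen_of_isUnit _ hl, e2] at e1
    have : x ∈ U ⊓ h ⁻¹ᵁ P1Five.chart R ε := ⟨hx, hε⟩
    constructor
    · intro hs
      have : x ∈ (U ⊓ h ⁻¹ᵁ P1Five.chart R ε) ⊓ h ⁻¹ᵁ (P1Five R).basicOpen (s ε) := ⟨this, hs⟩
      rw [← e1] at this
      exact this.2.2
    · intro ht
      have : x ∈ (U ⊓ h ⁻¹ᵁ P1Five.chart R ε) ⊓ ((U ⊓ h ⁻¹ᵁ P1Five.chart R ε) ⊓ T.basicOpen t) :=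
        ⟨this, this, ht⟩
      rw [e1] at this
      exact this.2
  rw [TopologicalSpace.Opens.mem_iSup]
  constructor
  · rintro ⟨ε, hε⟩
    exact (key ε ((P1Five R).basicOpen_le _ hε)).mp hε
  · intro ht
    obtain ⟨ε, hε⟩ := P1Five.exists_mem_chart (h x)
    exact ⟨ε, (key ε hε).mpr ht⟩

theorem mem_ratTMOpen_iff (h : T ⟶ P1Five R) {U : T.Opens} {x : T} (hx : x ∈ U)
    {c : Fin 5 → Fin 2 → Γ(T, U)} (hc : HasPtsCoords (fun i => h ≫ P1Five.π R i) U c) :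
    h x ∈ ratTMOpen R ↔ ((x ∈ T.basicOpen (br (c 3) (c 4)) ∧
      x ∈ T.basicOpen (pairing (c 3) (c 4) (c 1) (c 2))) ∧
      x ∈ T.basicOpen (pairing (c 3) (c 4) (c 0) (c 2))) ∧
      x ∈ T.basicOpen (pairing (c 3) (c 4) (c 0) (c 1)) := by
  have key : ∀ (ε) (V : T.Opens) (hV : V ≤ U) (hV' : V ≤ h ⁻¹ᵁ P1Five.chart R ε),
      ∃ l : Fin 5 → Γ(T, V), (∀ i, IsUnit (l i)) ∧
        ∀ i k, ev h hV' (P1Five.coord R ε i k) = l i * res hV (c i k) := fun ε V hV hV' => by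
    obtain ⟨l, hl, e⟩ := (hc.restrict hV).exists_unit ((P1Five.hasPtsCoords ε).comp h hV')
    exact ⟨l, hl, fun i k => congrFun (congrFun e i) k⟩
  have hC : h x ∈ P1Five.complC R ↔ x ∈ T.basicOpen (br (c 3) (c 4)) := by
    refine mem_iSup_basicOpen_iff h hx _ _ fun ε V hV hV' => ?_
    obtain ⟨l, hl, e⟩ := key ε V hV hV'
    refine ⟨_, (hl 3).mul (hl 4), ?_⟩
    simp only [P1Five.bracket, map_sub, map_mul, e, br]
    ring
  have hR : ∀ j k, h x ∈ P1Five.complR R j k ↔ x ∈ T.basicOpen (pairing (c 3) (c 4) (c j) (c k)) := by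
    intro j k
    refine mem_iSup_basicOpen_iff h hx _ _ fun ε V hV hV' => ?_
    obtain ⟨l, hl, e⟩ := key ε V hV hV'
    refine ⟨_, (((hl 3).mul (hl 4)).mul (hl j)).mul (hl k), ?_⟩
    simp only [P1Five.bracket, map_add, map_sub, map_mul, e, br, pairing]
    ring
  rw [← hC, ← hR, ← hR, ← hR]
  rfl

theorem good_iff (h : T ⟶ P1Five R) :
    Good (fun i => h ≫ P1Five.π R i) ↔ ∀ x, h x ∈ ratTMOpen R := by
  constructor
  · intro H x
    obtain ⟨U, c, hx, hc, hn⟩ := H x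
    rw [mem_ratTMOpen_iff h hx hc, Scheme.basicOpen_of_isUnit _ hn.br,
      Scheme.basicOpen_of_isUnit _ hn.pairing₁₂, Scheme.basicOpen_of_isUnit _ hn.pairing₀₂,
      Scheme.basicOpen_of_isUnit _ hn.pairing₀₁]
    exact ⟨⟨⟨hx, hx⟩, hx⟩, hx⟩
  · intro H x
    obtain ⟨U, c, hx, hc⟩ := exists_hasPtsCoords (fun i => h ≫ P1Five.π R i) x
    obtain ⟨⟨⟨h1, h2⟩, h3⟩, h4⟩ := (mem_ratTMOpen_iff h hx hc).mp (H x)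
    let V := T.basicOpen (br (c 3) (c 4)) ⊓ T.basicOpen (pairing (c 3) (c 4) (c 1) (c 2)) ⊓
      T.basicOpen (pairing (c 3) (c 4) (c 0) (c 2)) ⊓ T.basicOpen (pairing (c 3) (c 4) (c 0) (c 1))
    have hV : V ≤ U := inf_le_right.trans (T.basicOpen_le _)
    refine ⟨V, _, ⟨⟨⟨h1, h2⟩, h3⟩, h4⟩, hc.restrict hV, ?_, ?_, ?_, ?_⟩
    · rw [← map_br, ← le_basicOpen_iff]
      exact inf_le_left.trans (inf_le_left.trans inf_le_left)
    · rw [← map_pairing, ← le_basicOpen_iff]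
      exact inf_le_left.trans (inf_le_left.trans inf_le_right)
    · rw [← map_pairing, ← le_basicOpen_iff]
      exact inf_le_left.trans inf_le_right
    · rw [← map_pairing, ← le_basicOpen_iff]
      exact inf_le_right

theorem P1Five.hom_ext {f g : T ⟶ P1Five R} [IsLocalization.Away (2 : ℤ) R]
    (h : ∀ i, f ≫ P1Five.π R i = g ≫ P1Five.π R i) : f = g :=
  WidePullback.hom_ext _ _ _ h (toSpec_ext R _ _)

theorem ratTM.good : Good (ratTM.point R) := by
  refine (good_iff (ratTMOpen R).ι).mpr fun x => x.2

theorem exists_hom_ratTM [IsLocalization.Away (2 : ℤ) R] {S : Sch R} {p : Fin 5 → (S.left ⟶ P1 R)}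
    (h : Good p) : ∃ f : S ⟶ ratTM R, ∀ i, f.left ≫ ratTM.point R i = p i := by
  let k : S.left ⟶ P1Five R := WidePullback.lift S.hom p (fun i => toSpec_ext R _ _)
  have hk : ∀ i, k ≫ P1Five.π R i = p i := fun i => WidePullback.lift_π _ _ _ _ _
  have hg := (good_iff k).mp (by simpa only [hk] using h)
  have hr : Set.range k ⊆ Set.range (ratTMOpen R).ι := by
    rintro _ ⟨x, rfl⟩
    rw [Scheme.Opens.range_ι]
    exact hg x
  let f := IsOpenImmersion.lift (ratTMOpen R).ι k hr
  have hf : f ≫ (ratTMOpen R).ι = k := IsOpenImmersion.lift_fac _ _ hr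
  refine ⟨Over.homMk f (toSpec_ext R _ _), fun i => ?_⟩
  change f ≫ (ratTMOpen R).ι ≫ P1Five.π R i = p i
  rw [← Category.assoc, hf, hk]

theorem ratTM.hom_ext [IsLocalization.Away (2 : ℤ) R] {S : Sch R} {f g : S ⟶ ratTM R}
    (h : ∀ i, f.left ≫ ratTM.point R i = g.left ≫ ratTM.point R i) : f = g := by
  refine Over.OverMorphism.ext ?_
  refine (cancel_mono (ratTMOpen R).ι).mp ?_
  refine P1Five.hom_ext fun i => ?_
  exact (Category.assoc _ _ _).trans ((h i).trans (Category.assoc _ _ _).symm)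

end Moduli

/-! ### Totally marked maps and standard maps -/

section Forms

variable {A B : Type*} [CommRing A] [CommRing B]

/-- Extension of a finite family by zero. -/
def extendZero {n : ℕ} (v : Fin n → A) (i : ℕ) : A := if h : i < n then v ⟨i, h⟩ else 0

theorem homForm_two (v : Fin 3 → A) (x : Fin 2 → A) : homForm 2 (extendZero v) x = quad v x := by
  simp [homForm, quad, Finset.sum_range_succ, extendZero]
  ring

theorem homForm_three (v : Fin 4 → A) (x : Fin 2 → A) : homForm 3 (extendZero v) x =
    v 0 * x 0 ^ 3 + v 1 * (x 0 ^ 2 * x 1) + v 2 * (x 0 * x 1 ^ 2) + v 3 * x 1 ^ 3 := by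
  simp [homForm, Finset.sum_range_succ, extendZero]
  ring

theorem map_extendZero {n : ℕ} (φ : A →+* B) (v : Fin n → A) :
    (fun i => φ (extendZero v i)) = extendZero (fun i => φ (v i)) := by
  funext i
  by_cases h : i < n <;> simp [extendZero, h]

theorem map_fixForm (φ : A →+* B) (f g : Fin 3 → A) (i : Fin 4) :
    φ (fixForm f g i) = fixForm (fun i => φ (f i)) (fun i => φ (g i)) i := by
  fin_cases i <;> simp [fixForm]

theorem map_cubicForm (φ : A →+* B) (ω : Fin 3 → Fin 2 → A) (i : Fin 4) :
    φ (cubicForm ω i) = cubicForm (fun j k => φ (ω j k)) i := by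
  fin_cases i <;> simp [cubicForm]

theorem map_prodForm (φ : A →+* B) (a b : Fin 2 → A) (i : Fin 3) :
    φ (prodForm a b i) = prodForm (fun k => φ (a k)) (fun k => φ (b k)) i := by
  fin_cases i <;> simp [prodForm]

end Forms

/-! ### Standard maps are totally marked -/

section Main

variable {R : Type u} [CommRing R] {S : Sch R} {W : S.left.Opens}

theorem exists_affine_le {X : Scheme.{u}} {U : X.Opens} {x : X} (hx : x ∈ U) :
    ∃ W : X.Opens, IsAffineOpen W ∧ x ∈ W ∧ W ≤ U := by
  obtain ⟨_, ⟨W, hW, rfl⟩, hxW, hWU⟩ :=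
    X.isBasis_affineOpens.exists_subset_of_mem_open (show x ∈ (U : Set X) from hx) U.isOpen
  exact ⟨W, hW, hxW, hWU⟩

/-- The five marked points of a marked map. -/
def MarkedMap.pts (x : MarkedMap S) : Fin 5 → (S.left ⟶ P1 R) :=
  ![x.r 0 ≫ line.toP1 S, x.r 1 ≫ line.toP1 S, x.r 2 ≫ line.toP1 S, x.s 0 ≫ line.toP1 S,
    x.s 1 ≫ line.toP1 S]

theorem MarkedMap.pts_castAdd (x : MarkedMap S) (i : Fin 3) :
    x.pts (Fin.castAdd 2 i) = x.r i ≫ line.toP1 S := by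
  fin_cases i <;> rfl

theorem MarkedMap.pts_natAdd (x : MarkedMap S) (j : Fin 2) :
    x.pts (Fin.natAdd 3 j) = x.s j ≫ line.toP1 S := by
  fin_cases j <;> rfl

/-- The underlying map of `x` is the standard map given by its marked points. -/
def MarkedMap.IsStandard (x : MarkedMap S) : Prop :=
  Good x.pts ∧ IsStd (fun i => line.proj S ≫ x.pts i) (line.toP1 S) (x.φ ≫ line.toP1 S)

theorem line.hasPtsCoords_proj {p : Fin 5 → (S.left ⟶ P1 R)} {c : Fin 5 → Fin 2 → Γ(S.left, W)}
    (hc : HasPtsCoords p W c) (k : Fin 2) : HasPtsCoords (fun i => line.proj S ≫ p i) (line.chart S W k)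
      (fun i j => line.scalar S W k (c i j)) :=
  hc.comp (line.proj S) inf_le_left

theorem line.stdVal_eq_quadPair (c : Fin 5 → Fin 2 → Γ(S.left, W)) (k : Fin 2) :
    stdVal (fun i j => line.scalar S W k (c i j)) (line.coord S W k) =
      line.quadPair S W k (stdCoeff c 0) (stdCoeff c 1) := by
  funext e
  have : ∀ e, quad (stdCoeff (fun i j => line.scalar S W k (c i j)) e) (line.coord S W k) =
      quad (fun i => line.scalar S W k (stdCoeff c e i)) (line.coord S W k) := fun e =>
    congrArg (fun v => quad v (line.coord S W k))
      (funext fun i => (map_stdCoeff (line.scalar S W k) c e i).symm)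
  match e with
  | 0 => exact this 0
  | 1 => exact this 1

theorem MarkedMap.IsStandard.hasCoords {x : MarkedMap S} (h : x.IsStandard)
    {c : Fin 5 → Fin 2 → Γ(S.left, W)} (hc : HasPtsCoords x.pts W c) (k : Fin 2) :
    HasCoords (x.φ ≫ line.toP1 S) (line.chart S W k)
      (line.quadPair S W k (stdCoeff c 0) (stdCoeff c 1)) := by
  rw [← line.stdVal_eq_quadPair]
  exact h.2.hasCoords (line.hasPtsCoords_proj hc k) (line.hasCoords S W k) ((h.1.nondeg hc).map _)

theorem line.br_quadPair (f g : Fin 3 → Γ(S.left, W)) (k : Fin 2) :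
    br (line.coord S W k) (line.quadPair S W k f g) =
      homForm 3 (fun i => line.scalar S W k (extendZero (fixForm f g) i)) (line.coord S W k) := by
  rw [map_extendZero, homForm_three]
  simp only [map_fixForm]
  exact br_quad _ _ _

theorem line.linForm_mul_mul (ω : Fin 3 → Fin 2 → Γ(S.left, W)) (k : Fin 2) :
    line.linForm S W k (ω 0) * line.linForm S W k (ω 1) * line.linForm S W k (ω 2) =
      homForm 3 (fun i => line.scalar S W k (extendZero (cubicForm ω) i)) (line.coord S W k) := by
  rw [map_extendZero, homForm_three]
  simp only [map_cubicForm]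
  exact cubicForm_eval (fun j l => line.scalar S W k (ω j l)) (line.coord S W k)

theorem line.linForm_mul (a b : Fin 2 → Γ(S.left, W)) (k : Fin 2) :
    line.linForm S W k a * line.linForm S W k b =
      homForm 2 (fun i => line.scalar S W k (extendZero (prodForm a b) i)) (line.coord S W k) := by
  rw [map_extendZero, homForm_two]
  simp only [map_prodForm]
  exact (quad_prodForm _ _ _).symm

theorem line.ideal_ext {I J : (line S).IdealSheafData}
    (H : ∀ p : S.left, ∃ (W : S.left.Opens) (hW : IsAffineOpen W), p ∈ W ∧ ∀ k,
      I.ideal ⟨line.chart S W k, line.isAffineOpen_chart S k hW⟩ =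
        J.ideal ⟨line.chart S W k, line.isAffineOpen_chart S k hW⟩) : I = J := by
  choose W hW hp H using H
  refine Scheme.IdealSheafData.ext_of_iSup_eq_top
    (fun i : S.left × Fin 2 => ⟨line.chart S (W i.1) i.2, line.isAffineOpen_chart S i.2 (hW i.1)⟩)
    (top_le_iff.mp fun x _ => ?_) (fun i => H i.1 i.2)
  obtain ⟨k, hk⟩ := line.exists_mem_chart S (W (line.proj S x)) x (hp _)
  exact TopologicalSpace.Opens.mem_iSup.mpr ⟨(line.proj S x, k), hk⟩

theorem MarkedMap.IsStandard.degree_two {x : MarkedMap S} (h : x.IsStandard) (p : S.left) :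
    ∃ W : S.left.Opens, p ∈ W ∧
      ((line.twist S 1).pullback x.φ).IsoOver (line.twist S 2) (line.proj S ⁻¹ᵁ W) := by
  obtain ⟨U, c, hp, hc⟩ := exists_hasPtsCoords x.pts p
  exact ⟨U, hp, line.isoOver_of_quadPair fun k => h.hasCoords hc k⟩

theorem line.quad_jac_stdCoeff (c : Fin 5 → Fin 2 → Γ(S.left, W)) (k : Fin 2) :
    quad (fun i => line.scalar S W k (jac (stdCoeff c 0) (stdCoeff c 1) i)) (line.coord S W k) =
      line.scalar S W k (2 * br (stdV (fun j => c (Fin.castAdd 2 j)) (c 3) (c 4))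
        (stdW (fun j => c (Fin.castAdd 2 j)) (c 3) (c 4)) * br (c 3) (c 4)) *
      (line.linForm S W k (c 3) * line.linForm S W k (c 4)) := by
  have hj : ∀ i, jac (stdCoeff c 0) (stdCoeff c 1) i = _ := jac_stdForm _ _ _
  rw [line.linForm, line.linForm, ← quad_prodForm]
  simp only [quad, hj, map_mul, ← map_prodForm]
  ring

variable [IsLocalization.Away (2 : ℤ) R]

theorem isUnit_two (S : Sch R) (W : S.left.Opens) : IsUnit (2 : Γ(S.left, W)) := by
  have h1 : IsUnit (2 : R) := by
    have := IsLocalization.Away.algebraMap_isUnit (S := R) (2 : ℤ)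
    rwa [map_ofNat] at this
  have := h1.map ((ev S.hom (U := ⊤) (V := W) le_top).comp (Scheme.ΓSpecIso (.of R)).inv.hom)
  rwa [map_ofNat] at this

theorem MarkedMap.prod_ker_r (x : MarkedMap S) (hW : IsAffineOpen W) {c : Fin 5 → Fin 2 → Γ(S.left, W)}
    (hc : HasPtsCoords x.pts W c) (k : Fin 2) :
    (∏ i, (x.r i).ker).ideal ⟨line.chart S W k, line.isAffineOpen_chart S k hW⟩ =
      Ideal.span {line.linForm S W k (c 0) * line.linForm S W k (c 1) * line.linForm S W k (c 2)} := by
  rw [Fin.prod_univ_three, Scheme.IdealSheafData.ideal_mul, Pi.mul_apply,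
    Scheme.IdealSheafData.ideal_mul, Pi.mul_apply, line.ker_section k hW (x.r_proj 0) (hc 0),
    line.ker_section k hW (x.r_proj 1) (hc 1), line.ker_section k hW (x.r_proj 2) (hc 2),
    Ideal.span_singleton_mul_span_singleton, Ideal.span_singleton_mul_span_singleton]

theorem MarkedMap.prod_ker_s (x : MarkedMap S) (hW : IsAffineOpen W) {c : Fin 5 → Fin 2 → Γ(S.left, W)}
    (hc : HasPtsCoords x.pts W c) (k : Fin 2) :
    (∏ j, (x.s j).ker).ideal ⟨line.chart S W k, line.isAffineOpen_chart S k hW⟩ =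
      Ideal.span {line.linForm S W k (c 3) * line.linForm S W k (c 4)} := by
  rw [Fin.prod_univ_two, Scheme.IdealSheafData.ideal_mul, Pi.mul_apply,
    line.ker_section k hW (x.s_proj 0) (hc 3), line.ker_section k hW (x.s_proj 1) (hc 4),
    Ideal.span_singleton_mul_span_singleton]

/-- The bracket of a point y with its image is [a, b]³ ∏ [y, ω_j], which contains the zero factor
[ω_i, ω_i] when y = ω_i. -/
theorem MarkedMap.IsStandard.fixed {x : MarkedMap S} (h : x.IsStandard) (i : Fin 3) :
    x.r i ≫ x.φ = x.r i := by
  refine line.hom_ext (by rw [Category.assoc, x.φ_proj]) ?_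
  rw [Category.assoc]
  refine hom_ext_of_locally fun p => ?_
  obtain ⟨U, c, hp, hc⟩ := exists_hasPtsCoords x.pts p
  refine ⟨U, hp, ?_⟩
  have hn := h.1.nondeg hc
  have hi := hc (Fin.castAdd 2 i)
  rw [x.pts_castAdd] at hi
  have h1 := h.2.comp (x.r i)
  have h2 : (fun j => x.r i ≫ line.proj S ≫ x.pts j) = x.pts := by
    funext j
    rw [← Category.assoc, x.r_proj, Category.id_comp]
  rw [h2] at h1
  have h3 := h1.hasCoords hc hi hn
  refine h3.ι_comp_eq' hi ?_
  have h4 : br (stdVal c (c (Fin.castAdd 2 i))) (c (Fin.castAdd 2 i)) =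
      -br (c (Fin.castAdd 2 i)) (stdVal c (c (Fin.castAdd 2 i))) := by simp only [br]; ring
  have h5 : ∀ a : Fin 2 → Γ(S.left, U), br a a = 0 := fun a => by simp only [br]; ring
  rw [h4, br_stdVal]
  match i with
  | 0 => rw [show c (Fin.castAdd 2 0) = c 0 from rfl, h5]; ring
  | 1 => rw [show c (Fin.castAdd 2 1) = c 1 from rfl, h5]; ring
  | 2 => rw [show c (Fin.castAdd 2 2) = c 2 from rfl, h5]; ring

theorem MarkedMap.IsStandard.fixed_divisor {x : MarkedMap S} (h : x.IsStandard) :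
    ∏ i, (x.r i).ker = (equalizer.ι x.φ (𝟙 (line S))).ker := by
  refine line.ideal_ext fun p => ?_
  obtain ⟨U, c, hp, hc⟩ := exists_hasPtsCoords x.pts p
  obtain ⟨W, hW, hpW, hWU⟩ := exists_affine_le hp
  replace hc := hc.restrict hWU
  refine ⟨W, hW, hpW, fun k => ?_⟩
  rw [x.prod_ker_r hW hc, line.ker_equalizer k hW x.φ_proj (h.hasCoords hc k),
    ← line.stdVal_eq_quadPair, br_stdVal]
  refine (Ideal.span_singleton_mul_left_unit ?_ _).symm
  exact ((h.1.nondeg hc).map (line.scalar S W k)).br.pow 3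

theorem MarkedMap.IsStandard.ramification {x : MarkedMap S} (h : x.IsStandard) :
    IsRamificationIdeal x.φ (∏ j, (x.s j).ker) := by
  refine line.isRamificationIdeal_iff x.φ_proj fun p => ?_
  obtain ⟨U, c, hp, hc⟩ := exists_hasPtsCoords x.pts p
  obtain ⟨W, hW, hpW, hWU⟩ := exists_affine_le hp
  replace hc := hc.restrict hWU
  refine ⟨W, _, _, hW, hpW, fun k => ⟨h.hasCoords hc k, ?_⟩⟩
  rw [x.prod_ker_s hW hc]
  have hn := h.1.nondeg hc
  -- The Jacobian of the standard pair is 2 [V, W] [a, b] times the product of the two linear forms;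
  -- invertibility of 2 is essential here.
  have hu := (((isUnit_two S W).mul hn.isUnit_br).mul hn.br).map (line.scalar S W k)
  refine (Ideal.span_singleton_mul_left_unit hu _).symm.trans ?_
  rw [line.quad_jac_stdCoeff]

end Main

/-! ### Totally marked maps are standard -/

section Converse

variable {R : Type u} [CommRing R] {S : Sch R} {W : S.left.Opens}

theorem isCoprime_of_locally {X : Scheme.{u}} {U : X.Opens} (hU : IsAffineOpen U) {a b : Γ(X, U)}
    (h : ∀ x ∈ U, ∃ (V : X.Opens) (hV : V ≤ U), x ∈ V ∧ IsCoprime (res hV a) (res hV b)) :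
    IsCoprime a b := by
  rw [← Ideal.isCoprime_span_singleton_iff, Ideal.isCoprime_iff_sup_eq, ← Ideal.span_union,
    ← hU.iSup_basicOpen_eq_self_iff]
  refine le_antisymm (iSup_le fun f => X.basicOpen_le _) fun x hx => ?_
  obtain ⟨V, hV, hxV, hc⟩ := h x hx
  obtain ⟨j, hj⟩ := exists_mem_basicOpen (a := ![res hV a, res hV b]) hc hxV
  have key : ∀ s : Γ(X, U), x ∈ X.basicOpen (res hV s) → x ∈ X.basicOpen s := fun s hs => by
    have : X.basicOpen (res hV s) = V ⊓ X.basicOpen s := Scheme.basicOpen_res _ _ _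
    rw [this] at hs
    exact hs.2
  rw [TopologicalSpace.Opens.mem_iSup]
  match j with
  | 0 => exact ⟨⟨a, Or.inl rfl⟩, key a hj⟩
  | 1 => exact ⟨⟨b, Or.inr rfl⟩, key b hj⟩

theorem line.ev_section {r : S.left ⟶ line S} (hr : r ≫ line.proj S = 𝟙 _) {k : Fin 2} {V : S.left.Opens}
    (hV : V ≤ r ⁻¹ᵁ line.chart S W k) (hVW : V ≤ W) (a : Γ(S.left, W)) :
    ev r hV (line.scalar S W k a) = res hVW a := by
  exact (ev_ev _ _ _ _ _).trans ((ev_congr hr _ _).trans (ev_id _ _))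

theorem line.isCoprime_quad_section (hW : IsAffineOpen W) {f g : Fin 3 → Γ(S.left, W)}
    (hfg : ∀ k, IsCoprime (line.quadPair S W k f g 0) (line.quadPair S W k f g 1))
    {r : S.left ⟶ line S} (hr : r ≫ line.proj S = 𝟙 _) {a : Fin 2 → Γ(S.left, W)}
    (ha : HasCoords (r ≫ line.toP1 S) W a) : IsCoprime (quad f a) (quad g a) := by
  refine isCoprime_of_locally hW fun x hx => ?_
  have hx' : line.proj S (r x) ∈ W := by
    rwa [← Scheme.Hom.comp_apply, hr]
  obtain ⟨k, hk⟩ := line.exists_mem_chart S W (r x) hx'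
  refine ⟨W ⊓ r ⁻¹ᵁ line.chart S W k, inf_le_left, ⟨hx, hk⟩, ?_⟩
  obtain ⟨l, hl⟩ := ((line.hasCoords S W k).comp r (inf_le_right : W ⊓ r ⁻¹ᵁ line.chart S W k ≤ _)).exists_unit
    (ha.restrict inf_le_left)
  have key : ∀ f : Fin 3 → Γ(S.left, W), res (inf_le_left : W ⊓ r ⁻¹ᵁ line.chart S W k ≤ W) (quad f a) =
      l.1 ^ 2 * ev r inf_le_right (quad (fun i => line.scalar S W k (f i)) (line.coord S W k)) := by
    intro f
    have hl' : (fun j => res (inf_le_left : W ⊓ r ⁻¹ᵁ line.chart S W k ≤ W) (a j)) = _ := funext hl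
    have h2 : (fun i => ev r (inf_le_right : W ⊓ r ⁻¹ᵁ line.chart S W k ≤ _) (line.scalar S W k (f i))) =
        fun i => res inf_le_left (f i) := funext fun i => line.ev_section hr _ _ _
    rw [map_quad, map_quad, hl', h2]
    simp only [quad]
    ring
  rw [key, key]
  have := ((hfg k).map (ev r (inf_le_right : W ⊓ r ⁻¹ᵁ line.chart S W k ≤ _)))
  have hu : IsUnit (l.1 ^ 2) := l.isUnit.pow 2
  exact (isCoprime_mul_unit_left hu _ _).mpr this

variable [IsLocalization.Away (2 : ℤ) R]

/-- On a small affine base φ is a pair (f, g) of quadratic forms, and the two divisor conditions fix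
its cubic form and its Jacobian up to units. `exists_unit_stdForm` then makes (f, g) proportional to
the standard pair and the five points nondegenerate. -/
theorem MarkedMap.IsTotallyMarked.exists_coords {x : MarkedMap S} (h : x.IsTotallyMarked) (p : S.left) :
    ∃ (W : S.left.Opens) (c : Fin 5 → Fin 2 → Γ(S.left, W)), p ∈ W ∧ HasPtsCoords x.pts W c ∧
      Nondeg c ∧ ∀ k, HasCoords (x.φ ≫ line.toP1 S) (line.chart S W k)
        (stdVal (fun i j => line.scalar S W k (c i j)) (line.coord S W k)) := by
  obtain ⟨W₀, hp₀, hdeg⟩ := h.degree_two p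
  obtain ⟨U, c, hpU, hc⟩ := exists_hasPtsCoords x.pts p
  obtain ⟨W, hW, hpW, hle⟩ := exists_affine_le (show p ∈ W₀ ⊓ U from ⟨hp₀, hpU⟩)
  replace hc := hc.restrict (hle.trans inf_le_right)
  revert hc
  generalize (fun i j => res (hle.trans inf_le_right) (c i j)) = d
  intro hc
  obtain ⟨f, g, hfg⟩ := line.exists_quadPair_of_isoOver hW (hle.trans inf_le_left) hdeg
  -- Both cubic forms generate the ideal of the fixed divisor on each chart, so they differ by a
  -- unit of the base; coefficients are then compared.
  have hfix : ∃ v, IsUnit v ∧ ∀ i, fixForm f g i = v * cubicForm (fun j => d (Fin.castAdd 2 j)) i := by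
    obtain ⟨v, hv, e⟩ := line.exists_unit_of_span_eq hW
      (p := fun k => br (line.coord S W k) (line.quadPair S W k f g))
      (q := fun k => line.linForm S W k (d 0) * line.linForm S W k (d 1) * line.linForm S W k (d 2)) (d := 3)
      ((congrArg _ (line.br_quadPair f g 1)).trans ((line.homForm_transform _ _).trans
          (congrArg (fun t => _ * res (line.overlap_le 0) t) (line.br_quadPair f g 0).symm)))
      (by
        have := line.linForm_mul_mul (fun j => d (Fin.castAdd 2 j))
        exact (congrArg _ (this 1)).trans ((line.homForm_transform _ _).trans
          (congrArg (fun t => _ * res (line.overlap_le 0) t) (this 0).symm)))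
      (fun k => mul_mem (mul_mem (line.linForm_mem_nonZeroDivisors hW k (hc 0).coprime)
        (line.linForm_mem_nonZeroDivisors hW k (hc 1).coprime))
        (line.linForm_mem_nonZeroDivisors hW k (hc 2).coprime))
      (fun k => by
        rw [← x.prod_ker_r hW hc, h.fixed_divisor, line.ker_equalizer k hW x.φ_proj (hfg k)])
    refine ⟨v, hv, fun i => ?_⟩
    have e0 := e 0
    have := line.homForm_injective hW (d := 3) (c := extendZero (fixForm f g))
      (c' := fun i => v * extendZero (cubicForm (fun j => d (Fin.castAdd 2 j))) i) ?_ (i := i.1) (by omega)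
    · simpa [extendZero] using this
    · rw [← line.br_quadPair, e 0]
      refine (congrArg _ (line.linForm_mul_mul (fun j => d (Fin.castAdd 2 j)) 0)).trans ?_
      simp only [homForm, map_mul, Finset.mul_sum, mul_assoc]
  -- The same argument in degree two, for the ramification ideal.
  have hjac : ∃ u, IsUnit u ∧ ∀ i, jac f g i = u * prodForm (d 3) (d 4) i := by
    obtain ⟨v, hv, e⟩ := line.exists_unit_of_span_eq hW
      (p := fun k => quad (fun i => line.scalar S W k (jac f g i)) (line.coord S W k))
      (q := fun k => line.linForm S W k (d 3) * line.linForm S W k (d 4)) (d := 2)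
      (by
        simp only [← homForm_two, ← map_extendZero]
        exact line.homForm_transform _ _)
      ((congrArg _ (line.linForm_mul (d 3) (d 4) 1)).trans ((line.homForm_transform _ _).trans
          (congrArg (fun t => _ * res (line.overlap_le 0) t) (line.linForm_mul (d 3) (d 4) 0).symm)))
      (fun k => mul_mem (line.linForm_mem_nonZeroDivisors hW k (hc 3).coprime)
        (line.linForm_mem_nonZeroDivisors hW k (hc 4).coprime))
      (fun k => by
        rw [← x.prod_ker_s hW hc]
        exact (line.ideal_eq_of_isRamificationIdeal x.φ_proj h.ramification hW k (hfg k)).symm)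
    refine ⟨v, hv, fun i => ?_⟩
    have := line.homForm_injective hW (d := 2) (c := extendZero (jac f g))
      (c' := fun i => v * extendZero (prodForm (d 3) (d 4)) i) ?_ (i := i.1) (by omega)
    · simpa [extendZero] using this
    · rw [map_extendZero, homForm_two]
      refine (e 0).trans ?_
      refine (congrArg _ (line.linForm_mul (d 3) (d 4) 0)).trans ?_
      simp only [homForm, map_mul, Finset.mul_sum, mul_assoc]
  obtain ⟨v, hv, hfix⟩ := hfix
  obtain ⟨u, hu, hjac⟩ := hjac
  obtain ⟨-, hD, l, hl, hlf⟩ := exists_unit_stdForm _ _ _ (isUnit_two S W) hu hv (hc 4).coprime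
    (line.isCoprime_quad_section hW (fun k => (hfg k).coprime) (x.s_proj 0) (hc 3)) hjac hfix
  have hn : Nondeg d := nondeg_of_isUnit hD
  refine ⟨W, d, hpW, hc, hn, fun k => ?_⟩
  refine (hfg k).of_br_eq_zero ?_ ?_
  · exact (hn.map (line.scalar S W k)).isCoprime (line.hasCoords S W k).coprime
  · have h0 : stdCoeff d 0 = fun i => l * f i := funext fun i => (hlf i).1
    have h1 : stdCoeff d 1 = fun i => l * g i := funext fun i => (hlf i).2
    rw [line.stdVal_eq_quadPair, h0, h1]
    simp only [br, line.quadPair, quad, map_mul, Matrix.cons_val_zero, Matrix.cons_val_one]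
    ring

theorem MarkedMap.IsTotallyMarked.isStandard {x : MarkedMap S} (h : x.IsTotallyMarked) : x.IsStandard := by
  refine ⟨fun p => ?_, fun y => ?_⟩
  · obtain ⟨W, c, hp, hc, hn, -⟩ := h.exists_coords p
    exact ⟨W, c, hp, hc, hn⟩
  · obtain ⟨W, c, hp, hc, -, hφ⟩ := h.exists_coords (line.proj S y)
    obtain ⟨k, hk⟩ := line.exists_mem_chart S W y hp
    exact ⟨line.chart S W k, _, _, hk, line.hasPtsCoords_proj hc k, line.hasCoords S W k, hφ k⟩

end Converse

/-! ### Separability -/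

section FieldTheory

open Polynomial

variable {A M : Type*} [Field A] [Field M] [Algebra A M] {t : M} {P Q : A[X]}

/-- The minimal polynomial divides p; if its derivative were zero, p' would vanish at t as well. -/
theorem isSeparable_of_aeval_derivative_ne_zero {p : A[X]} (h : aeval t p = 0)
    (h' : aeval t (derivative p) ≠ 0) : IsSeparable A t := by
  have hp : p ≠ 0 := fun hp => h' (by rw [hp]; simp)
  have hi : IsIntegral A t := IsAlgebraic.isIntegral ⟨p, hp, h⟩
  rw [IsSeparable, separable_iff_derivative_ne_zero (minpoly.irreducible hi)]
  intro h0
  obtain ⟨q, rfl⟩ := minpoly.dvd A t h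
  refine h' ?_
  rw [derivative_mul, h0, zero_mul, zero_add, map_mul, minpoly.aeval, zero_mul]

/-- t is a root of w P − Q. If it were also a root of w P' − Q', the Wronskian would vanish at the
transcendental element t. -/
theorem isSeparable_of_wronskian {N : Type*} [Field N] [Algebra A N] [Algebra N M] [IsScalarTower A N M]
    {w : N} (ht : Transcendental A t) (hw : algebraMap N M w * aeval t P = aeval t Q)
    (hW : P * derivative Q - derivative P * Q ≠ 0) : IsSeparable N t := by
  refine isSeparable_of_aeval_derivative_ne_zero
    (p := C w * P.map (algebraMap A N) - Q.map (algebraMap A N)) ?_ ?_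
  · simp [hw]
  · intro h
    have h1 : algebraMap N M w * aeval t (derivative P) = aeval t (derivative Q) := by
      simpa [derivative_map, sub_eq_zero] using h
    refine hW ((transcendental_iff.mp ht) _ ?_)
    rw [map_sub, map_mul, map_mul, ← hw, ← h1]
    ring

/-- t is separable, in particular algebraic, over A(τ); if τ were algebraic over A, so would be t.
-/
theorem transcendental_of_wronskian {τ : M} (ht : Transcendental A t)
    (hτ : τ * aeval t P = aeval t Q) (hW : P * derivative Q - derivative P * Q ≠ 0) :
    Transcendental A τ := by
  intro h
  have hs : IsSeparable (IntermediateField.adjoin A {τ}) t :=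
    isSeparable_of_wronskian (w := IntermediateField.AdjoinSimple.gen A τ) ht (by simpa using hτ) hW
  have : Algebra.IsAlgebraic A (IntermediateField.adjoin A {τ}) :=
    IntermediateField.isAlgebraic_adjoin_simple h.isIntegral
  exact ht (hs.isIntegral.isAlgebraic.restrictScalars A)

theorem algebra_isSeparable_of_wronskian {N : Type*} [Field N] [Algebra A N] [Algebra N M]
    [IsScalarTower A N M] {w : N} (ht : Transcendental A t)
    (hw : algebraMap N M w * aeval t P = aeval t Q) (hW : P * derivative Q - derivative P * Q ≠ 0)
    (hM : ∀ z : M, ∃ a b : A[X], aeval t b ≠ 0 ∧ z * aeval t b = aeval t a) :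
    Algebra.IsSeparable N M := by
  have hs := isSeparable_of_wronskian ht hw hW
  have key : ∀ a : A[X], aeval t a ∈ separableClosure N M := fun a => by
    have h1 : aeval t a = aeval t (a.map (algebraMap A N)) := by simp
    rw [h1]
    have h2 := aeval_algHom_apply (separableClosure N M).val (⟨t, mem_separableClosure_iff.mpr hs⟩ :
      separableClosure N M) (a.map (algebraMap A N))
    exact h2 ▸ Subtype.mem _
  refine ⟨fun z => mem_separableClosure_iff.mp ?_⟩
  obtain ⟨a, b, hb, e⟩ := hM z
  rw [eq_div_of_mul_eq hb e]
  exact div_mem (key a) (key b)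

theorem transcendental_iff_injective_eval₂ {A M : Type*} [Field A] [Field M] (α : A →+* M) (t : M) :
    (letI := α.toAlgebra; Transcendental A t) ↔ Function.Injective (eval₂RingHom α t) :=
  letI := α.toAlgebra
  transcendental_iff_injective

/-- Stalks and rings of sections come with a commutative ring structure only, so fields enter
through `IsField` and transcendence as injectivity of evaluation. -/
theorem injective_eval₂_of_wronskian {A M : Type*} [CommRing A] [CommRing M] (hA : IsField A)
    (hM : IsField M) {α : A →+* M} {t τ : M} {P Q : A[X]}
    (ht : Function.Injective (eval₂RingHom α t))
    (hτ : τ * eval₂RingHom α t P = eval₂RingHom α t Q)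
    (hW : P * derivative Q - derivative P * Q ≠ 0) : Function.Injective (eval₂RingHom α τ) := by
  let _ := hA.toField
  let _ := hM.toField
  let _ := α.toAlgebra
  exact (transcendental_iff_injective_eval₂ α τ).mp
    (transcendental_of_wronskian ((transcendental_iff_injective_eval₂ α t).mpr ht) hτ hW)

theorem isSeparable_toAlgebra_of_wronskian {A N M : Type*} [CommRing A] [CommRing N] [CommRing M]
    (hA : IsField A) (hN : IsField N) (hM : IsField M) {α : A →+* N} {ψ : N →+* M} {w : N} {t : M}
    {P Q : A[X]} (ht : Function.Injective (eval₂RingHom (ψ.comp α) t))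
    (hw : ψ w * eval₂RingHom (ψ.comp α) t P = eval₂RingHom (ψ.comp α) t Q)
    (hW : P * derivative Q - derivative P * Q ≠ 0)
    (hz : ∀ z : M, ∃ a b : A[X], eval₂RingHom (ψ.comp α) t b ≠ 0 ∧
      z * eval₂RingHom (ψ.comp α) t b = eval₂RingHom (ψ.comp α) t a) :
    letI := ψ.toAlgebra
    Algebra.IsSeparable N M := by
  let _ := hA.toField
  let _ := hN.toField
  let _ := hM.toField
  let _ := α.toAlgebra
  let _ := ψ.toAlgebra
  let _ := (ψ.comp α).toAlgebra
  have : IsScalarTower A N M := .of_algebraMap_eq' rfl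
  exact algebra_isSeparable_of_wronskian (w := w)
    ((transcendental_iff_injective_eval₂ (ψ.comp α) t).mpr ht) hw hW hz

end FieldTheory

/-! ### Generic points and their local rings -/

section GenericPoint

variable {X : Scheme.{u}} {x : X}

/-- The germ at `x` of a function on a neighbourhood. -/
def germ {U : X.Opens} (hx : x ∈ U) : Γ(X, U) →+* X.presheaf.stalk x := (X.presheaf.germ U x hx).hom

theorem mem_basicOpen_iff_germ {U : X.Opens} (hx : x ∈ U) (s : Γ(X, U)) :
    x ∈ X.basicOpen s ↔ IsUnit (germ hx s) := Scheme.mem_basicOpen _ _ _ hx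

theorem germ_res {U V : X.Opens} (h : V ≤ U) (hx : x ∈ V) (s : Γ(X, U)) :
    germ hx (res h s) = germ (h hx) s :=
  X.presheaf.germ_res_apply (homOfLE h) x hx s

theorem stalkMap_germ {Y : Scheme.{u}} (φ : X ⟶ Y) {V : Y.Opens} (hx : φ x ∈ V) {U : X.Opens}
    (h : U ≤ φ ⁻¹ᵁ V) (hU : x ∈ U)
    (s : Γ(Y, V)) : (φ.stalkMap x).hom (germ hx s) = germ hU (ev φ h s) := by
  refine (Scheme.Hom.germ_stalkMap_apply φ V x hx s).trans (Eq.trans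
    (germ_res h hU ((φ.app V).hom s)).symm ?_)
  rfl

theorem exists_germ {U : X.Opens} (hU : IsAffineOpen U) (hx : x ∈ U) (z : X.presheaf.stalk x) :
    ∃ a b : Γ(X, U), IsUnit (germ hx b) ∧ z * germ hx b = germ hx a := by
  let _ : Algebra Γ(X, U) (X.presheaf.stalk x) := (germ hx).toAlgebra
  have : IsLocalization.AtPrime (X.presheaf.stalk x) (hU.primeIdealOf ⟨x, hx⟩).asIdeal :=
    hU.isLocalization_stalk ⟨x, hx⟩
  obtain ⟨⟨a, b⟩, h⟩ := IsLocalization.surj (hU.primeIdealOf ⟨x, hx⟩).asIdeal.primeCompl z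
  exact ⟨a, b.1, IsLocalization.map_units (M := (hU.primeIdealOf ⟨x, hx⟩).asIdeal.primeCompl) _ b, h⟩

theorem isUnit_germ {U : X.Opens} (hU : IsAffineOpen U) [IsDomain Γ(X, U)]
    (hg : IsGenericPoint x Set.univ) (hx : x ∈ U) {s : Γ(X, U)} (hs : s ≠ 0) : IsUnit (germ hx s) := by
  rw [← mem_basicOpen_iff_germ]
  have h1 : X.basicOpen s ≠ ⊥ := fun h =>
    hs (IsNilpotent.eq_zero ((Scheme.isNilpotent_iff_basicOpen_eq_bot_of_isCompact hU.isCompact s).mpr h))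
  obtain ⟨y, hy⟩ := (TopologicalSpace.Opens.ne_bot_iff_nonempty _).mp h1
  exact (hg.specializes (Set.mem_univ y)).mem_open (X.basicOpen s).isOpen hy

theorem isField_stalk {U : X.Opens} (hU : IsAffineOpen U) [IsDomain Γ(X, U)]
    (hg : IsGenericPoint x Set.univ) (hx : x ∈ U) : IsField (X.presheaf.stalk x) := by
  refine ⟨exists_pair_ne _, mul_comm, fun {z} hz => ?_⟩
  obtain ⟨a, b, hb, e⟩ := exists_germ hU hx z
  have ha : a ≠ 0 := fun h => hz (hb.mul_left_eq_zero.mp (by rw [e, h, map_zero]))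
  exact (isUnit_of_mul_isUnit_left (e ▸ isUnit_germ hU hg hx ha)).exists_right_inv

/-- Under the hypothesis y lies in every nonempty basic open set of `U`, hence in every
neighbourhood of x; its closure then contains the closure of x. -/
theorem isGenericPoint_of_isUnit {x y : X} (hg : IsGenericPoint x Set.univ) {U : X.Opens} (hU : IsAffineOpen U)
    (hx : x ∈ U) (hy : y ∈ U) (h : ∀ s : Γ(X, U), s ≠ 0 → IsUnit (germ hy s)) :
    IsGenericPoint y Set.univ := by
  have hs : y ⤳ x := by
    rw [specializes_iff_forall_open]
    intro O hO hxO
    obtain ⟨s, hs, hxs⟩ := hU.exists_basicOpen_le ⟨x, (show x ∈ (⟨O, hO⟩ : X.Opens) from hxO)⟩ hx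
    refine hs ?_
    rw [mem_basicOpen_iff_germ hy]
    refine h s fun h0 => ?_
    rw [h0] at hxs
    simp at hxs
  rw [isGenericPoint_def] at hg ⊢
  exact Set.univ_subset_iff.mp (hg ▸ hs.closure_subset)

end GenericPoint

/-! ### Dominance and separability over a field -/

section Line

open Polynomial

variable {R : Type u} [CommRing R] [IsLocalization.Away (2 : ℤ) R] {S : Sch R}

theorem line.isDomain_chart {W : S.left.Opens} (hW : IsAffineOpen W) [IsDomain Γ(S.left, W)] (k : Fin 2) :
    IsDomain Γ(line S, line.chart S W k) :=
  (RingEquiv.ofBijective _ (line.scalar_bijective S k hW)).symm.toMulEquiv.isDomain _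

/-- The stalk at the generic point is K(t), and φ pulls the coordinate of chart j back to τ =
F_{1-j} / F_j. The nonzero Jacobian is the Wronskian of this fraction; it makes τ transcendental,
hence φ dominant, and t separable over the function field of the target. -/
theorem line.isSeparableMorphism {φ : line S ⟶ line S} (hφ : φ ≫ line.proj S = line.proj S)
    (hK : IsField Γ(S.left, ⊤)) (hW : IsAffineOpen (⊤ : S.left.Opens)) {f g : Fin 3 → Γ(S.left, ⊤)}
    (h : ∀ k, HasCoords (φ ≫ line.toP1 S) (line.chart S ⊤ k) (line.quadPair S ⊤ k f g))
    (hjac : ∀ k, quad (fun i => line.scalar S ⊤ k (jac f g i)) (line.coord S ⊤ k) ≠ 0) :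
    IsSeparableMorphism φ := by
  intro x hx
  have : IsDomain Γ(S.left, ⊤) := hK.isDomain
  have hdom := line.isDomain_chart hW
  obtain ⟨k, hk⟩ := line.exists_mem_chart S ⊤ x trivial
  obtain ⟨j, hj⟩ := line.exists_mem_chart S ⊤ (φ x) trivial
  have hUk := line.isAffineOpen_chart S k hW
  have hUj := line.isAffineOpen_chart S j hW
  have hM := isField_stalk hUk hx hk
  set ψ := (φ.stalkMap x).hom with hψ
  set α := (germ hk).comp (line.scalar S ⊤ k) with hα
  set t := germ hk (line.coord S ⊤ k (1 - k)) with ht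
  set w := germ hj (line.coord S ⊤ j (1 - j)) with hw
  have hev : ∀ p : Γ(S.left, ⊤)[X], eval₂RingHom α t p =
      germ hk (eval₂RingHom (line.scalar S ⊤ k) (line.coord S ⊤ k (1 - k)) p) := fun p =>
    (hom_eval₂ p _ _ _).symm
  have hinj : Function.Injective (germ hk) := (injective_iff_map_eq_zero _).mpr fun s hs => by
    by_contra h0
    have := isUnit_germ hUk hx hk h0
    rw [hs] at this
    exact not_isUnit_zero this
  have htinj : Function.Injective (eval₂RingHom α t) := by
    have : (eval₂RingHom α t : _ → _) = germ hk ∘ eval₂RingHom (line.scalar S ⊤ k) (line.coord S ⊤ k (1 - k)) :=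
      funext hev
    rw [this]
    exact hinj.comp (line.scalar_bijective S k hW).1
  have hxU : x ∈ (line S).basicOpen (line.quadPair S ⊤ k f g j) := by
    rw [(h k).basicOpen_eq]
    exact ⟨hk, hj.2⟩
  have hle := (line S).basicOpen_le (line.quadPair S ⊤ k f g j)
  have hψα : ψ.comp ((germ hj).comp (line.scalar S ⊤ j)) = α := by
    refine RingHom.ext fun a => ?_
    refine (stalkMap_germ φ hj (line.basicOpen_quadPair_le hφ (h k) j) hxU _).trans ?_
    refine Eq.trans (congrArg (germ hxU) ?_) (germ_res hle hxU (line.scalar S ⊤ k a))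
    refine (ev_ev _ _ _ _ _).trans ((ev_congr hφ _ _).trans ?_)
    exact (res_ev _ _ _ _).symm
  have hτ : ψ w * germ hk (line.quadPair S ⊤ k f g j) = germ hk (line.quadPair S ⊤ k f g (1 - j)) := by
    have h1 := (h k).eq j (1 - j) _ hle
      ((line.basicOpen_quadPair_le hφ (h k) j).trans (φ.preimage_mono inf_le_right))
    have h2 := congrArg (germ hxU) h1
    rw [map_mul, germ_res, germ_res] at h2
    refine Eq.trans ?_ h2.symm
    rw [mul_comm]
    refine congrArg _ ((stalkMap_germ φ hj (line.basicOpen_quadPair_le hφ (h k) j) hxU _).trans ?_)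
    exact congrArg (germ hxU) (ev_ev _ _ _ _ _)
  obtain ⟨P, Q, hP, hQ, hPQ⟩ : ∃ P Q : Γ(S.left, ⊤)[X],
      eval₂RingHom (line.scalar S ⊤ k) (line.coord S ⊤ k (1 - k)) P = line.quadPair S ⊤ k f g j ∧
      eval₂RingHom (line.scalar S ⊤ k) (line.coord S ⊤ k (1 - k)) Q = line.quadPair S ⊤ k f g (1 - j) ∧
      P * derivative Q - derivative P * Q ≠ 0 := by
    obtain ⟨v, hv, hjv⟩ := exists_quad_polynomial (line.scalar S ⊤ k) k (line.coord_self S ⊤ k)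
    have hne : quad (fun i => C (f i)) v * derivative (quad (fun i => C (g i)) v) -
        derivative (quad (fun i => C (f i)) v) * quad (fun i => C (g i)) v ≠ 0 := fun h0 => by
      have := hjv f g
      rw [h0, map_zero, eq_comm, Ideal.span_singleton_zero, Ideal.span_singleton_eq_bot] at this
      exact hjac k this
    match j with
    | 0 => exact ⟨_, _, hv f, hv g, hne⟩
    | 1 =>
      refine ⟨_, _, hv g, hv f, fun h0 => hne ?_⟩
      rw [← neg_eq_zero, ← h0]
      ring
  have hw' : ψ w * eval₂RingHom α t P = eval₂RingHom α t Q := by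
    rw [hev, hev, hP, hQ, hτ]
  have hτinj := injective_eval₂_of_wronskian hK hM htinj hw' hPQ
  -- A nonzero function on chart j is a polynomial in its coordinate and has nonzero value at the
  -- transcendental τ; the stalk map is local, so the function is already a unit at φ x.
  have hy : IsGenericPoint (φ x) Set.univ := by
    refine isGenericPoint_of_isUnit hx hUj
      ((hx.specializes (Set.mem_univ (φ x))).mem_open (line.chart S ⊤ j).isOpen hj) hj fun s hs => ?_
    obtain ⟨p, rfl⟩ := (line.scalar_bijective S j hW).2 s
    have hp : p ≠ 0 := fun h0 => hs (by rw [h0, map_zero])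
    have h1 : ψ (germ hj (eval₂RingHom (line.scalar S ⊤ j) (line.coord S ⊤ j (1 - j)) p)) =
        eval₂RingHom α (ψ w) p := by
      rw [← hψα]
      exact (congrArg ψ (hom_eval₂ p _ _ _)).trans (hom_eval₂ p _ _ _)
    have h2 := hM.mul_inv_cancel ((map_ne_zero_iff _ hτinj).mpr hp)
    rw [← h1] at h2
    obtain ⟨z, hz⟩ := h2
    exact isUnit_of_map_unit ψ _ (IsUnit.of_mul_eq_one z hz)
  refine ⟨hy, ?_⟩
  have hN := isField_stalk hUj hy hj
  rw [← hψα] at htinj hw' hev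
  refine isSeparable_toAlgebra_of_wronskian hK hN hM htinj hw' hPQ fun z => ?_
  obtain ⟨a, b, hb, e⟩ := exists_germ hUk hk z
  obtain ⟨a, rfl⟩ := (line.scalar_bijective S k hW).2 a
  obtain ⟨b, rfl⟩ := (line.scalar_bijective S k hW).2 b
  refine ⟨a, b, ?_, ?_⟩
  · rw [hev]
    exact hb.ne_zero
  · rw [hev, hev]
    exact e

end Line

/-! ### The moduli problem -/

section ModuliProblem

variable {R : Type u} [CommRing R] {S T : Sch R}

theorem MarkedMap.pts_baseChange (f : T ⟶ S) (x : MarkedMap S) :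
    (x.baseChange f).pts = fun i => f.left ≫ x.pts i := by
  have h : ∀ (r : S.left ⟶ line S) (hr : r ≫ line.proj S = 𝟙 _),
      baseChangeSection f r hr ≫ line.toP1 T = f.left ≫ r ≫ line.toP1 S := fun r hr =>
    line.lift_toP1 _ _ _ _
  funext i
  fin_cases i
  · exact h _ (x.r_proj 0)
  · exact h _ (x.r_proj 1)
  · exact h _ (x.r_proj 2)
  · exact h _ (x.s_proj 0)
  · exact h _ (x.s_proj 1)

/-- Coordinates and polynomial formulas pull back. Stability under base change is proved in this
form, with no base change of ideals or differentials. -/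
theorem MarkedMap.IsStandard.baseChange {x : MarkedMap S} (h : x.IsStandard) (f : T ⟶ S) :
    (x.baseChange f).IsStandard := by
  rw [IsStandard, x.pts_baseChange f]
  refine ⟨h.1.comp f.left, ?_⟩
  have h1 := h.2.comp (line.map f)
  have h2 : (fun i => line.map f ≫ line.proj S ≫ x.pts i) = fun i => line.proj T ≫ f.left ≫ x.pts i :=
    funext fun i => by rw [← Category.assoc, line.map_proj, Category.assoc]
  have h3 : (x.baseChange f).φ ≫ line.toP1 T = line.map f ≫ x.φ ≫ line.toP1 S := line.lift_toP1 _ _ _ _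
  rw [h2, line.map_toP1] at h1
  rwa [h3]

variable [IsLocalization.Away (2 : ℤ) R]

theorem MarkedMap.IsStandard.ext {x y : MarkedMap S} (hx : x.IsStandard) (hy : y.IsStandard)
    (h : ∀ i, x.pts i = y.pts i) : x = y := by
  have h' : x.pts = y.pts := funext h
  refine MarkedMap.ext ?_ (funext fun i => ?_) (funext fun j => ?_)
  · refine line.hom_ext (x.φ_proj.trans y.φ_proj.symm) ?_
    have h2 := hy.2
    rw [← h'] at h2
    exact hx.2.eq h2
  · refine line.hom_ext ((x.r_proj i).trans (y.r_proj i).symm) ?_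
    rw [← x.pts_castAdd, ← y.pts_castAdd, h']
  · refine line.hom_ext ((x.s_proj j).trans (y.s_proj j).symm) ?_
    rw [← x.pts_natAdd, ← y.pts_natAdd, h']

theorem Good.exists_isStandard {p : Fin 5 → (S.left ⟶ P1 R)} (h : Good p) :
    ∃ x : MarkedMap S, x.IsStandard ∧ x.pts = p := by
  obtain ⟨Φ, hΦ⟩ := (h.comp (line.proj S)).exists_isStd (line.toP1 S)
  let x : MarkedMap S :=
    { φ := line.lift S (line.proj S) Φ (toSpec_ext R _ _)
      φ_proj := line.lift_proj _ _ _ _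
      r := fun i => line.lift S (𝟙 _) (p (Fin.castAdd 2 i)) (toSpec_ext R _ _)
      r_proj := fun i => line.lift_proj _ _ _ _
      s := fun j => line.lift S (𝟙 _) (p (Fin.natAdd 3 j)) (toSpec_ext R _ _)
      s_proj := fun j => line.lift_proj _ _ _ _ }
  have hp : x.pts = p := by
    funext i
    fin_cases i <;> exact line.lift_toP1 _ _ _ _
  have hφ : x.φ ≫ line.toP1 S = Φ := line.lift_toP1 _ _ _ _
  exact ⟨x, ⟨hp.symm ▸ h, by rwa [hp, hφ]⟩, hp⟩

/-- The Jacobian is a unit times two linear forms that are nonzero divisors, so it is nonzero. -/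
theorem MarkedMap.IsStandard.isSeparableMorphism {x : MarkedMap S} (h : x.IsStandard)
    [Nonempty S.left] [Subsingleton S.left] (hK : IsField Γ(S.left, ⊤))
    (hW : IsAffineOpen (⊤ : S.left.Opens)) : IsSeparableMorphism x.φ := by
  obtain ⟨U, c, hp, hc⟩ := exists_hasPtsCoords x.pts (Classical.arbitrary S.left)
  obtain rfl : U = ⊤ := top_le_iff.mp fun y _ => Subsingleton.elim (Classical.arbitrary S.left) y ▸ hp
  have : IsDomain Γ(S.left, ⊤) := hK.isDomain
  refine line.isSeparableMorphism x.φ_proj hK hW (h.hasCoords hc) fun k => ?_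
  have := line.isDomain_chart hW k
  have hn := h.1.nondeg hc
  rw [line.quad_jac_stdCoeff]
  have hu := (((isUnit_two S ⊤).mul hn.isUnit_br).mul hn.br).map (line.scalar S ⊤ k)
  exact mul_ne_zero hu.ne_zero (mul_ne_zero
    (nonZeroDivisors.ne_zero (line.linForm_mem_nonZeroDivisors hW k (hc 3).coprime))
    (nonZeroDivisors.ne_zero (line.linForm_mem_nonZeroDivisors hW k (hc 4).coprime)))

theorem MarkedMap.IsStandard.separable {x : MarkedMap S} (h : x.IsStandard) (p : S.left) :
    IsSeparableMorphism (fibreEnd x.φ x.φ_proj p) := by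
  have h1 := h.baseChange (T := Over.mk (S.left.fromSpecResidueField p ≫ S.hom))
    (Over.homMk (S.left.fromSpecResidueField p))
  have : Nonempty (Over.mk (S.left.fromSpecResidueField p ≫ S.hom)).left :=
    inferInstanceAs (Nonempty (Spec (S.left.residueField p)))
  have : Subsingleton (Over.mk (S.left.fromSpecResidueField p ≫ S.hom)).left :=
    inferInstanceAs (Subsingleton (Spec (S.left.residueField p)))
  have : IsAffine (Over.mk (S.left.fromSpecResidueField p ≫ S.hom)).left :=
    inferInstanceAs (IsAffine (Spec (S.left.residueField p)))
  exact h1.isSeparableMorphism (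
    (Scheme.ΓSpecIso (S.left.residueField p)).commRingCatIsoToRingEquiv.toMulEquiv.isField
      (Field.toIsField (S.left.residueField p))) (isAffineOpen_top _)

/-- Functoriality and representability reduce through this equivalence to statements about five
points. -/
theorem MarkedMap.isTotallyMarked_iff {x : MarkedMap S} : x.IsTotallyMarked ↔ x.IsStandard :=
  ⟨fun h => h.isStandard, fun h =>
    ⟨h.degree_two, h.separable, h.fixed, h.fixed_divisor, h.ramification⟩⟩

variable (R) in
/-- The functor of totally marked maps. -/
def totallyMarkedFunctor : Subfunctor (markedMapFunctor R) where
  obj S := {x : MarkedMap S.unop | x.IsTotallyMarked}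
  map f _ hx := MarkedMap.isTotallyMarked_iff.mpr ((MarkedMap.isTotallyMarked_iff.mp hx).baseChange f.unop)

variable (R) in
/-- The universal totally marked map. -/
def univMap : MarkedMap (ratTM R) := (ratTM.good (R := R)).exists_isStandard.choose

theorem univMap_isStandard : (univMap R).IsStandard := (ratTM.good (R := R)).exists_isStandard.choose_spec.1

theorem univMap_pts : (univMap R).pts = ratTM.point R := (ratTM.good (R := R)).exists_isStandard.choose_spec.2

theorem pts_baseChange_univMap (f : S ⟶ ratTM R) (i : Fin 5) :
    ((univMap R).baseChange f).pts i = f.left ≫ ratTM.point R i := by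
  rw [MarkedMap.pts_baseChange, univMap_pts]

variable (R) in
/-- The functor of totally marked maps is represented by `ratTM R`. -/
def representableBy : (totallyMarkedFunctor R).toFunctor.RepresentableBy (ratTM R) where
  homEquiv {S} := Equiv.ofBijective
    (fun f => (⟨(univMap R).baseChange f, MarkedMap.isTotallyMarked_iff.mpr (univMap_isStandard.baseChange f)⟩ :
      (totallyMarkedFunctor R).toFunctor.obj (op S)))
    -- The marked points of a pullback are the coordinates of the morphism, which gives injectivity.
    -- For surjectivity, the points of x are in general position and define a morphism, and a
    -- standard map is determined by its points.
    ⟨fun f g h => ratTM.hom_ext fun i => by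
      rw [← pts_baseChange_univMap, ← pts_baseChange_univMap]
      exact congrArg (fun x => MarkedMap.pts x.1 i) h, fun x => by
      have hx := MarkedMap.isTotallyMarked_iff.mp x.2
      obtain ⟨f, hf⟩ := exists_hom_ratTM hx.1
      refine ⟨f, Subtype.ext ((univMap_isStandard.baseChange f).ext hx fun i => ?_)⟩
      rw [pts_baseChange_univMap, hf]⟩
  homEquiv_comp f g := Subtype.ext (MarkedMap.baseChange_comp f g _)

end ModuliProblem

end TotallyMarked

end

/-- `R` is the ring `ℤ[1/2]`. Totally marked degree two rational maps form a subfunctor `F` of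
the functor of all marked maps, that is, they are stable under base change, and `F` is represented
by `ratTM R`, the marked points of the universal map being the coordinates of `ratTM R`. -/
theorem theorem4p3 (R : Type u) [CommRing R] [IsLocalization.Away (2 : ℤ) R] :
    ∃ F : Subfunctor (TotallyMarked.markedMapFunctor R),
      (∀ S : TotallyMarked.Sch R,
        F.obj (op S) = {x : TotallyMarked.MarkedMap S | x.IsTotallyMarked}) ∧
      ∃ h : F.toFunctor.RepresentableBy (TotallyMarked.ratTM R),
        ∀ (S : TotallyMarked.Sch R) (f : S ⟶ TotallyMarked.ratTM R) (x : TotallyMarked.MarkedMap S),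
          x = (h.homEquiv f).1 →
          (∀ i : Fin 3, x.r i ≫ TotallyMarked.line.toP1 S =
            f.left ≫ TotallyMarked.ratTM.point R (Fin.castAdd 2 i)) ∧
          (∀ j : Fin 2, x.s j ≫ TotallyMarked.line.toP1 S =
            f.left ≫ TotallyMarked.ratTM.point R (Fin.natAdd 3 j)) := by
  refine ⟨TotallyMarked.totallyMarkedFunctor R, fun S => rfl, TotallyMarked.representableBy R, ?_⟩
  rintro S f x rfl
  refine ⟨fun i => ?_, fun j => ?_⟩
  · exact (TotallyMarked.MarkedMap.pts_castAdd _ i).symm.trans (TotallyMarked.pts_baseChange_univMap f _)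
  · exact (TotallyMarked.MarkedMap.pts_natAdd _ j).symm.trans (TotallyMarked.pts_baseChange_univMap f _)
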